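/- An object is a nonempty, bounded, connected subset of $\mathbb{R}^d$ ($d\ge 1$), and its size is the side length of a minimal (axis-parallel) enclosing hypercube. A collection $S$ of objects is $f$-fat if for every $r>0$ and every axis-parallel hypercube $R$ of side length $r$ there are $f$ points such that every object of $S$ that intersects $R$ and has size at least $r$ contains one of these points. A hypercube $s$ with positive side length is regarded as a separating surface: an object is entirely inside $s$ if it is contained in the interior of the solid hypercube, entirely outside $s$ if it is disjoint from the closed solid hypercube, and it intersects $s$ if it meets the boundary of the hypercube. Algorithms run on a real RAM: unit-cost arithmetic and comparisons on natural numbers and on real numbers, indirect addressing, no rounding of reals to integers. The numbers $d,|S_1|,|S_2|$ are given, and every object is given by an arbitrary representative point in it, the center and side length of a minimal enclosing hypercube, and a query operation which decides, in time $O(d)$, whether the object lies entirely inside a given hypercube, entirely outside it, or neither. Lemma. There are an algorithm, an absolute constant $C$ and numbers $K(f,d)$ such that the following holds for all $d\ge 1$ and $f$. Let $S_1$ and $S_2$ be two finite $f$-fat collections of objects in $\mathbb{R}^d$, the objects within each collection being pairwise disjoint, and let $n=|S_1|+|S_2|$. In time at most $C\cdot d\cdot \max(n,1)$ the algorithm computes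 an axis-parallel hypercube $s$ and the sets $S_1^{\mathrm{in}}\subseteq S_1$, $S_2^{\mathrm{in}}\subseteq S_2$ of all objects that lie entirely inside $s$ and the sets $S_1^{\mathrm{out}}\subseteq S_1$, $S_2^{\mathrm{out}}\subseteq S_2$ of all objects that lie entirely outside $s$, such that $s$ intersects at most $K(f,d)\,n^{1-1/d}$ objects of $S_1\cup S_2$, and $$|S_1^{\mathrm{in}}|\le \frac{4^d-1}{4^d}\,|S_1|,\qquad |S_1^{\mathrm{out}}|\le \frac{4^d-1}{4^d}\,|S_1|.$$ -/

import Mathlib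

namespace FatSep

/-! Geometry. Points of `ℝ^d` are functions `Fin d → ℝ`. -/

/-- The closed solid axis-parallel hypercube with center `c` and side length `r`. -/
def cube {d : ℕ} (c : Fin d → ℝ) (r : ℝ) : Set (Fin d → ℝ) :=
  {x | ∀ j, |x j - c j| ≤ r / 2}

/-- `cube c r` is a minimal enclosing hypercube of `A`. -/
def IsMinEnclosing {d : ℕ} (A : Set (Fin d → ℝ)) (c : Fin d → ℝ) (r : ℝ) : Prop :=
  A ⊆ cube c r ∧ ∀ (c' : Fin d → ℝ) (r' : ℝ), A ⊆ cube c' r' → r ≤ r'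

/-- The size of an object: the side length of its minimal enclosing hypercubes. -/
noncomputable def objSize {d : ℕ} (A : Set (Fin d → ℝ)) : ℝ :=
  sInf {r | 0 ≤ r ∧ ∃ c, A ⊆ cube c r}

/-- A family of objects is `f`-fat if for every hypercube `R` of side length `r` there are
(at most) `f` points such that every object that intersects `R` and has size at least `r`
contains one of these points. -/
def IsFat {d : ℕ} {ι : Type*} (f : ℕ) (S : ι → Set (Fin d → ℝ)) : Prop :=
  ∀ (c : Fin d → ℝ) (r : ℝ), 0 < r → ∃ P : Finset (Fin d → ℝ), P.card ≤ f ∧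
    ∀ i, (S i ∩ cube c r).Nonempty → r ≤ objSize (S i) → ∃ p ∈ P, p ∈ S i

/-- The object `A` intersects the separator, that is, the boundary of the hypercube. -/
def Crosses {d : ℕ} (A : Set (Fin d → ℝ)) (c : Fin d → ℝ) (r : ℝ) : Prop :=
  (A ∩ frontier (cube c r)).Nonempty

/-- The object `A` lies entirely inside the separator. -/
def LiesInside {d : ℕ} (A : Set (Fin d → ℝ)) (c : Fin d → ℝ) (r : ℝ) : Prop :=
  A ⊆ interior (cube c r)

/-- The object `A` lies entirely outside the separator. -/
def LiesOutside {d : ℕ} (A : Set (Fin d → ℝ)) (c : Fin d → ℝ) (r : ℝ) : Prop :=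
  Disjoint A (cube c r)

open scoped Classical in
/-- Position of an object relative to a hypercube: `0` for inside, `1` for outside, and `2`
otherwise (for a connected object: it intersects the boundary). -/
noncomputable def position {d : ℕ} (A : Set (Fin d → ℝ)) (c : Fin d → ℝ) (r : ℝ) : ℕ :=
  if LiesInside A c r then 0 else if LiesOutside A c r then 1 else 2

/-! The machine: a real RAM. It has an infinite memory of natural numbers and an infinite memory
of real numbers, both with indirect addressing, arithmetic and comparisons (there is no rounding
of reals to integers), structured control flow and recursive parameterless procedures. Every
operation has unit cost, except the query for the position of an object of the input relative to
a hypercube, which costs `d + 1`, the number of reals that describe the hypercube. -/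

/-- The memory of the machine. -/
structure State where
  nat : ℕ → ℕ
  real : ℕ → ℝ

/-- Expressions for natural numbers (also used as addresses); `get a` reads the cell `a` of the
memory of natural numbers, `sub` is truncated. -/
inductive NatExpr where
  | lit (k : ℕ)
  | get (a : NatExpr)
  | add (e₁ e₂ : NatExpr)
  | sub (e₁ e₂ : NatExpr)
  | mul (e₁ e₂ : NatExpr)

def NatExpr.eval (σ : State) : NatExpr → ℕ
  | .lit k => k
  | .get a => σ.nat (a.eval σ)
  | .add e₁ e₂ => e₁.eval σ + e₂.eval σ
  | .sub e₁ e₂ => e₁.eval σ - e₂.eval σ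
  | .mul e₁ e₂ => e₁.eval σ * e₂.eval σ

def NatExpr.cost : NatExpr → ℕ
  | .lit _ => 1
  | .get a => a.cost + 1
  | .add e₁ e₂ => e₁.cost + e₂.cost + 1
  | .sub e₁ e₂ => e₁.cost + e₂.cost + 1
  | .mul e₁ e₂ => e₁.cost + e₂.cost + 1

/-- Expressions for real numbers; `get a` reads the cell `a` of the memory of reals. -/
inductive RealExpr where
  | ofNat (e : NatExpr)
  | get (a : NatExpr)
  | add (e₁ e₂ : RealExpr)
  | sub (e₁ e₂ : RealExpr)
  | mul (e₁ e₂ : RealExpr)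
  | div (e₁ e₂ : RealExpr)

noncomputable def RealExpr.eval (σ : State) : RealExpr → ℝ
  | .ofNat e => (e.eval σ : ℝ)
  | .get a => σ.real (a.eval σ)
  | .add e₁ e₂ => e₁.eval σ + e₂.eval σ
  | .sub e₁ e₂ => e₁.eval σ - e₂.eval σ
  | .mul e₁ e₂ => e₁.eval σ * e₂.eval σ
  | .div e₁ e₂ => e₁.eval σ / e₂.eval σ

def RealExpr.cost : RealExpr → ℕ
  | .ofNat e => e.cost + 1
  | .get a => a.cost + 1
  | .add e₁ e₂ => e₁.cost + e₂.cost + 1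
  | .sub e₁ e₂ => e₁.cost + e₂.cost + 1
  | .mul e₁ e₂ => e₁.cost + e₂.cost + 1
  | .div e₁ e₂ => e₁.cost + e₂.cost + 1

/-- Tests. -/
inductive Test where
  | natLe (e₁ e₂ : NatExpr)
  | realLe (e₁ e₂ : RealExpr)
  | not (b : Test)
  | and (b₁ b₂ : Test)

def Test.Holds (σ : State) : Test → Prop
  | .natLe e₁ e₂ => e₁.eval σ ≤ e₂.eval σ
  | .realLe e₁ e₂ => e₁.eval σ ≤ e₂.eval σ
  | .not b => ¬ b.Holds σ
  | .and b₁ b₂ => b₁.Holds σ ∧ b₂.Holds σ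

def Test.cost : Test → ℕ
  | .natLe e₁ e₂ => e₁.cost + e₂.cost + 1
  | .realLe e₁ e₂ => e₁.cost + e₂.cost + 1
  | .not b => b.cost + 1
  | .and b₁ b₂ => b₁.cost + b₂.cost + 1

/-- Commands. `setNat a e` and `setReal a e` write the value of `e` into the cell with address
`a`; `call p` runs the procedure number `p`; `query a o s` writes into the cell `a` of the memory
of natural numbers the position of the input object number `o` relative to the hypercube stored
in the memory of reals from address `s` on (`d` center coordinates, then the side length). -/
inductive Cmd where
  | skip
  | setNat (a e : NatExpr)
  | setReal (a : NatExpr) (e : RealExpr)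
  | query (a o s : NatExpr)
  | seq (p q : Cmd)
  | ite (b : Test) (p q : Cmd)
  | loop (b : Test) (p : Cmd)
  | call (p : ℕ)

/-- A program: the main command and a finite list of procedures. -/
structure Program where
  main : Cmd
  procs : List Cmd

def State.setNat (σ : State) (a v : ℕ) : State :=
  { σ with nat := Function.update σ.nat a v }

noncomputable def State.setReal (σ : State) (a : ℕ) (v : ℝ) : State :=
  { σ with real := Function.update σ.real a v }

/-- `Exec X procs p σ τ t`: on the input objects `X`, with the procedures `procs`, the command `p`
started in the memory `σ` terminates in the memory `τ` after exactly `t` units of time. -/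
inductive Exec {d n : ℕ} (X : Fin n → Set (Fin d → ℝ)) (procs : List Cmd) :
    Cmd → State → State → ℕ → Prop where
  | skip (σ : State) : Exec X procs .skip σ σ 1
  | setNat (σ : State) (a e : NatExpr) :
      Exec X procs (.setNat a e) σ (σ.setNat (a.eval σ) (e.eval σ)) (a.cost + e.cost + 1)
  | setReal (σ : State) (a : NatExpr) (e : RealExpr) :
      Exec X procs (.setReal a e) σ (σ.setReal (a.eval σ) (e.eval σ)) (a.cost + e.cost + 1)
  | query (σ : State) (a o s : NatExpr) (h : o.eval σ < n) :
      Exec X procs (.query a o s) σ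
        (σ.setNat (a.eval σ)
          (position (X ⟨o.eval σ, h⟩) (fun j => σ.real (s.eval σ + j)) (σ.real (s.eval σ + d))))
        (a.cost + o.cost + s.cost + (d + 1))
  | seq {p q : Cmd} {σ₁ σ₂ σ₃ : State} {t₁ t₂ : ℕ} (h₁ : Exec X procs p σ₁ σ₂ t₁)
      (h₂ : Exec X procs q σ₂ σ₃ t₂) : Exec X procs (.seq p q) σ₁ σ₃ (t₁ + t₂)
  | iteTrue {b : Test} {p q : Cmd} {σ τ : State} {t : ℕ} (hb : b.Holds σ)
      (h : Exec X procs p σ τ t) : Exec X procs (.ite b p q) σ τ (b.cost + 1 + t)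
  | iteFalse {b : Test} {p q : Cmd} {σ τ : State} {t : ℕ} (hb : ¬ b.Holds σ)
      (h : Exec X procs q σ τ t) : Exec X procs (.ite b p q) σ τ (b.cost + 1 + t)
  | loopTrue {b : Test} {p : Cmd} {σ₁ σ₂ σ₃ : State} {t₁ t₂ : ℕ} (hb : b.Holds σ₁)
      (h₁ : Exec X procs p σ₁ σ₂ t₁) (h₂ : Exec X procs (.loop b p) σ₂ σ₃ t₂) :
      Exec X procs (.loop b p) σ₁ σ₃ (b.cost + 1 + t₁ + t₂)
  | loopFalse {b : Test} {p : Cmd} {σ : State} (hb : ¬ b.Holds σ) :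
      Exec X procs (.loop b p) σ σ (b.cost + 1)
  | call {k : ℕ} {p : Cmd} {σ τ : State} {t : ℕ} (hk : procs[k]? = some p)
      (h : Exec X procs p σ τ t) : Exec X procs (.call k) σ τ (t + 1)

/-- The input format. The first three natural number cells hold `d`, `n₁`, `n₂`; the memory of
reals holds one record of `2 * d + 1` cells per object: the coordinates of a representative point,
the coordinates of the center of a minimal enclosing hypercube, and its side length. All other
cells may hold arbitrary values. -/
def IsInput {d : ℕ} (n₁ n₂ : ℕ) (rep center : Fin (n₁ + n₂) → Fin d → ℝ)
    (side : Fin (n₁ + n₂) → ℝ) (σ : State) : Prop :=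
  σ.nat 0 = d ∧ σ.nat 1 = n₁ ∧ σ.nat 2 = n₂ ∧
    ∀ i : Fin (n₁ + n₂),
      (∀ j : Fin d, σ.real (i * (2 * d + 1) + j) = rep i j) ∧
      (∀ j : Fin d, σ.real (i * (2 * d + 1) + d + j) = center i j) ∧
      σ.real (i * (2 * d + 1) + 2 * d) = side i

/-- The output format. The natural number cell `0` holds the address of the computed hypercube in
the memory of reals (`d` center coordinates, then the side length), and the natural number cell `1`
holds the address of an array of natural numbers with one entry `0`, `1` or `2` per object: `0`
stands for the sets of inside objects, `1` for the sets of outside objects. -/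
def IsOutput {d n : ℕ} (τ : State) (c : Fin d → ℝ) (r : ℝ) (inside outside : Set (Fin n)) : Prop :=
  (∀ j : Fin d, τ.real (τ.nat 0 + j) = c j) ∧ τ.real (τ.nat 0 + d) = r ∧
    ∀ i : Fin n, τ.nat (τ.nat 1 + i) ≤ 2 ∧
      (i ∈ inside ↔ τ.nat (τ.nat 1 + i) = 0) ∧ (i ∈ outside ↔ τ.nat (τ.nat 1 + i) = 1)

end FatSep

namespace FatSep

infixr:60 " ;; " => Cmd.seq

/-- The natural number register with number `k`. -/
abbrev rg (k : ℕ) : NatExpr := .get (.lit k)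

attribute [simp] NatExpr.eval NatExpr.cost RealExpr.eval RealExpr.cost Test.Holds Test.cost

@[simp] theorem State.setNat_nat (σ : State) (a v b : ℕ) :
    (σ.setNat a v).nat b = if b = a then v else σ.nat b := by
  simp [State.setNat, Function.update_apply]

@[simp] theorem State.setNat_real (σ : State) (a v : ℕ) : (σ.setNat a v).real = σ.real := rfl

@[simp] theorem State.setReal_real (σ : State) (a : ℕ) (v : ℝ) (b : ℕ) :
    (σ.setReal a v).real b = if b = a then v else σ.real b := by
  simp [State.setReal, Function.update_apply]

@[simp] theorem State.setReal_nat (σ : State) (a : ℕ) (v : ℝ) : (σ.setReal a v).nat = σ.nat := rfl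

section Logic

variable {d n : ℕ} (X : Fin n → Set (Fin d → ℝ)) (ps : List Cmd)

/-- The command `p` started in `σ` terminates, and its final state and running time satisfy `Q`. -/
def W (p : Cmd) (σ : State) (Q : State → ℕ → Prop) : Prop :=
  ∃ τ t, Exec X ps p σ τ t ∧ Q τ t

variable {X ps}

theorem W.mono {p : Cmd} {σ : State} {Q Q' : State → ℕ → Prop} (h : W X ps p σ Q)
    (hQ : ∀ τ t, Q τ t → Q' τ t) : W X ps p σ Q' := by
  obtain ⟨τ, t, h, hq⟩ := h
  exact ⟨τ, t, h, hQ _ _ hq⟩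

theorem W.skip {σ : State} {Q : State → ℕ → Prop} (h : Q σ 1) : W X ps .skip σ Q :=
  ⟨_, _, .skip σ, h⟩

theorem W.setNat {σ : State} {a e : NatExpr} {Q : State → ℕ → Prop}
    (h : Q (σ.setNat (a.eval σ) (e.eval σ)) (a.cost + e.cost + 1)) :
    W X ps (.setNat a e) σ Q :=
  ⟨_, _, .setNat σ a e, h⟩

theorem W.setReal {σ : State} {a : NatExpr} {e : RealExpr} {Q : State → ℕ → Prop}
    (h : Q (σ.setReal (a.eval σ) (e.eval σ)) (a.cost + e.cost + 1)) :
    W X ps (.setReal a e) σ Q :=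
  ⟨_, _, .setReal σ a e, h⟩

theorem W.query {σ : State} {a o s : NatExpr} {Q : State → ℕ → Prop} (ho : o.eval σ < n)
    (h : Q (σ.setNat (a.eval σ)
        (position (X ⟨o.eval σ, ho⟩) (fun j => σ.real (s.eval σ + j)) (σ.real (s.eval σ + d))))
        (a.cost + o.cost + s.cost + (d + 1))) :
    W X ps (.query a o s) σ Q :=
  ⟨_, _, .query σ a o s ho, h⟩

theorem W.seq {p q : Cmd} {σ : State} {Q : State → ℕ → Prop}
    (h : W X ps p σ (fun τ t => W X ps q τ (fun τ' t' => Q τ' (t + t')))) :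
    W X ps (p ;; q) σ Q := by
  obtain ⟨τ, t, h, τ', t', h', hQ⟩ := h
  exact ⟨τ', _, .seq h h', hQ⟩

theorem W.ite {b : Test} {p q : Cmd} {σ : State} {Q : State → ℕ → Prop}
    (h₁ : b.Holds σ → W X ps p σ (fun τ t => Q τ (b.cost + 1 + t)))
    (h₂ : ¬ b.Holds σ → W X ps q σ (fun τ t => Q τ (b.cost + 1 + t))) :
    W X ps (.ite b p q) σ Q := by
  by_cases hb : b.Holds σ
  · obtain ⟨τ, t, h, hQ⟩ := h₁ hb
    exact ⟨τ, _, .iteTrue hb h, hQ⟩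
  · obtain ⟨τ, t, h, hQ⟩ := h₂ hb
    exact ⟨τ, _, .iteFalse hb h, hQ⟩

theorem W.call {k : ℕ} {p : Cmd} {σ : State} {Q : State → ℕ → Prop} (hk : ps[k]? = some p)
    (h : W X ps p σ (fun τ t => Q τ (t + 1))) : W X ps (.call k) σ Q := by
  obtain ⟨τ, t, h, hQ⟩ := h
  exact ⟨τ, _, .call hk h, hQ⟩

/-- A loop with invariant `I` whose cost is paid by the potential `Φ`. -/
theorem W.loop {b : Test} {p : Cmd} {σ : State} {Q : State → ℕ → Prop} (I : State → Prop)
    (Φ : State → ℕ) (h0 : I σ)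
    (hstep : ∀ σ', I σ' → b.Holds σ' →
      W X ps p σ' (fun τ t => I τ ∧ b.cost + 1 + t + Φ τ ≤ Φ σ'))
    (hQ : ∀ τ t, I τ → ¬ b.Holds τ → t + Φ τ ≤ Φ σ + b.cost + 1 → Q τ t) :
    W X ps (.loop b p) σ Q := by
  suffices H : ∀ N, ∀ σ', Φ σ' = N → I σ' → ∃ τ t, Exec X ps (.loop b p) σ' τ t ∧
      I τ ∧ ¬ b.Holds τ ∧ t + Φ τ ≤ Φ σ' + b.cost + 1 by
    obtain ⟨τ, t, he, h1, h2, h3⟩ := H _ σ rfl h0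
    exact ⟨τ, t, he, hQ _ _ h1 h2 h3⟩
  intro N
  induction N using Nat.strong_induction_on with
  | _ N ih =>
    intro σ' hN hI
    by_cases hb : b.Holds σ'
    · obtain ⟨τ, t, he, hI', ht⟩ := hstep σ' hI hb
      obtain ⟨τ', t', he', h1, h2, h3⟩ := ih (Φ τ) (by omega) τ rfl hI'
      exact ⟨τ', _, .loopTrue hb he he', h1, h2, by omega⟩
    · exact ⟨σ', _, .loopFalse hb, hI, hb, by omega⟩

end Logic

/-- The list of the `m` reals stored from address `B` on. -/
def arr (σ : State) (B m : ℕ) : List ℝ := (List.range m).map fun i => σ.real (B + i)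

@[simp] theorem arr_zero (σ : State) (B : ℕ) : arr σ B 0 = [] := rfl

theorem arr_succ (σ : State) (B m : ℕ) : arr σ B (m + 1) = arr σ B m ++ [σ.real (B + m)] := by
  simp [arr, List.range_succ]

@[simp] theorem arr_length (σ : State) (B m : ℕ) : (arr σ B m).length = m := by simp [arr]

theorem arr_congr {σ τ : State} {B m : ℕ} (h : ∀ a, B ≤ a → a < B + m → τ.real a = σ.real a) :
    arr τ B m = arr σ B m := by
  unfold arr
  apply List.map_congr_left
  intro i hi
  rw [List.mem_range] at hi
  exact h _ (by omega) (by omega)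

theorem arr_setNat (σ : State) (a v B m : ℕ) : arr (σ.setNat a v) B m = arr σ B m := rfl

theorem arr_setReal (σ : State) (a : ℕ) (v : ℝ) (B m : ℕ) (h : a < B ∨ B + m ≤ a) :
    arr (σ.setReal a v) B m = arr σ B m := by
  apply arr_congr
  intro b h1 h2
  rw [State.setReal_real, if_neg (by omega)]

theorem arr_push (σ : State) (v : ℝ) (B m : ℕ) :
    arr (σ.setReal (B + m) v) B (m + 1) = arr σ B m ++ [v] := by
  rw [arr_succ, arr_setReal _ _ _ _ _ (by omega)]
  simp

/-- The number of entries below `v`. -/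
noncomputable def cntLt (v : ℝ) (L : List ℝ) : ℕ := L.countP fun x => decide (x < v)
/-- The number of entries that are at most `v`. -/
noncomputable def cntLe (v : ℝ) (L : List ℝ) : ℕ := L.countP fun x => decide (x ≤ v)
/-- The number of entries that are at least `v`. -/
noncomputable def cntGe (v : ℝ) (L : List ℝ) : ℕ := L.countP fun x => decide (v ≤ x)
/-- The number of entries above `v`. -/
noncomputable def cntGt (v : ℝ) (L : List ℝ) : ℕ := L.countP fun x => decide (v < x)

theorem cntLt_add_cntGe (v : ℝ) (L : List ℝ) : cntLt v L + cntGe v L = L.length := by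
  rw [List.length_eq_countP_add_countP (fun x => decide (x < v))]
  simp [cntLt, cntGe]

theorem cntLe_add_cntGt (v : ℝ) (L : List ℝ) : cntLe v L + cntGt v L = L.length := by
  rw [List.length_eq_countP_add_countP (fun x => decide (x ≤ v))]
  simp [cntLe, cntGt]

/-- `v` is a quantile of `L`: its rank is `T / 4`. -/
def IsQuantile (L : List ℝ) (T : ℕ) (v : ℝ) : Prop := 4 * cntLt v L < T ∧ T ≤ 4 * cntLe v L

theorem IsQuantile.of_low {L : List ℝ} {T : ℕ} {p v : ℝ} (hT : T ≤ 4 * cntLt p L)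
    (h : IsQuantile (L.filter fun x => decide (x < p)) T v) : IsQuantile L T v := by
  obtain ⟨h1, h2⟩ := h
  have hv : v < p := by
    by_contra hv
    have : cntLt v (L.filter fun x => decide (x < p)) = cntLt p L := by
      unfold cntLt
      rw [List.countP_filter]
      congr 1
      ext x
      simp only [← Bool.decide_and, decide_eq_decide]
      exact ⟨fun h => h.2, fun h => ⟨lt_of_lt_of_le h (not_lt.1 hv), h⟩⟩
    omega
  unfold IsQuantile cntLt cntLe at *
  rw [List.countP_filter] at h1 h2
  simp only [← Bool.decide_and] at h1 h2
  have e1 : ∀ x, (x < v ∧ x < p) = (x < v) := fun x =>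
    propext ⟨fun h => h.1, fun h => ⟨h, h.trans hv⟩⟩
  have e2 : ∀ x, (x ≤ v ∧ x < p) = (x ≤ v) := fun x =>
    propext ⟨fun h => h.1, fun h => ⟨h, h.trans_lt hv⟩⟩
  simp only [e1, e2] at h1 h2
  exact ⟨h1, h2⟩

theorem countP_split (L : List ℝ) (P Q R : ℝ → Prop) [DecidablePred P] [DecidablePred Q]
    [DecidablePred R] (h : ∀ x, P x ↔ Q x ∨ R x) (h' : ∀ x, ¬ (Q x ∧ R x)) :
    L.countP (fun x => decide (P x)) =
      L.countP (fun x => decide (Q x)) + L.countP (fun x => decide (R x)) := by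
  induction L with
  | nil => simp
  | cons a L ih =>
    have h1 := h a
    have h2 := h' a
    by_cases hq : Q a <;> by_cases hr : R a <;> simp_all [List.countP_cons] <;> omega

theorem IsQuantile.of_high {L : List ℝ} {T : ℕ} {p v : ℝ} (hT : 4 * cntLe p L < T)
    (h : IsQuantile (L.filter fun x => decide (p < x)) (T - 4 * cntLe p L) v) :
    IsQuantile L T v := by
  obtain ⟨h1, h2⟩ := h
  have hv : p < v := by
    by_contra hv
    have : cntLe v (L.filter fun x => decide (p < x)) = 0 := by
      unfold cntLe
      rw [List.countP_eq_zero]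
      intro x hx
      simp at hx ⊢
      exact lt_of_le_of_lt (not_lt.1 hv) hx.2
    omega
  unfold IsQuantile
  have e1 : cntLt v L = cntLe p L + cntLt v (L.filter fun x => decide (p < x)) := by
    unfold cntLt cntLe
    rw [List.countP_filter]
    simp only [← Bool.decide_and]
    apply countP_split
    · intro x
      constructor
      · intro h
        rcases le_or_gt x p with hx | hx
        · exact Or.inl hx
        · exact Or.inr ⟨h, hx⟩
      · rintro (h | h)
        · exact h.trans_lt hv
        · exact h.1
    · intro x h
      exact absurd h.1 (not_le.2 h.2.2)
  have e2 : cntLe v L = cntLe p L + cntLe v (L.filter fun x => decide (p < x)) := by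
    unfold cntLe
    rw [List.countP_filter]
    simp only [← Bool.decide_and]
    apply countP_split
    · intro x
      constructor
      · intro h
        rcases le_or_gt x p with hx | hx
        · exact Or.inl hx
        · exact Or.inr ⟨h, hx⟩
      · rintro (h | h)
        · exact h.trans hv.le
        · exact h.1
    · intro x h
      exact absurd h.1 (not_le.2 h.2.2)
  omega

/-- The saved value number `k` on top of the stack. -/
abbrev stk (k : ℕ) : NatExpr := .get (.add (rg 5) (.lit k))

/-- Partition of the array at address `rg 7` of length `rg 8` by the pivot in the real register:
the smaller entries go to the address `rg 6`, the larger ones to `rg 6 + rg 8`. -/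
def partitionCmd : Cmd :=
  .setNat (.lit 10) (.lit 0) ;; .setNat (.lit 11) (.lit 0) ;; .setNat (.lit 12) (.lit 0) ;;
  .loop (.natLe (.add (rg 10) (.lit 1)) (rg 8))
    (.ite (.not (.realLe (.get (rg 4)) (.get (.add (rg 7) (rg 10)))))
      (.setReal (.add (rg 6) (rg 11)) (.get (.add (rg 7) (rg 10))) ;;
        .setNat (.lit 11) (.add (rg 11) (.lit 1)))
      (.ite (.not (.realLe (.get (.add (rg 7) (rg 10))) (.get (rg 4))))
        (.setReal (.add (.add (rg 6) (rg 8)) (rg 12)) (.get (.add (rg 7) (rg 10))) ;;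
          .setNat (.lit 12) (.add (rg 12) (.lit 1)))
        .skip) ;;
    .setNat (.lit 10) (.add (rg 10) (.lit 1)))

section Select

variable {d n : ℕ} {X : Fin n → Set (Fin d → ℝ)} {ps : List Cmd}

theorem partitionCmd_spec (σ : State) (h1 : σ.nat 4 < σ.nat 6)
    (h2 : σ.nat 7 + σ.nat 8 ≤ σ.nat 6) :
    W X ps partitionCmd σ fun τ t => t ≤ 100 * σ.nat 8 + 100 ∧
      (∀ a, a ∉ [10, 11, 12] → τ.nat a = σ.nat a) ∧
      (∀ a, a < σ.nat 6 → τ.real a = σ.real a) ∧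
      arr τ (σ.nat 6) (τ.nat 11) =
        (arr σ (σ.nat 7) (σ.nat 8)).filter (fun x => decide (x < σ.real (σ.nat 4))) ∧
      arr τ (σ.nat 6 + σ.nat 8) (τ.nat 12) =
        (arr σ (σ.nat 7) (σ.nat 8)).filter (fun x => decide (σ.real (σ.nat 4) < x)) := by
  unfold partitionCmd
  refine .seq (.setNat (.seq (.setNat (.seq (.setNat ?_)))))
  refine .loop (fun τ => τ.nat 10 ≤ σ.nat 8 ∧ τ.nat 11 + τ.nat 12 ≤ τ.nat 10 ∧
      (∀ a, a ∉ [10, 11, 12] → τ.nat a = σ.nat a) ∧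
      (∀ a, a < σ.nat 6 → τ.real a = σ.real a) ∧
      arr τ (σ.nat 6) (τ.nat 11) =
        (arr σ (σ.nat 7) (τ.nat 10)).filter (fun x => decide (x < σ.real (σ.nat 4))) ∧
      arr τ (σ.nat 6 + σ.nat 8) (τ.nat 12) =
        (arr σ (σ.nat 7) (τ.nat 10)).filter (fun x => decide (σ.real (σ.nat 4) < x)))
    (fun τ => 100 * (σ.nat 8 - τ.nat 10)) ?_ ?_ ?_
  · simp +contextual
  · rintro τ ⟨i1, i2, i3, i4, i5, i6⟩ hb
    have r4 := i3 4 (by decide)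
    have r6 := i3 6 (by decide)
    have r7 := i3 7 (by decide)
    have r8 := i3 8 (by decide)
    simp [r8] at hb
    have hx : τ.real (σ.nat 7 + τ.nat 10) = σ.real (σ.nat 7 + τ.nat 10) := i4 _ (by omega)
    have hp : τ.real (σ.nat 4) = σ.real (σ.nat 4) := i4 _ (by omega)
    refine .seq (.ite ?_ ?_)
    · intro hlt
      simp [r4, r7, hx, hp] at hlt
      refine .seq (.setReal (.setNat (.setNat ?_)))
      simp [r6, r7, r8, hx, arr_setNat, arr_push]
      refine ⟨⟨by omega, by omega, ?_, ?_, ?_, ?_⟩, by omega⟩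
      · intro a h1 h2 h3
        simp [h1, h2, i3 a (by simp [h1, h2, h3])]
      · intro a ha
        rw [if_neg (by omega), i4 a ha]
      · rw [arr_succ, List.filter_append, i5]
        simp [hlt]
      · rw [arr_succ, List.filter_append, arr_setReal _ _ _ _ _ (by omega), i6]
        simp [hlt.le]
    · intro hle
      simp [r4, r7, hx, hp] at hle
      refine .ite ?_ ?_
      · intro hlt
        simp [r4, r7, hx, hp] at hlt
        refine .seq (.setReal (.setNat (.setNat ?_)))
        simp [r6, r7, r8, hx, arr_setNat, arr_push]
        refine ⟨⟨by omega, by omega, ?_, ?_, ?_, ?_⟩, by omega⟩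
        · intro a h1 h2 h3
          simp [h1, h3, i3 a (by simp [h1, h2, h3])]
        · intro a ha
          rw [if_neg (by omega), i4 a ha]
        · rw [arr_succ, List.filter_append, arr_setReal _ _ _ _ _ (by omega), i5]
          simp [hlt.le]
        · rw [arr_succ, List.filter_append, i6]
          simp [hlt]
      · intro hge
        simp [r4, r7, hx, hp] at hge
        refine .skip (.setNat ?_)
        simp [arr_setNat]
        refine ⟨⟨by omega, by omega, ?_, i4, ?_, ?_⟩, by omega⟩
        · intro a h1 h2 h3
          simp [h1, i3 a (by simp [h1, h2, h3])]
        · rw [arr_succ, List.filter_append, i5]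
          simp [hle]
        · rw [arr_succ, List.filter_append, i6]
          simp [hge]
  · rintro τ t ⟨i1, i2, i3, i4, i5, i6⟩ hb ht
    have r8 := i3 8 (by decide)
    simp [r8] at hb ht
    have : τ.nat 10 = σ.nat 8 := by omega
    rw [this] at i5 i6 ht
    refine ⟨by simp; omega, i3, i4, i5, i6⟩

/-- `y` is a median of `a`, `b`, `c`. -/
def IsMed (a b c y : ℝ) : Prop :=
  (∀ v, y ≤ v → 2 ≤ cntLe v [a, b, c]) ∧ (∀ v, v ≤ y → 2 ≤ cntGe v [a, b, c])

theorem cntLe_append (v : ℝ) (L M : List ℝ) : cntLe v (L ++ M) = cntLe v L + cntLe v M :=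
  List.countP_append

theorem cntGe_append (v : ℝ) (L M : List ℝ) : cntGe v (L ++ M) = cntGe v L + cntGe v M :=
  List.countP_append

theorem arr_triple (σ : State) (B i : ℕ) :
    arr σ B (3 * (i + 1)) =
      arr σ B (3 * i) ++ [σ.real (B + 3 * i), σ.real (B + 3 * i + 1), σ.real (B + 3 * i + 2)] := by
  rw [show 3 * (i + 1) = 3 * i + 1 + 1 + 1 by ring, arr_succ, arr_succ, arr_succ]
  simp [add_assoc]

theorem isMed_mid {a b c y : ℝ} (h : (a ≤ y ∧ b ≤ y ∧ (y = a ∨ y = b) ∧ y ≤ c) ∨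
    (a ≤ y ∧ c ≤ y ∧ (y = a ∨ y = c) ∧ y ≤ b) ∨ (b ≤ y ∧ c ≤ y ∧ (y = b ∨ y = c) ∧ y ≤ a)) :
    IsMed a b c y := by
  constructor <;> intro v hv <;> simp only [cntLe, cntGe, List.countP_cons, List.countP_nil,
    decide_eq_true_eq]
  · rcases h with ⟨h1, h2, -, -⟩ | ⟨h1, h2, -, -⟩ | ⟨h1, h2, -, -⟩ <;>
    simp [h1.trans hv, h2.trans hv]
  · rcases h with ⟨-, -, rfl | rfl, h4⟩ | ⟨-, -, rfl | rfl, h4⟩ | ⟨-, -, rfl | rfl, h4⟩ <;>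
    simp [hv, hv.trans h4]

theorem IsMed.cntLe_le {a b c y : ℝ} (h : IsMed a b c y) (v : ℝ) :
    2 * cntLe v [y] ≤ cntLe v [a, b, c] := by
  by_cases hv : y ≤ v
  · have := h.1 v hv
    have : cntLe v [y] = 1 := by simp [cntLe, hv]
    omega
  · have : cntLe v [y] = 0 := by simp [cntLe, not_le.1 hv]
    omega

theorem IsMed.cntGe_le {a b c y : ℝ} (h : IsMed a b c y) (v : ℝ) :
    2 * cntGe v [y] ≤ cntGe v [a, b, c] := by
  by_cases hv : v ≤ y
  · have := h.2 v hv
    have : cntGe v [y] = 1 := by simp [cntGe, hv]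
    omega
  · have : cntGe v [y] = 0 := by simp [cntGe, not_le.1 hv]
    omega

/-- Writes to the address `rg 12` the median of the three reals from the address `rg 11` on. -/
def medianCmd : Cmd :=
  .ite (.realLe (.get (rg 11)) (.get (.add (rg 11) (.lit 1))))
    (.ite (.realLe (.get (.add (rg 11) (.lit 1))) (.get (.add (rg 11) (.lit 2))))
      (.setReal (rg 12) (.get (.add (rg 11) (.lit 1))))
      (.ite (.realLe (.get (rg 11)) (.get (.add (rg 11) (.lit 2))))
        (.setReal (rg 12) (.get (.add (rg 11) (.lit 2))))
        (.setReal (rg 12) (.get (rg 11)))))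
    (.ite (.realLe (.get (rg 11)) (.get (.add (rg 11) (.lit 2))))
      (.setReal (rg 12) (.get (rg 11)))
      (.ite (.realLe (.get (.add (rg 11) (.lit 1))) (.get (.add (rg 11) (.lit 2))))
        (.setReal (rg 12) (.get (.add (rg 11) (.lit 2))))
        (.setReal (rg 12) (.get (.add (rg 11) (.lit 1))))))

theorem medianCmd_spec (σ : State) :
    W X ps medianCmd σ fun τ t => t ≤ 60 ∧ ∃ y, τ = σ.setReal (σ.nat 12) y ∧
      IsMed (σ.real (σ.nat 11)) (σ.real (σ.nat 11 + 1)) (σ.real (σ.nat 11 + 2)) y := by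
  unfold medianCmd
  refine .ite (fun c1 => .ite (fun c2 => .setReal ?_)
      (fun c2 => .ite (fun c3 => .setReal ?_) (fun c3 => .setReal ?_)))
    (fun c1 => .ite (fun c2 => .setReal ?_)
      (fun c2 => .ite (fun c3 => .setReal ?_) (fun c3 => .setReal ?_))) <;>
  refine ⟨by simp, _, rfl, isMed_mid ?_⟩ <;> simp at c1 c2 ⊢ <;> try simp at c3
  all_goals grind

/-- Replace the array at address `rg 7` of length `rg 8` by the array of the medians of
consecutive triples. -/
def compressCmd : Cmd :=
  .setNat (.lit 10) (.lit 0) ;;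
  .loop (.natLe (.add (.mul (.lit 3) (rg 10)) (.lit 3)) (rg 8))
    (.setNat (.lit 11) (.add (rg 7) (.mul (.lit 3) (rg 10))) ;;
     .setNat (.lit 12) (.add (rg 6) (rg 10)) ;; medianCmd ;;
     .setNat (.lit 10) (.add (rg 10) (.lit 1))) ;;
  .setNat (.lit 7) (rg 6) ;; .setNat (.lit 8) (rg 10) ;;
  .setNat (.lit 6) (.add (rg 6) (rg 10))

theorem arr_sublist (σ : State) (B : ℕ) {k m : ℕ} (h : k ≤ m) :
    (arr σ B k).Sublist (arr σ B m) := by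
  unfold arr
  exact (List.range_sublist.2 h).map _

theorem compressCmd_spec (σ : State) (h2 : σ.nat 7 + σ.nat 8 ≤ σ.nat 6) :
    W X ps compressCmd σ fun τ t => t ≤ 100 * σ.nat 8 + 100 ∧
      (∀ a, a ∉ [6, 7, 8, 10, 11, 12] → τ.nat a = σ.nat a) ∧
      τ.nat 6 = σ.nat 6 + σ.nat 8 / 3 ∧ τ.nat 7 = σ.nat 6 ∧ τ.nat 8 = σ.nat 8 / 3 ∧
      (∀ a, a < σ.nat 6 → τ.real a = σ.real a) ∧
      (∀ v, 2 * cntLe v (arr τ (σ.nat 6) (σ.nat 8 / 3)) ≤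
        cntLe v (arr σ (σ.nat 7) (σ.nat 8))) ∧
      (∀ v, 2 * cntGe v (arr τ (σ.nat 6) (σ.nat 8 / 3)) ≤
        cntGe v (arr σ (σ.nat 7) (σ.nat 8))) := by
  unfold compressCmd
  refine .seq (.setNat (.seq ?_))
  refine .loop (fun τ => 3 * τ.nat 10 ≤ σ.nat 8 ∧
      (∀ a, a ∉ [10, 11, 12] → τ.nat a = σ.nat a) ∧
      (∀ a, a < σ.nat 6 → τ.real a = σ.real a) ∧
      (∀ v, 2 * cntLe v (arr τ (σ.nat 6) (τ.nat 10)) ≤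
        cntLe v (arr σ (σ.nat 7) (3 * τ.nat 10))) ∧
      (∀ v, 2 * cntGe v (arr τ (σ.nat 6) (τ.nat 10)) ≤
        cntGe v (arr σ (σ.nat 7) (3 * τ.nat 10))))
    (fun τ => 100 * (σ.nat 8 - τ.nat 10)) ?_ ?_ ?_
  · simp +contextual [cntLe, cntGe]
  · rintro τ ⟨i1, i3, i4, i5, i6⟩ hb
    have r6 := i3 6 (by decide)
    have r7 := i3 7 (by decide)
    have r8 := i3 8 (by decide)
    simp [r8] at hb
    refine .seq (.setNat (.seq (.setNat (.seq ((medianCmd_spec _).mono ?_)))))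
    rintro _ t ⟨ht, y, rfl, hy⟩
    have x0 : τ.real (σ.nat 7 + 3 * τ.nat 10) = σ.real (σ.nat 7 + 3 * τ.nat 10) := i4 _ (by omega)
    have x1 : τ.real (σ.nat 7 + 3 * τ.nat 10 + 1) = σ.real (σ.nat 7 + 3 * τ.nat 10 + 1) :=
      i4 _ (by omega)
    have x2 : τ.real (σ.nat 7 + 3 * τ.nat 10 + 2) = σ.real (σ.nat 7 + 3 * τ.nat 10 + 2) :=
      i4 _ (by omega)
    simp [r6, r7, x0, x1, x2] at hy
    refine .setNat ?_
    simp [r6, arr_setNat, arr_push, arr_triple, cntLe_append, cntGe_append]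
    refine ⟨⟨by omega, ?_, ?_, ?_, ?_⟩, by omega⟩
    · intro a h1 h2 h3
      simp [h1, h2, h3, i3 a (by simp [h1, h2, h3])]
    · intro a ha
      rw [if_neg (by omega), i4 a ha]
    · intro v
      have := i5 v
      have := hy.cntLe_le v
      omega
    · intro v
      have := i6 v
      have := hy.cntGe_le v
      omega
  · rintro τ t ⟨i1, i3, i4, i5, i6⟩ hb ht
    have r6 := i3 6 (by decide)
    have r7 := i3 7 (by decide)
    have r8 := i3 8 (by decide)
    simp [r8] at hb ht
    have e : τ.nat 10 = σ.nat 8 / 3 := by omega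
    refine .seq (.setNat (.seq (.setNat (.setNat ?_))))
    simp [arr_setNat, r6, e]
    rw [e] at i5 i6 ht
    refine ⟨by omega, ?_, i4, ?_, ?_⟩
    · intro a h1 h2 h3 h4 h5 h6
      simp [h1, h2, h3, i3 a (by simp [*])]
    · intro v
      exact (i5 v).trans ((arr_sublist σ _ (by omega)).countP_le)
    · intro v
      exact (i6 v).trans ((arr_sublist σ _ (by omega)).countP_le)

/-- Saves the arguments of the selection procedure on the stack. -/
def pushCmd : Cmd :=
  .setNat (rg 5) (rg 7) ;; .setNat (.add (rg 5) (.lit 1)) (rg 8) ;;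
    .setNat (.add (rg 5) (.lit 2)) (rg 9) ;; .setNat (.lit 5) (.add (rg 5) (.lit 3))

/-- Restores the arguments of the selection procedure from the stack. -/
def popCmd : Cmd :=
  .setNat (.lit 5) (.sub (rg 5) (.lit 3)) ;; .setNat (.lit 7) (stk 0) ;;
      .setNat (.lit 8) (stk 1) ;; .setNat (.lit 9) (stk 2)

theorem pushCmd_spec (σ : State) (h5 : 40 ≤ σ.nat 5) :
    W X ps pushCmd σ fun τ t => t ≤ 50 ∧ τ.real = σ.real ∧
      (∀ a, a < σ.nat 5 → a ≠ 5 → τ.nat a = σ.nat a) ∧ τ.nat 5 = σ.nat 5 + 3 ∧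
      τ.nat (σ.nat 5) = σ.nat 7 ∧ τ.nat (σ.nat 5 + 1) = σ.nat 8 ∧
      τ.nat (σ.nat 5 + 2) = σ.nat 9 := by
  have n1 : ∀ a b : ℕ, a < σ.nat 5 → (a = σ.nat 5 + b) = False := fun a b h => by
    simp; omega
  have n0 : ∀ a : ℕ, a < σ.nat 5 → (a = σ.nat 5) = False := fun a h => by
    simp; omega
  have n2 : ∀ a : ℕ, a < σ.nat 5 → (σ.nat 5 = a) = False := fun a h => by
    simp; omega
  have n3 : ∀ a b : ℕ, a < σ.nat 5 → (σ.nat 5 + b = a) = False := fun a b h => by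
    simp; omega
  have s5 : 5 < σ.nat 5 := by omega
  have s8 : 8 < σ.nat 5 := by omega
  have s9 : 9 < σ.nat 5 := by omega
  unfold pushCmd
  refine .seq (.setNat (.seq (.setNat (.seq (.setNat (.setNat ?_))))))
  simp [n0, n1, n2, n3, s5, s8, s9]
  intro a h1 h2
  simp [h2, n0, n1, h1]

theorem popCmd_spec (σ : State) (h5 : 40 ≤ σ.nat 5 - 3) :
    W X ps popCmd σ fun τ t => t ≤ 50 ∧ τ.real = σ.real ∧
      (∀ a, a ∉ [5, 7, 8, 9] → τ.nat a = σ.nat a) ∧ τ.nat 5 = σ.nat 5 - 3 ∧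
      τ.nat 7 = σ.nat (σ.nat 5 - 3) ∧ τ.nat 8 = σ.nat (σ.nat 5 - 3 + 1) ∧
      τ.nat 9 = σ.nat (σ.nat 5 - 3 + 2) := by
  have n1 : ∀ a b : ℕ, a < σ.nat 5 - 3 → (σ.nat 5 - 3 + b = a) = False := fun a b h => by
    simp; omega
  have n0 : ∀ a : ℕ, a < σ.nat 5 - 3 → (σ.nat 5 - 3 = a) = False := fun a h => by
    simp; omega
  have s5 : 5 < σ.nat 5 - 3 := by omega
  have s7 : 7 < σ.nat 5 - 3 := by omega
  have s8 : 8 < σ.nat 5 - 3 := by omega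
  unfold popCmd
  refine .seq (.setNat (.seq (.setNat (.seq (.setNat (.setNat ?_))))))
  simp [n0, n1, s5, s7, s8]
  intro a h1 h2 h3 h4
  simp [h1, h2, h3, h4]

/-- Chooses a pivot for the array at address `rg 7` of length `rg 8`. -/
def pivotCmd : Cmd :=
  .ite (.natLe (rg 8) (.lit 8)) (.setReal (rg 4) (.get (rg 7)))
    (pushCmd ;; compressCmd ;; compressCmd ;; .setNat (.lit 9) (.mul (.lit 2) (rg 8)) ;;
      .call 0 ;; popCmd ;; .setNat (.lit 15) (.lit 0))

/-- Selection: finds a quantile of rank `rg 9 / 4` of the array at address `rg 7` of length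
`rg 8` and writes it into the result register. -/
def selectCmd : Cmd :=
  .setNat (.lit 15) (.lit 0) ;;
  .loop (.natLe (rg 15) (.lit 0))
    (pivotCmd ;; partitionCmd ;;
      .ite (.natLe (rg 9) (.mul (.lit 4) (rg 11)))
        (.setNat (.lit 7) (rg 6) ;; .setNat (.lit 6) (.add (rg 6) (.mul (.lit 2) (rg 8))) ;;
          .setNat (.lit 8) (rg 11))
        (.setNat (.lit 16) (.mul (.lit 4) (.sub (rg 8) (rg 12))) ;;
          .ite (.natLe (rg 9) (rg 16))
            (.setNat (.lit 15) (.lit 1))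
            (.setNat (.lit 9) (.sub (rg 9) (rg 16)) ;;
              .setNat (.lit 7) (.add (rg 6) (rg 8)) ;;
              .setNat (.lit 6) (.add (rg 6) (.mul (.lit 2) (rg 8))) ;;
              .setNat (.lit 8) (rg 12))))

/-- The memory changes that a call of the selection procedure may make. -/
structure SelFrame (σ τ : State) : Prop where
  nat : ∀ a, a < σ.nat 5 → a ∉ [6, 7, 8, 9, 10, 11, 12, 15, 16] → τ.nat a = σ.nat a
  free : σ.nat 6 ≤ τ.nat 6
  real : ∀ a, a < σ.nat 6 → a ≠ σ.nat 4 → τ.real a = σ.real a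

theorem SelFrame.trans {σ τ υ : State} (h0 : 40 ≤ σ.nat 5) (h : SelFrame σ τ)
    (h' : SelFrame τ υ) : SelFrame σ υ := by
  have h5 := h.nat 5 (by omega) (by decide)
  have h4 := h.nat 4 (by omega) (by decide)
  refine ⟨fun a h1 h2 => ?_, h.free.trans h'.free, fun a h1 h2 => ?_⟩
  · rw [h'.nat a (by omega) h2, h.nat a h1 h2]
  · rw [h'.real a (h1.trans_le h.free) (by omega), h.real a h1 h2]

/-- What the selection procedure achieves in the state `σ`. -/
def SelectSpec (X : Fin n → Set (Fin d → ℝ)) (ps : List Cmd) (σ : State) : Prop :=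
  40 ≤ σ.nat 5 → σ.nat 4 < σ.nat 7 → σ.nat 7 + σ.nat 8 ≤ σ.nat 6 → 1 ≤ σ.nat 9 →
    σ.nat 9 ≤ 4 * σ.nat 8 → W X ps (.call 0) σ fun τ t =>
      t ≤ 20000 * σ.nat 8 + 200 ∧ SelFrame σ τ ∧
        IsQuantile (arr σ (σ.nat 7) (σ.nat 8)) (σ.nat 9) (τ.real (σ.nat 4))

theorem pivotCmd_spec (σ : State) (ih : ∀ τ : State, τ.nat 8 < σ.nat 8 → SelectSpec X ps τ)
    (h5 : 40 ≤ σ.nat 5) (h4 : σ.nat 4 < σ.nat 7) (h6 : σ.nat 7 + σ.nat 8 ≤ σ.nat 6)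
    (h8 : 1 ≤ σ.nat 8) (h15 : σ.nat 15 = 0) :
    W X ps pivotCmd σ fun τ t => SelFrame σ τ ∧ τ.nat 15 = 0 ∧
      (∀ a, a ∈ [7, 8, 9] → τ.nat a = σ.nat a) ∧
      ∃ q, 1 ≤ q ∧ q ≤ cntLe (τ.real (σ.nat 4)) (arr σ (σ.nat 7) (σ.nat 8)) ∧
        q ≤ cntGe (τ.real (σ.nat 4)) (arr σ (σ.nat 7) (σ.nat 8)) ∧
        t + 20000 * (σ.nat 8 - q) ≤ 20000 * σ.nat 8 - 300 * σ.nat 8 - 300 := by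
  unfold pivotCmd
  refine .ite (fun hb => .setReal ?_) (fun hb => ?_)
  · simp at hb
    have hm : σ.real (σ.nat 7) ∈ arr σ (σ.nat 7) (σ.nat 8) :=
      List.mem_map.2 ⟨0, by simpa using (Nat.succ_le_iff.1 h8), by simp⟩
    refine ⟨⟨by simp, by simp, ?_⟩, by simpa using h15, by simp, 1, le_rfl, ?_, ?_, ?_⟩
    · intro a _ h
      simp [h]
    · exact List.countP_pos_iff.2 ⟨_, hm, by simp⟩
    · exact List.countP_pos_iff.2 ⟨_, hm, by simp⟩
    · simp; omega
  · simp at hb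
    refine .seq ((pushCmd_spec σ h5).mono ?_)
    rintro σ₁ t₁ ⟨T1, R1, N1, p5, q7, q8, q9⟩
    have p4 := N1 4 (by omega) (by decide)
    have p6 := N1 6 (by omega) (by decide)
    have p7 := N1 7 (by omega) (by decide)
    have p8 := N1 8 (by omega) (by decide)
    refine .seq ((compressCmd_spec σ₁ (by omega)).mono ?_)
    rintro σ₂ t₂ ⟨T2, N2, r6, r7, r8, R2, L2, G2⟩
    have r4 := N2 4 (by decide)
    have r5 := N2 5 (by decide)
    refine .seq ((compressCmd_spec σ₂ (by omega)).mono ?_)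
    rintro σ₃ t₃ ⟨T3, N3, s6, s7, s8, R3, L3, G3⟩
    have s4 := N3 4 (by decide)
    have s5 := N3 5 (by decide)
    refine .seq (.setNat (.seq ?_))
    refine (ih _ (by simp; omega) (by simp; omega) (by simp; omega) (by simp; omega)
      (by simp; omega) (by simp; omega)).mono ?_
    rintro σ₄ t₄ ⟨T4, ⟨N4, F4, R4⟩, Q4⟩
    simp [arr_setNat] at T4 N4 F4 R4 Q4
    have u5 := N4 5 (by omega) (by decide) (by decide) (by decide) (by decide) (by decide)
      (by decide) (by decide) (by decide) (by decide)
    simp at u5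
    have up : ∀ a, a < σ.nat 5 + 3 → a ∉ [5, 6, 7, 8, 9, 10, 11, 12, 15, 16] →
        σ₄.nat a = σ₁.nat a := by
      intro a h1 h2
      simp only [List.mem_cons, List.not_mem_nil, or_false, not_or] at h2
      rw [N4 a (by omega) (by simp [h2]) (by simp [h2]) (by simp [h2]) (by simp [h2])
        (by simp [h2]) (by simp [h2]) (by simp [h2]) (by simp [h2]) (by simp [h2]),
        if_neg (by simp [h2]), N3 _ (by simp [h2]), N2 _ (by simp [h2])]
    have w0 := up (σ.nat 5) (by omega) (by simp; omega)
    have w1 := up (σ.nat 5 + 1) (by omega) (by simp; omega)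
    have w2 := up (σ.nat 5 + 2) (by omega) (by simp; omega)
    refine .seq ((popCmd_spec σ₄ (by omega)).mono ?_)
    rintro σ₅ t₅ ⟨T5, R5, N5, v5, v7, v8, v9⟩
    have e5 : σ₄.nat 5 - 3 = σ.nat 5 := by omega
    rw [e5] at v5 v7 v8 v9
    have v6 := N5 6 (by decide)
    refine .setNat ⟨⟨?_, ?_, ?_⟩, ?_, ?_, ?_⟩
    · intro a h1 h2
      simp only [List.mem_cons, List.not_mem_nil, or_false, not_or] at h2
      by_cases ha : a = 5
      · subst ha; simp [v5]
      · simp [h2]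
        rw [N5 a (by simp [h2, ha]), up a (by omega) (by simp [h2, ha]), N1 a h1 ha]
    · simp; omega
    · intro a h1 h2
      simp
      rw [R5, R4 a (by omega) (by omega), R3 a (by omega), R2 a (by omega), R1]
    · simp
    · simp; omega
    · have hR : σ₅.real (σ.nat 4) = σ₄.real (σ₃.nat 4) := by
        rw [R5, s4, r4, p4]
      simp only [NatExpr.eval, State.setNat_real, NatExpr.cost, Test.cost]
      rw [hR]
      generalize σ₄.real (σ₃.nat 4) = p at *
      have hA : arr σ₁ (σ₁.nat 7) (σ₁.nat 8) = arr σ (σ.nat 7) (σ.nat 8) := by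
        rw [p7, p8]; exact arr_congr fun a _ _ => by rw [R1]
      rw [hA] at L2 G2
      have l2 := L2 p
      have g2 := G2 p
      have l3 := L3 p
      have g3 := G3 p
      rw [← r7, ← r8] at l2 g2
      rw [← s7, ← s8] at l3 g3
      have hle := cntLt_add_cntGe p (arr σ₃ (σ₃.nat 7) (σ₃.nat 8))
      rw [arr_length] at hle
      obtain ⟨Q1, Q2⟩ := Q4
      refine ⟨2 * σ₃.nat 8, by omega, by omega, by omega, ?_⟩
      omega

theorem selectSpec_all (hps : ps[0]? = some selectCmd) :
    ∀ (m : ℕ) (σ : State), σ.nat 8 = m → SelectSpec X ps σ := by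
  intro m
  induction m using Nat.strong_induction_on with
  | _ m ih =>
  rintro σ hm h5 h4 h6 hT1 hT2
  refine .call hps ?_
  unfold selectCmd
  refine .seq (.setNat ?_)
  refine .loop (fun τ => SelFrame σ τ ∧ σ.nat 4 < τ.nat 7 ∧ τ.nat 7 + τ.nat 8 ≤ τ.nat 6 ∧
      τ.nat 8 ≤ m ∧ (τ.nat 15 = 0 → 1 ≤ τ.nat 9 ∧ τ.nat 9 ≤ 4 * τ.nat 8 ∧
        ∀ v, IsQuantile (arr τ (τ.nat 7) (τ.nat 8)) (τ.nat 9) v →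
          IsQuantile (arr σ (σ.nat 7) (σ.nat 8)) (σ.nat 9) v) ∧
      (τ.nat 15 ≠ 0 →
        IsQuantile (arr σ (σ.nat 7) (σ.nat 8)) (σ.nat 9) (τ.real (σ.nat 4))))
    (fun τ => if τ.nat 15 = 0 then 20000 * τ.nat 8 else 0) ?_ ?_ ?_
  · refine ⟨⟨?_, by simp, by simp⟩, by simpa using h4, by simpa using h6, by simp [hm], ?_, by simp⟩
    · simp +contextual
    · simp [hT1, hT2, arr_setNat]
  · rintro τ ⟨fr, i1, i2, i3, i4, i5⟩ hb
    simp at hb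
    have a5 := fr.nat 5 (by omega) (by decide)
    have a4 := fr.nat 4 (by omega) (by decide)
    obtain ⟨j1, j2, j3⟩ := i4 hb
    simp only [hb, if_true]
    refine .seq ((pivotCmd_spec τ (fun υ hυ => ih _ (by omega) υ rfl) (by omega) (by omega)
      (by omega) (by omega) hb).mono ?_)
    rintro τ₁ t₁ ⟨fr₁, b15, b, q, q1, q2, q3, T1⟩
    have b7 := b 7 (by decide)
    have b8 := b 8 (by decide)
    have b9 := b 9 (by decide)
    have b4 := fr₁.nat 4 (by omega) (by decide)
    have b5 := fr₁.nat 5 (by omega) (by decide)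
    have b6 := fr₁.free
    have hA : arr τ₁ (τ₁.nat 7) (τ₁.nat 8) = arr τ (τ.nat 7) (τ.nat 8) := by
      rw [b7, b8]; exact arr_congr fun a _ _ => fr₁.real a (by omega) (by omega)
    refine .seq ((partitionCmd_spec τ₁ (by omega) (by omega)).mono ?_)
    rintro τ₂ t₂ ⟨T2, N2, R2, L2, G2⟩
    rw [hA, b4] at L2 G2
    have c4 := N2 4 (by decide)
    have c5 := N2 5 (by decide)
    have c6 := N2 6 (by decide)
    have c7 := N2 7 (by decide)
    have c8 := N2 8 (by decide)
    have c9 := N2 9 (by decide)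
    have c15 := N2 15 (by decide)
    have frN : ∀ a, a < σ.nat 5 → a ∉ [6, 7, 8, 9, 10, 11, 12, 15, 16] →
        τ₂.nat a = σ.nat a := by
      intro a h1 h2
      rw [N2 a (by simp at h2 ⊢; omega), (fr.trans h5 fr₁).nat a h1 h2]
    have frR : ∀ a, a < σ.nat 6 → a ≠ σ.nat 4 → τ₂.real a = σ.real a := by
      intro a h1 h2
      rw [R2 a (by have := fr.free; omega), (fr.trans h5 fr₁).real a h1 h2]
    have frF := (fr.trans h5 fr₁).free
    have hp : τ₂.real (σ.nat 4) = τ₁.real (τ.nat 4) := by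
      rw [R2 _ (by omega), a4]
    generalize τ₁.real (τ.nat 4) = p at *
    have k1 : τ₂.nat 11 = cntLt p (arr τ (τ.nat 7) (τ.nat 8)) := by
      rw [← arr_length τ₂ (τ₁.nat 6) (τ₂.nat 11), L2, cntLt, List.countP_eq_length_filter]
    have k2 : τ₂.nat 12 = cntGt p (arr τ (τ.nat 7) (τ.nat 8)) := by
      rw [← arr_length τ₂ (τ₁.nat 6 + τ₁.nat 8) (τ₂.nat 12), G2, cntGt,
        List.countP_eq_length_filter]
    have s1 := cntLt_add_cntGe p (arr τ (τ.nat 7) (τ.nat 8))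
    have s2 := cntLe_add_cntGt p (arr τ (τ.nat 7) (τ.nat 8))
    rw [arr_length] at s1 s2
    refine .ite ?_ ?_
    · intro hlow
      simp at hlow
      refine .seq (.setNat (.seq (.setNat (.setNat ?_))))
      simp [c15, b15]
      refine ⟨⟨⟨?_, ?_, ?_⟩, ?_, ?_, ?_, ?_⟩, ?_⟩
      · intro a h1 h2
        simp only [List.mem_cons, List.not_mem_nil, or_false, not_or] at h2
        simp [h2, frN a h1 (by simp [h2])]
      · simp; omega
      · simpa using frR
      · omega
      · omega
      · omega
      · refine ⟨by omega, by omega, ?_⟩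
        intro v hv
        apply j3
        simp only [arr_setNat, c6, L2, c9, b9] at hv
        exact hv.of_low (by omega)
      · omega
    · intro hlow
      simp at hlow
      refine .seq (.setNat (.ite ?_ ?_))
      · intro hmid
        simp at hmid
        refine .setNat ?_
        simp [hp]
        refine ⟨⟨⟨?_, ?_, ?_⟩, ?_, ?_, ?_, ?_⟩, ?_⟩
        · intro a h1 h2
          simp only [List.mem_cons, List.not_mem_nil, or_false, not_or] at h2
          simp [h2, frN a h1 (by simp [h2])]
        · simp; omega
        · simpa using frR
        · omega
        · omega
        · omega
        · have h0 : IsQuantile (arr τ (τ.nat 7) (τ.nat 8)) (τ.nat 9) p :=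
            ⟨by omega, by omega⟩
          exact j3 p h0
        · omega
      · intro hhigh
        simp at hhigh
        refine .seq (.setNat (.seq (.setNat (.seq (.setNat (.setNat ?_))))))
        simp [c15, b15]
        refine ⟨⟨⟨?_, ?_, ?_⟩, ?_, ?_, ?_, ?_⟩, ?_⟩
        · intro a h1 h2
          simp only [List.mem_cons, List.not_mem_nil, or_false, not_or] at h2
          simp [h2, frN a h1 (by simp [h2])]
        · simp; omega
        · simpa using frR
        · omega
        · omega
        · omega
        · refine ⟨by omega, by omega, ?_⟩
          intro v hv
          apply j3
          have e1 : τ₂.nat 9 - 4 * (τ₁.nat 8 - τ₂.nat 12) =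
              τ.nat 9 - 4 * cntLe p (arr τ (τ.nat 7) (τ.nat 8)) := by omega
          simp only [arr_setNat, c6, c8, G2, e1] at hv
          exact hv.of_high (by omega)
        · omega
  · rintro τ t ⟨fr, i1, i2, i3, i4, i5⟩ hb ht
    simp at hb ht
    rw [if_neg (by omega)] at ht
    refine ⟨by simp; omega, fr, i5 (by omega)⟩

end Select

section Stage

variable {d n : ℕ} {X : Fin n → Set (Fin d → ℝ)} {ps : List Cmd}

theorem countP_range (N : ℕ) (p : ℕ → Prop) [DecidablePred p] :
    (List.range N).countP (fun i => decide (p i)) = ((Finset.range N).filter p).card := by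
  induction N with
  | zero => simp
  | succ N ih =>
    rw [List.range_succ, List.countP_append, ih, Finset.range_add_one, Finset.filter_insert]
    by_cases h : p N <;> simp [h]

/-- The address of the coordinate `rg 13` of the representative point of the object `rg 10`. -/
abbrev repAddr : NatExpr :=
  .add (.mul (rg 10) (.add (.mul (.lit 2) (rg 0)) (.lit 1))) (rg 13)

/-- Collects the coordinates number `rg 13` of the representative points of all flagged objects
of the first collection. -/
def gatherCmd : Cmd :=
  .setNat (.lit 10) (.lit 0) ;; .setNat (.lit 11) (.lit 0) ;;
  .loop (.natLe (.add (rg 10) (.lit 1)) (rg 1))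
    (.ite (.natLe (.lit 1) (.get (.add (.lit 40) (rg 10))))
      (.setReal (.add (rg 6) (rg 11)) (.get repAddr) ;;
        .setNat (.lit 11) (.add (rg 11) (.lit 1)))
      .skip ;;
    .setNat (.lit 10) (.add (rg 10) (.lit 1)))

theorem rep_index_lt {d i j n : ℕ} (hi : i < n) (hj : j < d) :
    i * (2 * d + 1) + j < n * (2 * d + 1) := by
  have : (i + 1) * (2 * d + 1) ≤ n * (2 * d + 1) := Nat.mul_le_mul_right _ hi
  rw [add_mul] at this
  omega

theorem gatherCmd_spec (σ : State) (h6 : σ.nat 1 * (2 * σ.nat 0 + 1) ≤ σ.nat 6)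
    (hj : σ.nat 13 < σ.nat 0) :
    W X ps gatherCmd σ fun τ t => t ≤ 100 * σ.nat 1 + 100 ∧
      (∀ a, a ∉ [10, 11] → τ.nat a = σ.nat a) ∧
      (∀ a, a < σ.nat 6 → τ.real a = σ.real a) ∧
      arr τ (σ.nat 6) (τ.nat 11) =
        ((List.range (σ.nat 1)).filter (fun i => decide (1 ≤ σ.nat (40 + i)))).map
          (fun i => σ.real (i * (2 * σ.nat 0 + 1) + σ.nat 13)) := by
  unfold gatherCmd
  refine .seq (.setNat (.seq (.setNat ?_)))
  refine .loop (fun τ => τ.nat 10 ≤ σ.nat 1 ∧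
      (∀ a, a ∉ [10, 11] → τ.nat a = σ.nat a) ∧
      (∀ a, a < σ.nat 6 → τ.real a = σ.real a) ∧
      arr τ (σ.nat 6) (τ.nat 11) =
        ((List.range (τ.nat 10)).filter (fun i => decide (1 ≤ σ.nat (40 + i)))).map
          (fun i => σ.real (i * (2 * σ.nat 0 + 1) + σ.nat 13)))
    (fun τ => 100 * (σ.nat 1 - τ.nat 10)) ?_ ?_ ?_
  · simp +contextual
  · rintro τ ⟨i1, i3, i4, i5⟩ hb
    have r0 := i3 0 (by decide)
    have r1 := i3 1 (by decide)
    have r6 := i3 6 (by decide)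
    have r13 := i3 13 (by decide)
    have rf := i3 (40 + τ.nat 10) (by simp; omega)
    simp [r1] at hb
    have hx := i4 (τ.nat 10 * (2 * σ.nat 0 + 1) + σ.nat 13)
      ((rep_index_lt (by omega) hj).trans_le h6)
    refine .seq (.ite ?_ ?_)
    · intro hf
      simp [rf] at hf
      refine .seq (.setReal (.setNat (.setNat ?_)))
      simp [r0, r13, r6, hx, arr_setNat, arr_push]
      refine ⟨⟨by omega, ?_, ?_, ?_⟩, by omega⟩
      · intro a h1 h2
        simp [h1, h2, i3 a (by simp [h1, h2])]
      · intro a ha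
        rw [if_neg (by omega), i4 a ha]
      · rw [List.range_succ, List.filter_append, i5]
        simp [Nat.succ_le_iff.2 (Nat.pos_of_ne_zero fun h => by omega : 0 < σ.nat (40 + τ.nat 10))]
    · intro hf
      simp [rf] at hf
      refine .skip (.setNat ?_)
      simp [arr_setNat]
      refine ⟨⟨by omega, ?_, i4, ?_⟩, by omega⟩
      · intro a h1 h2
        simp [h1, i3 a (by simp [h1, h2])]
      · rw [List.range_succ, List.filter_append, i5]
        simp [hf]
  · rintro τ t ⟨i1, i3, i4, i5⟩ hb ht
    have r1 := i3 1 (by decide)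
    simp [r1] at hb ht
    have : τ.nat 10 = σ.nat 1 := by omega
    rw [this] at i5 ht
    exact ⟨by simp; omega, i3, i4, i5⟩

/-- Counts the entries of an array in the two halves of an interval. -/
def countCmd : Cmd :=
  .setNat (.lit 10) (.lit 0) ;; .setNat (.lit 11) (.lit 0) ;; .setNat (.lit 12) (.lit 0) ;;
  .loop (.natLe (.add (rg 10) (.lit 1)) (rg 17))
    (.ite (.and (.realLe (.get (.add (rg 4) (.lit 2))) (.get (.add (rg 18) (rg 10))))
        (.realLe (.get (.add (rg 18) (rg 10))) (.get (.add (rg 4) (.lit 4)))))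
      (.setNat (.lit 11) (.add (rg 11) (.lit 1))) .skip ;;
    .ite (.and (.realLe (.get (.add (rg 4) (.lit 4))) (.get (.add (rg 18) (rg 10))))
        (.realLe (.get (.add (rg 18) (rg 10))) (.get (.add (rg 4) (.lit 3)))))
      (.setNat (.lit 12) (.add (rg 12) (.lit 1))) .skip ;;
    .setNat (.lit 10) (.add (rg 10) (.lit 1)))

theorem countCmd_spec (σ : State) :
    W X ps countCmd σ fun τ t => t ≤ 100 * σ.nat 17 + 100 ∧
      (∀ a, a ∉ [10, 11, 12] → τ.nat a = σ.nat a) ∧ τ.real = σ.real ∧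
      τ.nat 11 = (arr σ (σ.nat 18) (σ.nat 17)).countP
        (fun x => decide (σ.real (σ.nat 4 + 2) ≤ x ∧ x ≤ σ.real (σ.nat 4 + 4))) ∧
      τ.nat 12 = (arr σ (σ.nat 18) (σ.nat 17)).countP
        (fun x => decide (σ.real (σ.nat 4 + 4) ≤ x ∧ x ≤ σ.real (σ.nat 4 + 3))) := by
  unfold countCmd
  refine .seq (.setNat (.seq (.setNat (.seq (.setNat ?_)))))
  refine .loop (fun τ => τ.nat 10 ≤ σ.nat 17 ∧
      (∀ a, a ∉ [10, 11, 12] → τ.nat a = σ.nat a) ∧ τ.real = σ.real ∧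
      τ.nat 11 = (arr σ (σ.nat 18) (τ.nat 10)).countP
        (fun x => decide (σ.real (σ.nat 4 + 2) ≤ x ∧ x ≤ σ.real (σ.nat 4 + 4))) ∧
      τ.nat 12 = (arr σ (σ.nat 18) (τ.nat 10)).countP
        (fun x => decide (σ.real (σ.nat 4 + 4) ≤ x ∧ x ≤ σ.real (σ.nat 4 + 3))))
    (fun τ => 100 * (σ.nat 17 - τ.nat 10)) ?_ ?_ ?_
  · simp +contextual
  · rintro τ ⟨i1, i3, i4, i5, i6⟩ hb
    have r4 := i3 4 (by decide)
    have r17 := i3 17 (by decide)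
    have r18 := i3 18 (by decide)
    simp [r17] at hb
    refine .seq (.ite (fun h1 => .setNat (.seq (.ite (fun h2 => .setNat (.setNat ?_))
        (fun h2 => .skip (.setNat ?_)))))
      (fun h1 => .skip (.seq (.ite (fun h2 => .setNat (.setNat ?_))
        (fun h2 => .skip (.setNat ?_)))))) <;>
    simp [r4, r18, i4] at h1 h2 <;>
    simp [i4, i5, i6, arr_succ, h1, h2, List.countP_append, List.countP_cons] <;>
    refine ⟨⟨by omega, ?_⟩, by omega⟩ <;> (try and_intros) <;>
    first
    | exact h1
    | exact h2
    | (intro a q1 q2 q3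
       simp [q1, q2, q3, i3 a (by simp [q1, q2, q3])])
  · rintro τ t ⟨i1, i3, i4, i5, i6⟩ hb ht
    have r17 := i3 17 (by decide)
    simp [r17] at hb ht
    have : τ.nat 10 = σ.nat 17 := by omega
    rw [this] at i5 i6 ht
    exact ⟨by simp; omega, i3, i4, i5, i6⟩

/-- Clears the flags of the objects whose coordinate number `rg 13` is not in an interval. -/
def filterCmd : Cmd :=
  .setNat (.lit 10) (.lit 0) ;;
  .loop (.natLe (.add (rg 10) (.lit 1)) (rg 1))
    (.ite (.and (.realLe (.get (.add (rg 4) (.lit 2))) (.get repAddr))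
        (.realLe (.get repAddr) (.get (.add (rg 4) (.lit 3)))))
      .skip (.setNat (.add (.lit 40) (rg 10)) (.lit 0)) ;;
    .setNat (.lit 10) (.add (rg 10) (.lit 1)))

theorem filterCmd_spec (σ : State) :
    W X ps filterCmd σ fun τ t => t ≤ 100 * σ.nat 1 + 100 ∧
      (∀ a, a < 40 → a ≠ 10 → τ.nat a = σ.nat a) ∧ τ.real = σ.real ∧
      (∀ i, i < σ.nat 1 → (1 ≤ τ.nat (40 + i) ↔ 1 ≤ σ.nat (40 + i) ∧
        σ.real (σ.nat 4 + 2) ≤ σ.real (i * (2 * σ.nat 0 + 1) + σ.nat 13) ∧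
        σ.real (i * (2 * σ.nat 0 + 1) + σ.nat 13) ≤ σ.real (σ.nat 4 + 3))) := by
  unfold filterCmd
  refine .seq (.setNat ?_)
  refine .loop (fun τ => τ.nat 10 ≤ σ.nat 1 ∧
      (∀ a, a < 40 → a ≠ 10 → τ.nat a = σ.nat a) ∧ τ.real = σ.real ∧
      (∀ i, τ.nat 10 ≤ i → τ.nat (40 + i) = σ.nat (40 + i)) ∧
      (∀ i, i < τ.nat 10 → (1 ≤ τ.nat (40 + i) ↔ 1 ≤ σ.nat (40 + i) ∧
        σ.real (σ.nat 4 + 2) ≤ σ.real (i * (2 * σ.nat 0 + 1) + σ.nat 13) ∧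
        σ.real (i * (2 * σ.nat 0 + 1) + σ.nat 13) ≤ σ.real (σ.nat 4 + 3))))
    (fun τ => 100 * (σ.nat 1 - τ.nat 10)) ?_ ?_ ?_
  · refine ⟨by simp, ?_, rfl, ?_, by simp⟩
    · simp +contextual
    · intro i _
      simp; omega
  · rintro τ ⟨i1, i3, i4, i5, i6⟩ hb
    have r0 := i3 0 (by decide) (by decide)
    have r1 := i3 1 (by decide) (by decide)
    have r4 := i3 4 (by decide) (by decide)
    have r13 := i3 13 (by decide) (by decide)
    simp [r1] at hb
    have ne (i : ℕ) : (40 + i = 10) = False := by simp; omega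
    have ne' (i : ℕ) : (10 = 40 + i) = False := by simp; omega
    refine .seq (.ite ?_ ?_)
    · intro h
      simp [r0, r4, r13, i4] at h
      refine .skip (.setNat ?_)
      simp [i4, ne]
      refine ⟨⟨by omega, ?_, ?_, ?_⟩, by omega⟩
      · intro a h1 h2
        simp [h2, i3 a h1 h2]
      · intro i hi
        exact i5 i (by omega)
      · intro i hi
        rcases lt_or_eq_of_le hi with hi | rfl
        · exact i6 i hi
        · rw [i5 _ le_rfl]; simp [h]
    · intro h
      simp [r0, r4, r13, i4] at h
      refine .setNat (.setNat ?_)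
      simp [i4, ne, ne']
      refine ⟨⟨by omega, ?_, ?_, ?_⟩, by omega⟩
      · intro a h1 h2
        rw [if_neg h2, if_neg (by omega), i3 a h1 h2]
      · intro i hi
        rw [if_neg (by omega), i5 i (by omega)]
      · intro i hi
        rcases lt_or_eq_of_le hi with hi | rfl
        · rw [if_neg (by omega)]; exact i6 i hi
        · simp
          intro _ h'
          exact h h'
  · rintro τ t ⟨i1, i3, i4, i5, i6⟩ hb ht
    have r1 := i3 1 (by decide) (by decide)
    simp [r1] at hb ht
    have : τ.nat 10 = σ.nat 1 := by omega
    rw [this] at i6 ht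
    exact ⟨by simp; omega, i3, i4, i6⟩

theorem countP_gather (N : ℕ) (p : ℕ → Prop) (q : ℝ → Prop) [DecidablePred p] [DecidablePred q]
    (x : ℕ → ℝ) :
    (((List.range N).filter (fun i => decide (p i))).map x).countP (fun y => decide (q y)) =
      (((Finset.range N).filter p).filter fun i => q (x i)).card := by
  rw [List.countP_map, List.countP_filter, Finset.filter_filter, ← countP_range]
  congr 1
  ext i
  simp [Bool.and_comm]

/-- Two quartiles of a finite family of reals. -/
theorem quartiles {P : Finset ℕ} {x : ℕ → ℝ} {a b : ℝ}
    (h2 : 4 * (P.filter fun i => x i < a).card < P.card)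
    (h3 : 3 * P.card + 1 ≤ 4 * (P.filter fun i => x i ≤ b).card)
    (h4 : 4 * (P.filter fun i => x i < b).card < 3 * P.card + 1) :
    a ≤ b ∧ P.card ≤ 4 * (P.filter fun i => b ≤ x i).card ∧
      2 * P.card < 4 * ((P.filter fun i => a ≤ x i ∧ x i ≤ (a + b) / 2).card +
        (P.filter fun i => (a + b) / 2 ≤ x i ∧ x i ≤ b).card) := by
  have hab : a ≤ b := by
    by_contra hab
    have : (P.filter fun i => x i ≤ b).card ≤ (P.filter fun i => x i < a).card := by
      apply Finset.card_le_card
      intro i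
      simp only [Finset.mem_filter]
      exact fun h => ⟨h.1, h.2.trans_lt (not_le.1 hab)⟩
    omega
  have e1 := Finset.card_filter_add_card_filter_not (s := P) (fun i => x i < b)
  have e2 := Finset.card_filter_add_card_filter_not (s := P) (fun i => x i ≤ b)
  simp only [not_lt, not_le] at e1 e2
  refine ⟨hab, by omega, ?_⟩
  have : P ⊆ (P.filter fun i => x i < a) ∪ ((P.filter fun i => b < x i) ∪
      ((P.filter fun i => a ≤ x i ∧ x i ≤ (a + b) / 2) ∪
        (P.filter fun i => (a + b) / 2 ≤ x i ∧ x i ≤ b))) := by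
    intro i hi
    simp only [Finset.mem_union, Finset.mem_filter, hi, true_and]
    rcases lt_or_ge (x i) a with h | h
    · exact Or.inl h
    rcases lt_or_ge b (x i) with h' | h'
    · exact Or.inr (Or.inl h')
    rcases le_total (x i) ((a + b) / 2) with h'' | h''
    · exact Or.inr (Or.inr (Or.inl ⟨h, h''⟩))
    · exact Or.inr (Or.inr (Or.inr ⟨h'', h'⟩))
  have h5 := Finset.card_le_card this
  have u1 := Finset.card_union_le (P.filter fun i => x i < a) ((P.filter fun i => b < x i) ∪
      ((P.filter fun i => a ≤ x i ∧ x i ≤ (a + b) / 2) ∪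
        (P.filter fun i => (a + b) / 2 ≤ x i ∧ x i ≤ b)))
  have u2 := Finset.card_union_le (P.filter fun i => b < x i)
      ((P.filter fun i => a ≤ x i ∧ x i ≤ (a + b) / 2) ∪
        (P.filter fun i => (a + b) / 2 ≤ x i ∧ x i ≤ b))
  have u3 := Finset.card_union_le (P.filter fun i => a ≤ x i ∧ x i ≤ (a + b) / 2)
        (P.filter fun i => (a + b) / 2 ≤ x i ∧ x i ≤ b)
  omega

/-- The set of the flagged objects of the first collection. -/
def flagged (N : ℕ) (σ : State) : Finset ℕ :=
  (Finset.range N).filter fun i => 1 ≤ σ.nat (40 + i)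

/-- Computes two quartiles of the coordinates number `rg 13` of the flagged objects, and their
midpoint. -/
def quartileCmd : Cmd :=
  gatherCmd ;;
  .setNat (.lit 18) (rg 6) ;; .setNat (.lit 17) (rg 11) ;;
  .setNat (.lit 6) (.add (rg 6) (rg 11)) ;;
  .setNat (.lit 7) (rg 18) ;; .setNat (.lit 8) (rg 17) ;; .setNat (.lit 9) (rg 17) ;;
  .call 0 ;;
  .setReal (.add (rg 4) (.lit 2)) (.get (rg 4)) ;;
  .setNat (.lit 7) (rg 18) ;; .setNat (.lit 8) (rg 17) ;;
  .setNat (.lit 9) (.add (.mul (.lit 3) (rg 17)) (.lit 1)) ;;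
  .call 0 ;;
  .setReal (.add (rg 4) (.lit 3)) (.get (rg 4)) ;;
  .setReal (.add (rg 4) (.lit 4))
    (.div (.add (.get (.add (rg 4) (.lit 2))) (.get (.add (rg 4) (.lit 3)))) (.ofNat (.lit 2)))

/-- Registers with a fixed content during the computation of the centre. -/
def mainRegs : List ℕ := [0, 1, 2, 3, 4, 5, 13]

theorem quartileCmd_spec (hps : ps[0]? = some selectCmd) (σ : State)
    (h5 : 40 + σ.nat 1 ≤ σ.nat 5) (h4 : σ.nat 1 * (2 * σ.nat 0 + 1) ≤ σ.nat 4)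
    (h6 : σ.nat 4 + 16 ≤ σ.nat 6)
    (hj : σ.nat 13 < σ.nat 0) (hP : 1 ≤ (flagged (σ.nat 1) σ).card) :
    W X ps quartileCmd σ fun τ t => t ≤ 60000 * σ.nat 1 + 1500 ∧
      (∀ a, a ∈ mainRegs → τ.nat a = σ.nat a) ∧
      (∀ i, i < σ.nat 1 → τ.nat (40 + i) = σ.nat (40 + i)) ∧
      σ.nat 6 ≤ τ.nat 6 ∧ τ.nat 17 ≤ σ.nat 1 ∧
      (∀ a, a < σ.nat 6 → a ∉ [σ.nat 4, σ.nat 4 + 2, σ.nat 4 + 3, σ.nat 4 + 4] →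
        τ.real a = σ.real a) ∧
      arr τ (τ.nat 18) (τ.nat 17) =
        ((List.range (σ.nat 1)).filter (fun i => decide (1 ≤ σ.nat (40 + i)))).map
          (fun i => σ.real (i * (2 * σ.nat 0 + 1) + σ.nat 13)) ∧
      ∃ a b, τ.real (σ.nat 4 + 2) = a ∧ τ.real (σ.nat 4 + 3) = b ∧
        τ.real (σ.nat 4 + 4) = (a + b) / 2 ∧
        (flagged (σ.nat 1) σ).card ≤ 4 * ((flagged (σ.nat 1) σ).filter
          fun i => σ.real (i * (2 * σ.nat 0 + 1) + σ.nat 13) ≤ a).card ∧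
        4 * ((flagged (σ.nat 1) σ).filter
          fun i => σ.real (i * (2 * σ.nat 0 + 1) + σ.nat 13) < a).card <
            (flagged (σ.nat 1) σ).card ∧
        3 * (flagged (σ.nat 1) σ).card + 1 ≤ 4 * ((flagged (σ.nat 1) σ).filter
          fun i => σ.real (i * (2 * σ.nat 0 + 1) + σ.nat 13) ≤ b).card ∧
        4 * ((flagged (σ.nat 1) σ).filter
          fun i => σ.real (i * (2 * σ.nat 0 + 1) + σ.nat 13) < b).card <
            3 * (flagged (σ.nat 1) σ).card + 1 := by
  unfold quartileCmd
  refine .seq ((gatherCmd_spec σ (by omega) hj).mono ?_)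
  rintro τ t ⟨T1, N1, R1, A1⟩
  set V := ((List.range (σ.nat 1)).filter (fun i => decide (1 ≤ σ.nat (40 + i)))).map
          (fun i => σ.real (i * (2 * σ.nat 0 + 1) + σ.nat 13)) with hV
  have hlen : V.length = (flagged (σ.nat 1) σ).card := by
    rw [hV, List.length_map, ← List.countP_eq_length_filter, countP_range, flagged]
  have hm : τ.nat 11 = (flagged (σ.nat 1) σ).card := by
    rw [← hlen, ← A1, arr_length]
  have hle : (flagged (σ.nat 1) σ).card ≤ σ.nat 1 :=
    (Finset.card_filter_le _ _).trans (by simp)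
  have g4 := N1 4 (by decide)
  have g5 := N1 5 (by decide)
  have g6 := N1 6 (by decide)
  refine .seq (.setNat (.seq (.setNat (.seq (.setNat (.seq (.setNat (.seq (.setNat
    (.seq (.setNat (.seq ?_))))))))))))
  simp only [NatExpr.eval, State.setNat_nat, NatExpr.cost, Nat.reduceEqDiff, if_true, if_false]
  refine (selectSpec_all hps _ _ rfl (by simp; omega) (by simp; omega) (by simp)
    (by simp; omega) (by simp; omega)).mono ?_
  rintro τ₂ t₂ ⟨T2, F2, Q2⟩
  have k4 := F2.nat 4 (by simp; omega) (by decide)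
  have k5 := F2.nat 5 (by simp; omega) (by decide)
  have k17 := F2.nat 17 (by simp; omega) (by decide)
  have k18 := F2.nat 18 (by simp; omega) (by decide)
  have k6 := F2.free
  simp [arr_setNat, g6, A1, g4] at T2 Q2 k4 k5 k17 k18 k6
  have B2 : arr τ₂ (σ.nat 6) (τ.nat 11) = V := by
    rw [← A1]
    apply arr_congr
    intro a ha1 ha2
    rw [F2.real a (by simp; omega) (by simp; omega)]
    simp
  refine .seq (.setReal (.seq (.setNat (.seq (.setNat (.seq (.setNat (.seq ?_))))))))
  simp only [NatExpr.eval, RealExpr.eval, RealExpr.cost, State.setNat_nat, State.setReal_nat,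
    NatExpr.cost, Nat.reduceEqDiff, if_false, k4, k17, k18]
  refine (selectSpec_all hps _ _ rfl (by simp; omega) (by simp; omega) (by simp; omega)
    (by simp) (by simp; omega)).mono ?_
  rintro τ₃ t₃ ⟨T3, F3, Q3⟩
  have l4 := F3.nat 4 (by simp; omega) (by decide)
  have l17 := F3.nat 17 (by simp; omega) (by decide)
  have l18 := F3.nat 18 (by simp; omega) (by decide)
  have l6 := F3.free
  simp [arr_setNat] at T3 Q3 l4 l17 l18 l6
  rw [arr_setReal _ _ _ _ _ (by omega), B2] at Q3
  have B3 : arr τ₃ (σ.nat 6) (τ.nat 11) = V := by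
    rw [← B2]
    apply arr_congr
    intro a ha1 ha2
    rw [F3.real a (by simp; omega) (by simp; omega)]
    simp
    omega
  have R3 : ∀ a, a < σ.nat 6 → a ≠ σ.nat 4 → τ₃.real a =
      if a = σ.nat 4 + 2 then τ₂.real (σ.nat 4) else σ.real a := by
    intro a h1 h2
    rw [F3.real a (by simp; omega) (by simp; omega)]
    simp
    rw [F2.real a (by simp; omega) (by simp; omega)]
    simp [R1 a h1]
  have hN : ∀ a, a < σ.nat 5 → a ∉ [6, 7, 8, 9, 10, 11, 12, 15, 16, 17, 18] →
      τ₃.nat a = σ.nat a := by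
    intro a h1 h2
    simp only [List.mem_cons, List.not_mem_nil, or_false, not_or] at h2
    rw [F3.nat a (by simp; omega) (by simp [h2])]
    simp [h2]
    rw [F2.nat a (by simp; omega) (by simp [h2])]
    simp [h2, N1 a (by simp [h2])]
  refine .seq (.setReal (.setReal ?_))
  simp [l4, k4, l17, l18, k17, k18, arr_setNat, hm]
  refine ⟨by omega, ?_, ?_, by omega, by omega, ?_, ?_, ?_⟩
  · intro a ha
    apply hN a
    · simp [mainRegs] at ha; omega
    · simp [mainRegs] at ha ⊢; omega
  · intro i hi
    exact hN _ (by omega) (by simp; omega)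
  · intro a h1 h2 h3 h4 h5
    rw [if_neg h5, if_neg h4, R3 a h1 h2, if_neg h3]
  · rw [arr_setReal _ _ _ _ _ (by omega), arr_setReal _ _ _ _ _ (by omega), ← hm, B3]
  · rw [R3 _ (by omega) (by omega)]
    simp
    obtain ⟨q1, q2⟩ := Q2
    obtain ⟨q3, q4⟩ := Q3
    simp only [cntLt, cntLe, hV, countP_gather] at q1 q2 q3 q4
    rw [hm] at q1 q2 q3 q4
    rw [k4] at q3 q4
    exact ⟨q2, q1, q4, Nat.le_of_lt_succ q3⟩

end Stage

/-- The outcome of the first `j` rounds of the computation of the centre `c`: `P` is a large set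
of points close to `c`, and cubes of side less than `w` miss many points. -/
structure Localized (N D : ℕ) (x : ℕ → ℕ → ℝ) (j : ℕ) (P : Finset ℕ) (c : ℕ → ℝ) (w : ℝ) :
    Prop where
  sub : P ⊆ Finset.range N
  card : N ≤ 4 ^ j * P.card
  w_nonneg : 0 ≤ w
  close : ∀ k, k < j → ∀ i ∈ P, |x i k - c k| ≤ w / 4
  sep : ∀ (c' : ℕ → ℝ) (t : ℝ), t < w → ∃ M : Finset ℕ, M ⊆ Finset.range N ∧
    N ≤ 4 ^ j * M.card ∧ ∀ i ∈ M, ∃ k < D, t / 2 < |x i k - c' k|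

theorem Localized.congr_center {N D : ℕ} {x : ℕ → ℕ → ℝ} {j : ℕ} {P : Finset ℕ}
    {c c' : ℕ → ℝ} {w : ℝ} (h : Localized N D x j P c w) (hc : ∀ k, k < j → c' k = c k) :
    Localized N D x j P c' w :=
  ⟨h.sub, h.card, h.w_nonneg, fun k hk => by rw [hc k hk]; exact h.close k hk, h.sep⟩

theorem Localized.congr_points {N D : ℕ} {x x' : ℕ → ℕ → ℝ} {j : ℕ} {P : Finset ℕ}
    {c : ℕ → ℝ} {w : ℝ} (h : Localized N D x j P c w) (hj : j ≤ D)
    (hx : ∀ i, i < N → ∀ k, k < D → x' i k = x i k) : Localized N D x' j P c w := by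
  refine ⟨h.sub, h.card, h.w_nonneg, fun k hk i hi => ?_, fun c' t ht => ?_⟩
  · rw [hx i (Finset.mem_range.1 (h.sub hi)) k (by omega)]
    exact h.close k hk i hi
  · obtain ⟨M, h1, h2, h3⟩ := h.sep c' t ht
    refine ⟨M, h1, h2, fun i hi => ?_⟩
    obtain ⟨k, hk, h4⟩ := h3 i hi
    exact ⟨k, hk, by rwa [hx i (Finset.mem_range.1 (h1 hi)) k hk]⟩

theorem Localized.zero {N D : ℕ} (x : ℕ → ℕ → ℝ) (c : ℕ → ℝ) (hD : 1 ≤ D) :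
    Localized N D x 0 (Finset.range N) c 0 := by
  refine ⟨subset_rfl, by simp, le_rfl, by simp, fun c' t ht => ?_⟩
  refine ⟨Finset.range N, subset_rfl, by simp, fun i _ => ⟨0, hD, ?_⟩⟩
  have := abs_nonneg (x i 0 - c' 0)
  linarith

theorem Localized.step {N D : ℕ} {x : ℕ → ℕ → ℝ} {j : ℕ} {P : Finset ℕ}
    {c : ℕ → ℝ} {w : ℝ} (h : Localized N D x j P c w) (hj : j < D) {a b lo hi w' : ℝ}
    {P' : Finset ℕ}
    (hP' : ∀ i, i ∈ P' ↔ i ∈ P ∧ lo ≤ x i j ∧ x i j ≤ hi)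
    (hcard : P.card ≤ 4 * P'.card)
    (ha : P.card ≤ 4 * (P.filter fun i => x i j ≤ a).card)
    (hb : P.card ≤ 4 * (P.filter fun i => b ≤ x i j).card)
    (hlen : hi - lo = (b - a) / 2) (hc : c j = (lo + hi) / 2) (hw : w' = max w (b - a)) :
    Localized N D x (j + 1) P' c w' := by
  have hww : w ≤ w' := hw ▸ le_max_left _ _
  have hwb : b - a ≤ w' := hw ▸ le_max_right _ _
  have hN := h.card
  have lift : ∀ m : ℕ, P.card ≤ 4 * m → N ≤ 4 ^ (j + 1) * m := by
    intro m hm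
    calc N ≤ 4 ^ j * P.card := hN
      _ ≤ 4 ^ j * (4 * m) := Nat.mul_le_mul_left _ hm
      _ = 4 ^ (j + 1) * m := by ring
  refine ⟨fun i hi => h.sub ((hP' i).1 hi).1, lift _ hcard, h.w_nonneg.trans hww, ?_, ?_⟩
  · intro k hk i hi
    obtain ⟨h1, h2, h3⟩ := (hP' i).1 hi
    rcases Nat.lt_succ_iff_lt_or_eq.1 hk with hk | rfl
    · exact (h.close k hk i h1).trans (by linarith)
    · rw [hc, abs_le]
      constructor <;> linarith
  · intro c' t ht
    rcases lt_or_ge t w with h1 | h1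
    · obtain ⟨M, h2, h3, h4⟩ := h.sep c' t h1
      refine ⟨M, h2, h3.trans (Nat.mul_le_mul_right _ ?_), h4⟩
      exact Nat.pow_le_pow_right (by norm_num) (by omega)
    · have hba : t < b - a := by
        rcases le_total w (b - a) with h2 | h2
        · rwa [hw, max_eq_right h2] at ht
        · rw [hw, max_eq_left h2] at ht
          exact absurd ht (not_lt.2 h1)
      by_cases hca : a < c' j - t / 2
      · refine ⟨_, (Finset.filter_subset _ P).trans h.sub, lift _ ha, fun i hi => ⟨j, hj, ?_⟩⟩
        have := (Finset.mem_filter.1 hi).2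
        rw [lt_abs]
        right
        linarith
      · refine ⟨_, (Finset.filter_subset _ P).trans h.sub, lift _ hb, fun i hi => ⟨j, hj, ?_⟩⟩
        have := (Finset.mem_filter.1 hi).2
        rw [lt_abs]
        left
        linarith

section Stage

variable {d n : ℕ} {X : Fin n → Set (Fin d → ℝ)} {ps : List Cmd}

/-- One round of the computation of the centre. -/
def roundCmd : Cmd :=
  quartileCmd ;; countCmd ;;
  .ite (.realLe (.sub (.get (.add (rg 4) (.lit 3))) (.get (.add (rg 4) (.lit 2))))
      (.get (.add (rg 4) (.lit 1)))) .skip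
    (.setReal (.add (rg 4) (.lit 1))
      (.sub (.get (.add (rg 4) (.lit 3))) (.get (.add (rg 4) (.lit 2))))) ;;
  .ite (.natLe (rg 12) (rg 11))
    (.setReal (.add (rg 4) (.lit 3)) (.get (.add (rg 4) (.lit 4))))
    (.setReal (.add (rg 4) (.lit 2)) (.get (.add (rg 4) (.lit 4)))) ;;
  .setReal (.add (.add (rg 4) (.lit 16)) (rg 13))
    (.div (.add (.get (.add (rg 4) (.lit 2))) (.get (.add (rg 4) (.lit 3)))) (.ofNat (.lit 2))) ;;
  filterCmd

/-- The coordinates of the representative points in the memory. -/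
def coord (σ : State) (i j : ℕ) : ℝ := σ.real (i * (2 * σ.nat 0 + 1) + j)

theorem roundCmd_spec (hps : ps[0]? = some selectCmd) (σ : State)
    (h5 : 40 + σ.nat 1 ≤ σ.nat 5) (h4 : σ.nat 1 * (2 * σ.nat 0 + 1) ≤ σ.nat 4)
    (h6 : σ.nat 4 + 16 + σ.nat 0 ≤ σ.nat 6)
    (hj : σ.nat 13 < σ.nat 0) (hN : 1 ≤ σ.nat 1)
    (hL : Localized (σ.nat 1) (σ.nat 0) (coord σ) (σ.nat 13) (flagged (σ.nat 1) σ)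
      (fun k => σ.real (σ.nat 4 + 16 + k)) (σ.real (σ.nat 4 + 1))) :
    W X ps roundCmd σ fun τ t => t ≤ 65000 * σ.nat 1 + 2000 ∧
      (∀ a, a ∈ mainRegs → τ.nat a = σ.nat a) ∧
      σ.nat 6 ≤ τ.nat 6 ∧
      (∀ a, a < σ.nat 4 → τ.real a = σ.real a) ∧
      Localized (σ.nat 1) (σ.nat 0) (coord σ) (σ.nat 13 + 1) (flagged (σ.nat 1) τ)
      (fun k => τ.real (σ.nat 4 + 16 + k)) (τ.real (σ.nat 4 + 1)) := by
  have hP : 1 ≤ (flagged (σ.nat 1) σ).card := by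
    have := hL.card
    by_contra h
    have h0 : (flagged (σ.nat 1) σ).card = 0 := by omega
    rw [h0] at this
    omega
  have hidx : ∀ i, i < σ.nat 1 → i * (2 * σ.nat 0 + 1) + σ.nat 13 < σ.nat 4 :=
    fun i hi => (rep_index_lt hi hj).trans_le h4
  unfold roundCmd
  refine .seq ((quartileCmd_spec hps σ h5 h4 (by omega) hj hP).mono ?_)
  rintro σ₁ t₁ ⟨T1, N1, fl1, f6, m1, R1, A1, a, b, ra, rb, rm, qa1, qa2, qb1, qb2⟩
  obtain ⟨hab, hbc, hmid⟩ := quartiles (x := fun i => coord σ i (σ.nat 13)) qa2 qb1 qb2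
  have g0 := N1 0 (by decide)
  have g1 := N1 1 (by decide)
  have g4 := N1 4 (by decide)
  have g13 := N1 13 (by decide)
  refine .seq ((countCmd_spec σ₁).mono ?_)
  rintro σ₂ t₂ ⟨T2, N2, R2, K1, K2⟩
  have k0 := N2 0 (by decide)
  have k1 := N2 1 (by decide)
  have k4 := N2 4 (by decide)
  have k13 := N2 13 (by decide)
  rw [A1, countP_gather, g4, ra, rm] at K1
  rw [A1, countP_gather, g4, rb, rm] at K2
  rw [g0] at k0
  rw [g1] at k1
  rw [g4] at k4
  rw [g13] at k13
  rw [← R2] at ra rb rm R1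
  have flag : ∀ τ : State, (∀ i, i < σ.nat 1 → (1 ≤ τ.nat (40 + i) ↔ 1 ≤ σ₂.nat (40 + i) ∧
      τ.real (σ.nat 4 + 2) ≤ coord σ i (σ.nat 13) ∧
        coord σ i (σ.nat 13) ≤ τ.real (σ.nat 4 + 3))) →
      ∀ i, i ∈ flagged (σ.nat 1) τ ↔ i ∈ flagged (σ.nat 1) σ ∧
        τ.real (σ.nat 4 + 2) ≤ coord σ i (σ.nat 13) ∧
        coord σ i (σ.nat 13) ≤ τ.real (σ.nat 4 + 3) := by
    intro τ h i
    simp only [flagged, Finset.mem_filter, Finset.mem_range]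
    constructor
    · rintro ⟨h1, h2⟩
      have := (h i h1).1 h2
      rw [N2 _ (by simp; omega), fl1 i h1] at this
      exact ⟨⟨h1, this.1⟩, this.2⟩
    · rintro ⟨⟨h1, h2⟩, h3⟩
      refine ⟨h1, (h i h1).2 ?_⟩
      rw [N2 _ (by simp; omega), fl1 i h1]
      exact ⟨h2, h3⟩
  refine .seq (W.mono (Q := fun τ t => t ≤ 50 ∧ τ.nat = σ₂.nat ∧
    τ.real (σ.nat 4 + 1) = max (σ.real (σ.nat 4 + 1)) (b - a) ∧
    ∀ e, e ≠ σ.nat 4 + 1 → τ.real e = σ₂.real e) ?_ ?_)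
  · have hw : σ₂.real (σ.nat 4 + 1) = σ.real (σ.nat 4 + 1) := R1 _ (by omega) (by simp)
    refine .ite (fun h => .skip ?_) (fun h => .setReal ?_) <;> simp [k4, ra, rb, hw] at h ⊢
    · linarith
    · refine ⟨by linarith, fun e he => by simp [he]⟩
  rintro σ₃ t₃ ⟨T3, N3, W3, R3⟩
  have hlow : ∀ e, e < σ.nat 4 → σ₃.real e = σ.real e := by
    intro e he
    rw [R3 e (by omega), R1 e (by omega) (by simp; omega)]
  have hcen : ∀ k, k < σ.nat 13 → σ₃.real (σ.nat 4 + 16 + k) = σ.real (σ.nat 4 + 16 + k) := by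
    intro k hk
    rw [R3 _ (by omega), R1 _ (by omega) (by simp; omega)]
  rw [← R3 _ (by omega)] at ra rb rm
  have key : ∀ (lo hi : ℝ) (τ : State) (Q : State → ℕ → Prop), hi - lo = (b - a) / 2 →
      (flagged (σ.nat 1) σ).card ≤ 4 * ((flagged (σ.nat 1) σ).filter fun i =>
        lo ≤ coord σ i (σ.nat 13) ∧ coord σ i (σ.nat 13) ≤ hi).card →
      τ.nat = σ₂.nat → τ.real (σ.nat 4 + 2) = lo → τ.real (σ.nat 4 + 3) = hi →
      (∀ e, e ≠ σ.nat 4 + 2 → e ≠ σ.nat 4 + 3 → τ.real e = σ₃.real e) →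
      (∀ (τ' : State) (t : ℕ), t ≤ 100 * σ.nat 1 + 150 →
        (∀ e, e ∈ mainRegs → τ'.nat e = σ.nat e) → σ.nat 6 ≤ τ'.nat 6 →
        (∀ e, e < σ.nat 4 → τ'.real e = σ.real e) →
        Localized (σ.nat 1) (σ.nat 0) (coord σ) (σ.nat 13 + 1) (flagged (σ.nat 1) τ')
          (fun k => τ'.real (σ.nat 4 + 16 + k)) (τ'.real (σ.nat 4 + 1)) → Q τ' t) →
      W X ps (.setReal (.add (.add (rg 4) (.lit 16)) (rg 13))
        (.div (.add (.get (.add (rg 4) (.lit 2))) (.get (.add (rg 4) (.lit 3))))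
          (.ofNat (.lit 2))) ;; filterCmd) τ Q := by
    intro lo hi τ Q hlen hcard hn hlo hhi hR hQ
    refine .seq (.setReal ((filterCmd_spec _).mono ?_))
    rintro τ' t ⟨T, N4, R4, F4⟩
    simp only [State.setReal_nat, hn, k1, k0, k4, k13, NatExpr.eval, State.setReal_real,
      RealExpr.eval, hlo, hhi] at T N4 R4 F4
    have hlo' : τ'.real (σ.nat 4 + 2) = lo := by
      rw [R4]; simp [hlo]; omega
    have hhi' : τ'.real (σ.nat 4 + 3) = hi := by
      rw [R4]; simp [hhi]; omega
    have hm : ∀ i, i ∈ flagged (σ.nat 1) τ' ↔ i ∈ flagged (σ.nat 1) σ ∧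
        lo ≤ coord σ i (σ.nat 13) ∧ coord σ i (σ.nat 13) ≤ hi := by
      have := flag τ' ?_
      · rwa [hlo', hhi'] at this
      · intro i hi
        have hx := hidx i hi
        rw [F4 i hi, hlo', hhi', if_neg (by omega), if_neg (by omega), if_neg (by omega),
          hR _ (by omega) (by omega), hlow _ hx]
        rfl
    apply hQ
    · simp; omega
    · intro e he
      rw [N4 e (by simp [mainRegs] at he; omega) (by simp [mainRegs] at he; omega),
        N2 e (by simp [mainRegs] at he ⊢; omega), N1 e he]
    · rw [N4 6 (by omega) (by omega), N2 6 (by decide)]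
      exact f6
    · intro e he
      rw [R4]
      simp [hn, k4, k13]
      rw [if_neg (by omega), hR e (by omega) (by omega), hlow e he]
    · refine (hL.congr_center (c' := fun k => τ'.real (σ.nat 4 + 16 + k)) ?_).step hj
        (a := a) (b := b) hm ?_ qa1 hbc hlen ?_ ?_
      · intro k hk
        rw [R4]
        simp
        rw [if_neg (by omega), hR _ (by omega) (by omega), hcen k hk]
      · refine hcard.trans (Nat.mul_le_mul_left _ (Finset.card_le_card fun i hi => ?_))
        exact (hm i).2 (Finset.mem_filter.1 hi)
      · rw [R4]
        simp [hn, k4, k13, hlo, hhi]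
      · rw [R4]
        simp
        rw [if_neg (by omega), hR _ (by omega) (by omega), W3]
  have E1 : σ₃.nat 11 = ((flagged (σ.nat 1) σ).filter fun i =>
      a ≤ coord σ i (σ.nat 13) ∧ coord σ i (σ.nat 13) ≤ (a + b) / 2).card := by
    rw [N3, K1]; rfl
  have E2 : σ₃.nat 12 = ((flagged (σ.nat 1) σ).filter fun i =>
      (a + b) / 2 ≤ coord σ i (σ.nat 13) ∧ coord σ i (σ.nat 13) ≤ b).card := by
    rw [N3, K2]; rfl
  have hn1 : σ₁.nat 17 ≤ σ.nat 1 := m1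
  rw [← N3] at k4
  refine .seq (.ite (fun h => .setReal ?_) (fun h => .setReal ?_))
  · simp only [Test.Holds, NatExpr.eval] at h
    refine key a ((a + b) / 2) _ _ (by ring) ?_ (by simp [N3]) ?_ ?_ ?_ ?_
    · omega
    · simp [k4, ra]
    · simp [k4, rm]
    · intro e h1 h2
      simp [k4, h2]
    · intro τ' t ht c1 c2 c3 c4
      refine ⟨by simp; omega, c1, c2, c3, c4⟩
  · simp only [Test.Holds, NatExpr.eval] at h
    refine key ((a + b) / 2) b _ _ (by ring) ?_ (by simp [N3]) ?_ ?_ ?_ ?_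
    · omega
    · simp [k4, rm]
    · simp [k4, rb]
    · intro e h1 h2
      simp [k4, h1]
    · intro τ' t ht c1 c2 c3 c4
      refine ⟨by simp; omega, c1, c2, c3, c4⟩

end Stage

section Phases

variable {d n : ℕ} {X : Fin n → Set (Fin d → ℝ)} {ps : List Cmd}

/-- Initialises the registers and flags all objects of the first collection. -/
def initCmd : Cmd :=
  .setNat (.lit 3) (.add (rg 1) (rg 2)) ;;
  .setNat (.lit 4) (.mul (rg 3) (.add (.mul (.lit 2) (rg 0)) (.lit 1))) ;;
  .setNat (.lit 5) (.add (.lit 40) (rg 3)) ;;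
  .setNat (.lit 6) (.add (.add (rg 4) (.lit 17)) (rg 0)) ;;
  .setNat (.lit 13) (.lit 0) ;;
  .setReal (.add (rg 4) (.lit 1)) (.ofNat (.lit 0)) ;;
  .setNat (.lit 10) (.lit 0) ;;
  .loop (.natLe (.add (rg 10) (.lit 1)) (rg 1))
    (.setNat (.add (.lit 40) (rg 10)) (.lit 1) ;; .setNat (.lit 10) (.add (rg 10) (.lit 1)))

/-- The registers that describe the input and the layout of the memory. -/
structure Layout (σ τ : State) : Prop where
  nat0 : τ.nat 0 = σ.nat 0
  nat1 : τ.nat 1 = σ.nat 1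
  nat3 : τ.nat 3 = σ.nat 1 + σ.nat 2
  nat4 : τ.nat 4 = (σ.nat 1 + σ.nat 2) * (2 * σ.nat 0 + 1)
  nat5 : τ.nat 5 = 40 + (σ.nat 1 + σ.nat 2)
  nat6 : τ.nat 4 + 17 + σ.nat 0 ≤ τ.nat 6
  real : ∀ a, a < τ.nat 4 → τ.real a = σ.real a

theorem initCmd_spec (σ : State) :
    W X ps initCmd σ fun τ t => t ≤ 50 * σ.nat 1 + 100 ∧ Layout σ τ ∧
      τ.nat 13 = 0 ∧ τ.real (τ.nat 4 + 1) = 0 ∧ ∀ i, i < σ.nat 1 → τ.nat (40 + i) = 1 := by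
  unfold initCmd
  refine .seq (.setNat (.seq (.setNat (.seq (.setNat (.seq (.setNat (.seq (.setNat
    (.seq (.setReal (.seq (.setNat ?_)))))))))))))
  refine .loop (fun τ => τ.nat 10 ≤ σ.nat 1 ∧ Layout σ τ ∧
      τ.nat 13 = 0 ∧ τ.real (τ.nat 4 + 1) = 0 ∧ ∀ i, i < τ.nat 10 → τ.nat (40 + i) = 1)
    (fun τ => 50 * (σ.nat 1 - τ.nat 10)) ?_ ?_ ?_
  · refine ⟨by simp, ⟨by simp, by simp, by simp, by simp, by simp, by simp, ?_⟩, by simp, by simp,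
      by simp⟩
    intro a ha
    simp at ha ⊢
    omega
  · rintro τ ⟨i1, L, i2, i3, i4⟩ hb
    have r1 := L.nat1
    simp [r1] at hb
    have ne (i : ℕ) : (40 + i = 10) = False := by simp; omega
    have n1 (a i : ℕ) (h : a < 40) : (a = 40 + i) = False := by simp; omega
    refine .seq (.setNat (.setNat ?_))
    simp [ne, n1, i2, i3]
    refine ⟨⟨by omega, ⟨?_, ?_, ?_, ?_, ?_, ?_, ?_⟩, ?_⟩, by omega⟩
    · simpa [n1] using L.nat0
    · simpa [n1] using L.nat1
    · simpa [n1] using L.nat3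
    · simpa [n1] using L.nat4
    · simpa [n1] using L.nat5
    · simpa [n1] using L.nat6
    · simpa [n1] using L.real
    · intro i hi h
      exact i4 i (by omega)
  · rintro τ t ⟨i1, L, i2, i3, i4⟩ hb ht
    have r1 := L.nat1
    simp [r1] at hb ht
    have : τ.nat 10 = σ.nat 1 := by omega
    rw [this] at i4 ht
    exact ⟨by simp; omega, L, i2, i3, i4⟩

/-- Computes the centre. -/
def centerCmd : Cmd :=
  .loop (.natLe (.add (rg 13) (.lit 1)) (rg 0))
    (roundCmd ;; .setNat (.lit 13) (.add (rg 13) (.lit 1)))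

/-- Initialisation and computation of the centre. -/
def prepareCmd : Cmd :=
  initCmd ;; .ite (.natLe (.lit 1) (rg 1)) centerCmd .skip

theorem sub_mul_step {a b : ℕ} (h : a < b) (K : ℕ) :
    (b - a) * K = (b - (a + 1)) * K + K := by
  obtain ⟨c, rfl⟩ := Nat.exists_eq_add_of_lt h
  have e1 : a + c + 1 - a = c + 1 := by omega
  have e2 : a + c + 1 - (a + 1) = c := by omega
  rw [e1, e2, Nat.succ_mul]

theorem prepareCmd_spec (hps : ps[0]? = some selectCmd) (σ : State) (hd : 1 ≤ σ.nat 0) :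
    W X ps prepareCmd σ fun τ t =>
      t ≤ 50 * σ.nat 1 + 300 + σ.nat 0 * (65000 * σ.nat 1 + 2100) ∧ Layout σ τ ∧
      ∃ P, Localized (σ.nat 1) (σ.nat 0) (coord σ) (σ.nat 0) P
        (fun k => τ.real (τ.nat 4 + 16 + k)) (τ.real (τ.nat 4 + 1)) := by
  unfold prepareCmd
  refine .seq ((initCmd_spec σ).mono ?_)
  rintro σ₁ t₁ ⟨T1, L1, z1, w1, f1⟩
  have hR : σ.nat 1 * (2 * σ.nat 0 + 1) ≤ σ₁.nat 4 := by
    rw [L1.nat4]; exact Nat.mul_le_mul_right _ (by omega)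
  refine .ite ?_ ?_
  · intro hN
    simp [L1.nat1] at hN
    unfold centerCmd
    refine .loop (fun τ => Layout σ τ ∧ τ.nat 13 ≤ σ.nat 0 ∧
        Localized (σ.nat 1) (σ.nat 0) (coord σ) (τ.nat 13) (flagged (σ.nat 1) τ)
          (fun k => τ.real (τ.nat 4 + 16 + k)) (τ.real (τ.nat 4 + 1)))
      (fun τ => (σ.nat 0 - τ.nat 13) * (65000 * σ.nat 1 + 2100)) ?_ ?_ ?_
    · refine ⟨L1, by omega, ?_⟩
      have : flagged (σ.nat 1) σ₁ = Finset.range (σ.nat 1) := by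
        ext i
        simp only [flagged, Finset.mem_filter, Finset.mem_range]
        exact ⟨fun h => h.1, fun h => ⟨h, (f1 i h).ge⟩⟩
      rw [z1, w1, this]
      exact Localized.zero _ _ hd
    · rintro τ ⟨L, i1, hL⟩ hb
      have g0 := L.nat0
      have g1 := L.nat1
      have e4 : τ.nat 4 = σ₁.nat 4 := by rw [L.nat4, L1.nat4]
      simp [g0] at hb
      have hcoord : ∀ i, i < σ.nat 1 → ∀ k, k < σ.nat 0 → coord τ i k = coord σ i k := by
        intro i hi k hk
        unfold coord
        rw [g0]
        exact L.real _ ((rep_index_lt hi hk).trans_le (e4 ▸ hR))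
      have L6 := L.nat6
      have L5 := L.nat5
      refine .seq ((roundCmd_spec hps τ (by omega) (by rw [g0, g1, e4]; exact hR) (by omega)
        (by omega) (by omega) ?_).mono ?_)
      · rw [g0, g1]
        exact hL.congr_points i1 hcoord
      · rintro τ' t ⟨T, N, F, R, hL'⟩
        have q4 := N 4 (by decide)
        have q13 := N 13 (by decide)
        refine .setNat ⟨⟨⟨?_, ?_, ?_, ?_, ?_, ?_, ?_⟩, ?_, ?_⟩, ?_⟩
        · simpa [N 0 (by decide)] using g0
        · simpa [N 1 (by decide)] using g1
        · simpa [N 3 (by decide)] using L.nat3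
        · simpa [N 4 (by decide)] using L.nat4
        · simpa [N 5 (by decide)] using L.nat5
        · simp [q4]; omega
        · intro a ha
          simp [q4] at ha
          simp [R a ha, L.real a ha]
        · simp [q13]; omega
        · rw [g0, g1] at hL'
          have := hL'.congr_points (by omega) fun i hi k hk => (hcoord i hi k hk).symm
          simp [q4, q13]
          convert this using 1
          unfold flagged
          apply Finset.filter_congr
          intro i _
          simp
          have : (40 + i = 13) = False := by simp; omega
          simp [this]
        · have := sub_mul_step hb (65000 * σ.nat 1 + 2100)
          simp [q13]
          rw [g1] at T
          omega
    · rintro τ t ⟨L, i1, hL⟩ hb ht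
      simp [L.nat0] at hb
      have : τ.nat 13 = σ.nat 0 := by omega
      rw [this] at hL
      refine ⟨?_, L, _, hL⟩
      rw [this, z1] at ht
      simp at ht ⊢
      omega
  · intro hN
    simp [L1.nat1] at hN
    refine .skip ⟨by simp; omega, L1, ∅, ?_⟩
    rw [w1, hN]
    exact ⟨by simp, by simp, le_rfl, by simp, fun _ _ _ => ⟨∅, by simp, by simp, by simp⟩⟩

/-- Computes the distance of the representative point of the object `rg 10` from the centre. -/
def distCmd : Cmd :=
  .setReal (.add (rg 4) (.lit 6)) (.ofNat (.lit 0)) ;; .setNat (.lit 13) (.lit 0) ;;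
  .loop (.natLe (.add (rg 13) (.lit 1)) (rg 0))
    (.setReal (.add (rg 4) (.lit 7))
      (.sub (.get repAddr) (.get (.add (.add (rg 4) (.lit 16)) (rg 13)))) ;;
     .ite (.realLe (.get (.add (rg 4) (.lit 7))) (.ofNat (.lit 0)))
      (.setReal (.add (rg 4) (.lit 7)) (.sub (.ofNat (.lit 0)) (.get (.add (rg 4) (.lit 7)))))
      .skip ;;
     .ite (.realLe (.get (.add (rg 4) (.lit 7))) (.get (.add (rg 4) (.lit 6)))) .skip
      (.setReal (.add (rg 4) (.lit 6)) (.get (.add (rg 4) (.lit 7)))) ;;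
     .setNat (.lit 13) (.add (rg 13) (.lit 1)))

/-- `D` is the maximum distance of the first `N` coordinates of `x` and `c`. -/
def IsDist (N : ℕ) (x c : ℕ → ℝ) (D : ℝ) : Prop :=
  ∀ s, D ≤ s ↔ 0 ≤ s ∧ ∀ k, k < N → |x k - c k| ≤ s

theorem IsDist.succ {N : ℕ} {x c : ℕ → ℝ} {D : ℝ} (h : IsDist N x c D) :
    IsDist (N + 1) x c (max D |x N - c N|) := by
  intro s
  rw [max_le_iff, h s]
  constructor
  · rintro ⟨⟨h1, h2⟩, h3⟩
    refine ⟨h1, fun k hk => ?_⟩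
    rcases Nat.lt_succ_iff_lt_or_eq.1 hk with hk | rfl
    · exact h2 k hk
    · exact h3
  · rintro ⟨h1, h2⟩
    exact ⟨⟨h1, fun k hk => h2 k (by omega)⟩, h2 N (by omega)⟩

theorem distCmd_spec (σ : State) (hi : σ.nat 10 * (2 * σ.nat 0 + 1) + σ.nat 0 ≤ σ.nat 4) :
    W X ps distCmd σ fun τ t => t ≤ 150 * σ.nat 0 + 50 ∧
      (∀ a, a ≠ 13 → τ.nat a = σ.nat a) ∧
      (∀ a, a ≠ σ.nat 4 + 6 → a ≠ σ.nat 4 + 7 → τ.real a = σ.real a) ∧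
      IsDist (σ.nat 0) (coord σ (σ.nat 10)) (fun k => σ.real (σ.nat 4 + 16 + k))
        (τ.real (σ.nat 4 + 6)) := by
  unfold distCmd
  refine .seq (.setReal (.seq (.setNat ?_)))
  refine .loop (fun τ => τ.nat 13 ≤ σ.nat 0 ∧ (∀ a, a ≠ 13 → τ.nat a = σ.nat a) ∧
      (∀ a, a ≠ σ.nat 4 + 6 → a ≠ σ.nat 4 + 7 → τ.real a = σ.real a) ∧
      IsDist (τ.nat 13) (coord σ (σ.nat 10)) (fun k => σ.real (σ.nat 4 + 16 + k))
        (τ.real (σ.nat 4 + 6)))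
    (fun τ => 150 * (σ.nat 0 - τ.nat 13)) ?_ ?_ ?_
  · refine ⟨by simp, by simp +contextual, by simp +contextual, ?_⟩
    intro s
    simp
  · rintro τ ⟨i1, i2, i3, i4⟩ hb
    have g0 := i2 0 (by decide)
    have g4 := i2 4 (by decide)
    have g10 := i2 10 (by decide)
    simp [g0] at hb
    have hx : τ.real (σ.nat 10 * (2 * σ.nat 0 + 1) + τ.nat 13) = coord σ (σ.nat 10) (τ.nat 13) :=
      i3 _ (by omega) (by omega)
    have hc : τ.real (σ.nat 4 + 16 + τ.nat 13) = σ.real (σ.nat 4 + 16 + τ.nat 13) :=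
      i3 _ (by omega) (by omega)
    refine .seq (.setReal (.seq (W.mono (Q := fun υ t => t ≤ 30 ∧ υ.nat = τ.nat ∧
      (∀ a, a ≠ σ.nat 4 + 7 → υ.real a = τ.real a) ∧ υ.real (σ.nat 4 + 7) =
        |coord σ (σ.nat 10) (τ.nat 13) - σ.real (σ.nat 4 + 16 + τ.nat 13)|) ?_ ?_)))
    · refine .ite (fun h => .setReal ?_) (fun h => .skip ?_) <;>
      simp [g0, g4, g10, hx, hc] at h ⊢
      · refine ⟨by simp +contextual, ?_⟩
        rw [abs_of_nonpos (by linarith)]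
        ring
      · refine ⟨by simp +contextual, ?_⟩
        rw [abs_of_nonneg (by linarith)]
    rintro υ t ⟨T, N, R, V⟩
    have R6 := R (σ.nat 4 + 6) (by omega)
    refine .seq (W.mono (Q := fun υ t => t ≤ 30 ∧ υ.nat = τ.nat ∧
      (∀ a, a ≠ σ.nat 4 + 6 → a ≠ σ.nat 4 + 7 → υ.real a = τ.real a) ∧ υ.real (σ.nat 4 + 6) =
        max (τ.real (σ.nat 4 + 6))
          |coord σ (σ.nat 10) (τ.nat 13) - σ.real (σ.nat 4 + 16 + τ.nat 13)|) ?_ ?_)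
    · refine .ite (fun h => .skip ?_) (fun h => .setReal ?_) <;>
      simp [N, g4, V, R6] at h ⊢
      · refine ⟨fun a _ ha => R a ha, h⟩
      · refine ⟨fun a h1 h2 => by simp [h1, R a h2], h.le⟩
    · rintro υ' t' ⟨T', N', R', V'⟩
      refine .setNat ?_
      simp [N', V']
      refine ⟨⟨by omega, ?_, ?_, i4.succ⟩, by omega⟩
      · intro a ha
        simp [ha, i2 a ha]
      · intro a h1 h2
        rw [R' a h1 h2, i3 a h1 h2]
  · rintro τ t ⟨i1, i2, i3, i4⟩ hb ht
    simp [i2 0 (by decide)] at hb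
    have : τ.nat 13 = σ.nat 0 := by omega
    rw [this] at i4 ht
    simp at ht
    exact ⟨by simp; omega, i2, i3, i4⟩

end Phases

section Phases

variable {d n : ℕ} {X : Fin n → Set (Fin d → ℝ)} {ps : List Cmd}

/-- The address of the side length of the object `rg 10`. -/
abbrev sideAddr : NatExpr :=
  .add (.mul (rg 10) (.add (.mul (.lit 2) (rg 0)) (.lit 1))) (.mul (.lit 2) (rg 0))

/-- Shrinks the radius if a positive length is smaller. -/
def shrinkCmd (a : NatExpr) : Cmd :=
  .ite (.and (.not (.realLe (.get a) (.ofNat (.lit 0))))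
      (.not (.realLe (.get (.add (rg 4) (.lit 5))) (.get a))))
    (.setReal (.add (rg 4) (.lit 5)) (.get a)) .skip

theorem shrinkCmd_spec (σ : State) (a : NatExpr) (h : 0 < σ.real (σ.nat 4 + 5)) :
    W X ps (shrinkCmd a) σ fun τ t => t ≤ 2 * a.cost + a.cost + 30 ∧ τ.nat = σ.nat ∧
      (∀ e, e ≠ σ.nat 4 + 5 → τ.real e = σ.real e) ∧ 0 < τ.real (σ.nat 4 + 5) ∧
      τ.real (σ.nat 4 + 5) ≤ σ.real (σ.nat 4 + 5) ∧
      (σ.real (a.eval σ) ≤ 0 ∨ τ.real (σ.nat 4 + 5) ≤ σ.real (a.eval σ)) := by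
  unfold shrinkCmd
  refine .ite (fun hb => .setReal ?_) (fun hb => .skip ?_) <;> simp at hb ⊢
  · exact ⟨by omega, by simp +contextual, hb.1, hb.2.le⟩
  · refine ⟨by omega, h, ?_⟩
    rcases le_or_gt (σ.real (a.eval σ)) 0 with h' | h'
    · exact Or.inl h'
    · exact Or.inr (hb h')

/-- Computes a tiny hypercube with the centre on its boundary. -/
def tinyCmd : Cmd :=
  .setReal (.add (rg 4) (.lit 5)) (.ofNat (.lit 1)) ;; .setNat (.lit 10) (.lit 0) ;;
  .loop (.natLe (.add (rg 10) (.lit 1)) (rg 3))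
    (distCmd ;; shrinkCmd sideAddr ;; shrinkCmd (.add (rg 4) (.lit 6)) ;;
      .setNat (.lit 10) (.add (rg 10) (.lit 1))) ;;
  .setReal (.add (rg 4) (.lit 5)) (.div (.get (.add (rg 4) (.lit 5))) (.ofNat (.lit 2))) ;;
  .setReal (.add (.add (rg 4) (.lit 16)) (rg 0)) (.get (.add (rg 4) (.lit 5))) ;;
  .setReal (.add (rg 4) (.lit 16)) (.sub (.get (.add (rg 4) (.lit 16)))
    (.div (.get (.add (rg 4) (.lit 5))) (.ofNat (.lit 2))))

/-- The parameters of the input and the position of the working area. -/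
structure Kept (σ τ : State) : Prop where
  nat0 : τ.nat 0 = σ.nat 0
  nat3 : τ.nat 3 = σ.nat 3
  nat4 : τ.nat 4 = σ.nat 4

theorem tinyCmd_spec (σ : State) (h4 : σ.nat 4 = σ.nat 3 * (2 * σ.nat 0 + 1))
    (hd : 1 ≤ σ.nat 0) :
    W X ps tinyCmd σ fun τ t => t ≤ σ.nat 3 * (150 * σ.nat 0 + 300) + 100 ∧ Kept σ τ ∧
      ∃ r, 0 < r ∧ τ.real (σ.nat 4 + 16 + σ.nat 0) = r ∧
        τ.real (σ.nat 4 + 16) = σ.real (σ.nat 4 + 16) - r / 2 ∧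
        (∀ k, 1 ≤ k → k < σ.nat 0 →
          τ.real (σ.nat 4 + 16 + k) = σ.real (σ.nat 4 + 16 + k)) ∧
        ∀ i, i < σ.nat 3 →
          (σ.real (i * (2 * σ.nat 0 + 1) + 2 * σ.nat 0) ≤ 0 ∨
            r ≤ σ.real (i * (2 * σ.nat 0 + 1) + 2 * σ.nat 0)) ∧
          ∃ D, IsDist (σ.nat 0) (coord σ i) (fun k => σ.real (σ.nat 4 + 16 + k)) D ∧
            (D ≤ 0 ∨ r < D) := by
  unfold tinyCmd
  refine .seq (.setReal (.seq (.setNat (.seq ?_))))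
  refine .loop (fun τ => τ.nat 10 ≤ σ.nat 3 ∧ Kept σ τ ∧ 0 < τ.real (σ.nat 4 + 5) ∧
      (∀ a, a < σ.nat 4 ∨ σ.nat 4 + 16 ≤ a → τ.real a = σ.real a) ∧
      ∀ i, i < τ.nat 10 →
          (σ.real (i * (2 * σ.nat 0 + 1) + 2 * σ.nat 0) ≤ 0 ∨
            τ.real (σ.nat 4 + 5) ≤ σ.real (i * (2 * σ.nat 0 + 1) + 2 * σ.nat 0)) ∧
          ∃ D, IsDist (σ.nat 0) (coord σ i) (fun k => σ.real (σ.nat 4 + 16 + k)) D ∧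
            (D ≤ 0 ∨ τ.real (σ.nat 4 + 5) ≤ D))
    (fun τ => (σ.nat 3 - τ.nat 10) * (150 * σ.nat 0 + 300)) ?_ ?_ ?_
  · refine ⟨by simp, ⟨by simp, by simp, by simp⟩, by simp, ?_, by simp⟩
    intro a ha
    simp; omega
  · rintro τ ⟨i1, ⟨g0, g3, g4⟩, i2, i3, i4⟩ hb
    simp [g3] at hb
    have hmul : τ.nat 10 * (2 * σ.nat 0 + 1) + (2 * σ.nat 0 + 1) ≤ σ.nat 4 := by
      rw [h4, ← Nat.succ_mul]
      exact Nat.mul_le_mul_right _ hb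
    have hside : τ.real (τ.nat 10 * (2 * σ.nat 0 + 1) + 2 * σ.nat 0) =
        σ.real (τ.nat 10 * (2 * σ.nat 0 + 1) + 2 * σ.nat 0) := i3 _ (by omega)
    refine .seq ((distCmd_spec τ (by rw [g0, g4]; omega)).mono ?_)
    rintro τ₁ t₁ ⟨T1, N1, R1, D1⟩
    have k4 : τ₁.nat 4 = σ.nat 4 := by rw [N1 4 (by decide), g4]
    have k0 : τ₁.nat 0 = σ.nat 0 := by rw [N1 0 (by decide), g0]
    have k3 : τ₁.nat 3 = σ.nat 3 := by rw [N1 3 (by decide), g3]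
    have k10 := N1 10 (by decide)
    rw [g0] at T1
    rw [g4] at R1
    have D1' : IsDist (σ.nat 0) (coord σ (τ.nat 10)) (fun k => σ.real (σ.nat 4 + 16 + k))
        (τ₁.real (σ.nat 4 + 6)) := by
      intro s
      have := D1 s
      rw [g0, g4] at this
      rw [this]
      refine and_congr_right fun _ => forall_congr' fun k => forall_congr' fun hk => ?_
      dsimp only [coord]
      rw [g0, i3 _ (by omega), i3 _ (by omega)]
    have h5 : τ₁.real (σ.nat 4 + 5) = τ.real (σ.nat 4 + 5) := R1 _ (by omega) (by omega)
    refine .seq ((shrinkCmd_spec τ₁ _ (by rw [k4, h5]; exact i2)).mono ?_)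
    rintro τ₂ t₂ ⟨T2, N2, R2, P2, S2, A2⟩
    simp only [NatExpr.eval, NatExpr.cost, k0, k10] at T2 A2
    rw [k4] at R2 P2 S2 A2
    rw [R1 _ (by omega) (by omega), hside] at A2
    have l4 : τ₂.nat 4 = σ.nat 4 := by rw [N2, k4]
    refine .seq ((shrinkCmd_spec τ₂ _ (by rw [l4]; exact P2)).mono ?_)
    rintro τ₃ t₃ ⟨T3, N3, R3, P3, S3, A3⟩
    simp only [NatExpr.eval, NatExpr.cost] at T3 A3
    rw [l4] at R3 P3 S3 A3
    rw [R2 _ (by omega)] at A3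
    refine .setNat ?_
    simp [N3, N2, k10, P3]
    refine ⟨⟨by omega, ⟨by simp [N3, N2, k0], by simp [N3, N2, k3], by simp [N3, N2, k4]⟩,
      ?_, ?_⟩, ?_⟩
    · intro a ha
      rw [R3 a (by omega), R2 a (by omega), R1 a (by omega) (by omega), i3 a ha]
    · intro i hi
      rcases lt_or_eq_of_le hi with hi | rfl
      · obtain ⟨q1, D, q2, q3⟩ := i4 i hi
        refine ⟨q1.imp_right fun h => ?_, D, q2, q3.imp_right fun h => ?_⟩ <;> linarith
      · refine ⟨A2.imp_right fun h => S3.trans h, _, D1', A3⟩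
    · have := sub_mul_step hb (150 * σ.nat 0 + 300)
      omega
  · rintro τ t ⟨i1, ⟨g0, g3, g4⟩, i2, i3, i4⟩ hb ht
    simp [g3] at hb
    have e : τ.nat 10 = σ.nat 3 := by omega
    rw [e] at i4
    simp at ht
    refine .seq (.setReal (.seq (.setReal (.setReal ?_))))
    simp [g0, g4]
    refine ⟨by omega, ⟨by simp [g0], by simp [g3], by simp [g4]⟩, ?_⟩
    have e1 : (σ.nat 4 + 5 = σ.nat 4 + 16 + σ.nat 0) = False := by simp; omega
    have e2 : (16 = 16 + σ.nat 0) = False := by simp; omega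
    have e3 : (σ.nat 4 + 16 + σ.nat 0 = σ.nat 4 + 5) = False := by simp; omega
    have e4 : σ.nat 0 ≠ 0 := by omega
    simp [e1, e4]
    refine ⟨i2, ?_, ?_, ?_⟩
    · rw [i3 _ (by omega)]
    · intro k h1 h2
      rw [if_neg (by omega), if_neg (by omega), if_neg (by omega), i3 _ (by omega)]
    · intro i hi
      obtain ⟨q1, D, q2, q3⟩ := i4 i hi
      refine ⟨q1.imp_right fun h => ?_, D, q2, q3.imp_right fun h => ?_⟩ <;> linarith

/-- Queries the position of every object. -/
def outputCmd : Cmd :=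
  .setNat (.lit 10) (.lit 0) ;;
  .loop (.natLe (.add (rg 10) (.lit 1)) (rg 3))
    (.query (.add (.lit 40) (rg 10)) (rg 10) (.add (rg 4) (.lit 16)) ;;
      .setNat (.lit 10) (.add (rg 10) (.lit 1))) ;;
  .setNat (.lit 1) (.lit 40) ;; .setNat (.lit 0) (.add (rg 4) (.lit 16))

theorem outputCmd_spec (σ : State) (h3 : σ.nat 3 = n) :
    W X ps outputCmd σ fun τ t => t ≤ n * (d + 50) + 50 ∧ τ.real = σ.real ∧
      τ.nat 0 = σ.nat 4 + 16 ∧ τ.nat 1 = 40 ∧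
      ∀ i : Fin n, τ.nat (40 + i) = position (X i) (fun j => σ.real (σ.nat 4 + 16 + j))
        (σ.real (σ.nat 4 + 16 + d)) := by
  unfold outputCmd
  refine .seq (.setNat (.seq ?_))
  refine .loop (fun τ => τ.nat 10 ≤ n ∧ τ.nat 3 = n ∧ τ.nat 4 = σ.nat 4 ∧ τ.real = σ.real ∧
      ∀ i : Fin n, (i : ℕ) < τ.nat 10 →
        τ.nat (40 + i) = position (X i) (fun j => σ.real (σ.nat 4 + 16 + j))
          (σ.real (σ.nat 4 + 16 + d)))
    (fun τ => (n - τ.nat 10) * (d + 50)) ?_ ?_ ?_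
  · simp [h3]
  · rintro τ ⟨i1, g3, g4, i3, i4⟩ hb
    simp [g3] at hb
    have ne (i : ℕ) : (40 + i = 10) = False := by simp; omega
    have ne' (i : ℕ) : (10 = 40 + i) = False := by simp; omega
    refine .seq (.query (by simpa using hb) (.setNat ?_))
    have n3 : (3 = 40 + τ.nat 10) = False := by simp; omega
    have n4 : (4 = 40 + τ.nat 10) = False := by simp; omega
    simp [g3, g4, i3, ne, ne', n3, n4]
    refine ⟨⟨hb, ?_⟩, ?_⟩
    · intro i hi
      by_cases h : (i : ℕ) = τ.nat 10
      · simp [← h]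
      · rw [if_neg h]
        exact i4 i (by omega)
    · have := sub_mul_step hb (d + 50)
      omega
  · rintro τ t ⟨i1, g3, g4, i3, i4⟩ hb ht
    simp [g3] at hb ht
    have e : τ.nat 10 = n := by omega
    rw [e] at i4
    refine .seq (.setNat (.setNat ?_))
    simp [g4, i3]
    refine ⟨by omega, fun i => ?_⟩
    have n0 : (40 + (i : ℕ) = 0) = False := by simp
    have n1 : (40 + (i : ℕ) = 1) = False := by simp; omega
    simp [n1]
    exact i4 i i.2

end Phases

section Phases

variable {d n : ℕ} {X : Fin n → Set (Fin d → ℝ)} {ps : List Cmd}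

/-- Fills an array with the doubled distances of all representative points from the centre. -/
def distancesCmd : Cmd :=
  .setNat (.lit 10) (.lit 0) ;;
  .loop (.natLe (.add (rg 10) (.lit 1)) (rg 3))
    (distCmd ;;
      .setReal (.add (rg 6) (rg 10)) (.mul (.ofNat (.lit 2)) (.get (.add (rg 4) (.lit 6)))) ;;
      .setNat (.lit 10) (.add (rg 10) (.lit 1)))

theorem distancesCmd_spec (σ : State) (h4 : σ.nat 4 = σ.nat 3 * (2 * σ.nat 0 + 1))
    (h6 : σ.nat 4 + 17 + σ.nat 0 ≤ σ.nat 6) :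
    W X ps distancesCmd σ fun τ t => t ≤ σ.nat 3 * (150 * σ.nat 0 + 200) + 100 ∧
      (∀ a, a ∉ [10, 13] → τ.nat a = σ.nat a) ∧
      (∀ a, a < σ.nat 6 → a ≠ σ.nat 4 + 6 → a ≠ σ.nat 4 + 7 → τ.real a = σ.real a) ∧
      ∀ i, i < σ.nat 3 → IsDist (σ.nat 0) (coord σ i) (fun k => σ.real (σ.nat 4 + 16 + k))
        (τ.real (σ.nat 6 + i) / 2) := by
  unfold distancesCmd
  refine .seq (.setNat ?_)
  refine .loop (fun τ => τ.nat 10 ≤ σ.nat 3 ∧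
      (∀ a, a ∉ [10, 13] → τ.nat a = σ.nat a) ∧
      (∀ a, a < σ.nat 6 → a ≠ σ.nat 4 + 6 → a ≠ σ.nat 4 + 7 → τ.real a = σ.real a) ∧
      ∀ i, i < τ.nat 10 → IsDist (σ.nat 0) (coord σ i) (fun k => σ.real (σ.nat 4 + 16 + k))
        (τ.real (σ.nat 6 + i) / 2))
    (fun τ => (σ.nat 3 - τ.nat 10) * (150 * σ.nat 0 + 200)) ?_ ?_ ?_
  · simp +contextual
  · rintro τ ⟨i1, i2, i3, i4⟩ hb
    have g0 := i2 0 (by decide)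
    have g3 := i2 3 (by decide)
    have g4 := i2 4 (by decide)
    have g6 := i2 6 (by decide)
    simp [g3] at hb
    have hmul : τ.nat 10 * (2 * σ.nat 0 + 1) + (2 * σ.nat 0 + 1) ≤ σ.nat 4 := by
      rw [h4, ← Nat.succ_mul]
      exact Nat.mul_le_mul_right _ hb
    refine .seq ((distCmd_spec τ (by rw [g0, g4]; omega)).mono ?_)
    rintro τ₁ t₁ ⟨T1, N1, R1, D1⟩
    have k10 := N1 10 (by decide)
    have k6 := N1 6 (by decide)
    have k4 := N1 4 (by decide)
    rw [g0] at T1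
    rw [g4] at R1
    have D1' : IsDist (σ.nat 0) (coord σ (τ.nat 10)) (fun k => σ.real (σ.nat 4 + 16 + k))
        (τ₁.real (σ.nat 4 + 6)) := by
      intro s
      have := D1 s
      rw [g0, g4] at this
      rw [this]
      refine and_congr_right fun _ => forall_congr' fun k => forall_congr' fun hk => ?_
      dsimp only [coord]
      rw [g0, i3 _ (by omega) (by omega) (by omega), i3 _ (by omega) (by omega) (by omega)]
    refine .seq (.setReal (.setNat ?_))
    simp [k10, k6, k4, g4, g6]
    refine ⟨⟨hb, ?_, ?_, ?_⟩, ?_⟩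
    · intro a h1 h2
      simp [h1, N1 a h2, i2 a (by simp [h1, h2])]
    · intro a h1 h2 h3
      rw [if_neg (by omega), R1 a h2 h3, i3 a h1 h2 h3]
    · intro i hi
      rcases lt_or_eq_of_le hi with hi | rfl
      · rw [if_neg (by omega), R1 _ (by omega) (by omega)]
        exact i4 i hi
      · simpa using D1'
    · have := sub_mul_step hb (150 * σ.nat 0 + 200)
      omega
  · rintro τ t ⟨i1, i2, i3, i4⟩ hb ht
    simp [i2 3 (by decide)] at hb
    have e : τ.nat 10 = σ.nat 3 := by omega
    rw [e] at i4
    simp at ht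
    exact ⟨by simp; omega, i2, i3, i4⟩

/-- Halves the range of side lengths once and keeps the half with fewer doubled distances. -/
def halveCmd : Cmd :=
  .setReal (rg 4) (.div (.add (.get (.add (rg 4) (.lit 4))) (.get (.add (rg 4) (.lit 5))))
    (.ofNat (.lit 2))) ;;
  partitionCmd ;;
  .ite (.natLe (rg 11) (rg 12))
    (.setNat (.lit 7) (rg 6) ;; .setNat (.lit 6) (.add (rg 6) (.mul (.lit 2) (rg 8))) ;;
      .setNat (.lit 8) (rg 11) ;; .setReal (.add (rg 4) (.lit 5)) (.get (rg 4)))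
    (.setNat (.lit 7) (.add (rg 6) (rg 8)) ;;
      .setNat (.lit 6) (.add (rg 6) (.mul (.lit 2) (rg 8))) ;;
      .setNat (.lit 8) (rg 12) ;; .setReal (.add (rg 4) (.lit 4)) (.get (rg 4))) ;;
  .setNat (.lit 18) (.mul (rg 18) (rg 17))

/-- The number of entries in an open interval. -/
noncomputable def cntIoo (u v : ℝ) (L : List ℝ) : ℕ := L.countP fun x => decide (u < x ∧ x < v)

theorem cntIoo_filter (u v : ℝ) (L : List ℝ) (p : ℝ → Prop) [DecidablePred p]
    (h : ∀ x, u < x → x < v → p x) : cntIoo u v (L.filter fun x => decide (p x)) = cntIoo u v L := by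
  unfold cntIoo
  rw [List.countP_filter]
  congr 1
  ext x
  rw [← Bool.decide_and, decide_eq_decide]
  exact ⟨fun h => h.1, fun h' => ⟨h', h x h'.1 h'.2⟩⟩

theorem cntLt_add_cntGt_le (v : ℝ) (L : List ℝ) : cntLt v L + cntGt v L ≤ L.length := by
  have h1 := cntLe_add_cntGt v L
  have h2 : cntLt v L ≤ cntLe v L := by
    apply List.countP_mono_left
    intro x _ h
    simp at h ⊢
    exact h.le
  omega

theorem halveCmd_spec (σ : State) (h7 : σ.nat 4 + 16 ≤ σ.nat 7)
    (h6 : σ.nat 7 + σ.nat 8 ≤ σ.nat 6)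
    (hlt : σ.real (σ.nat 4 + 4) < σ.real (σ.nat 4 + 5)) :
    W X ps halveCmd σ fun τ t => t ≤ 100 * σ.nat 8 + 200 ∧
      (∀ a, a ∈ [0, 3, 4, 17] → τ.nat a = σ.nat a) ∧ σ.nat 6 ≤ τ.nat 6 ∧
      σ.nat 6 ≤ τ.nat 7 ∧ τ.nat 7 + τ.nat 8 ≤ τ.nat 6 ∧ 2 * τ.nat 8 ≤ σ.nat 8 ∧
      τ.nat 18 = σ.nat 18 * σ.nat 17 ∧
      (∀ a, a < σ.nat 6 → a ∉ [σ.nat 4, σ.nat 4 + 4, σ.nat 4 + 5] → τ.real a = σ.real a) ∧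
      σ.real (σ.nat 4 + 4) ≤ τ.real (σ.nat 4 + 4) ∧
      τ.real (σ.nat 4 + 5) ≤ σ.real (σ.nat 4 + 5) ∧
      τ.real (σ.nat 4 + 5) - τ.real (σ.nat 4 + 4) =
        (σ.real (σ.nat 4 + 5) - σ.real (σ.nat 4 + 4)) / 2 ∧
      ∀ u v, τ.real (σ.nat 4 + 4) ≤ u → v ≤ τ.real (σ.nat 4 + 5) →
        cntIoo u v (arr τ (τ.nat 7) (τ.nat 8)) = cntIoo u v (arr σ (σ.nat 7) (σ.nat 8)) := by
  unfold halveCmd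
  refine .seq (.setReal (.seq ((partitionCmd_spec _ (by simp; omega) (by simpa using h6)).mono ?_)))
  rintro τ t ⟨T, N, R, L, G⟩
  simp [arr_setReal _ _ _ (σ.nat 7) (σ.nat 8) (Or.inl (by omega : σ.nat 4 < σ.nat 7))]
    at T N R L G
  generalize hmid : (σ.real (σ.nat 4 + 4) + σ.real (σ.nat 4 + 5)) / 2 = mid at *
  have k4 := N 4 (by decide) (by decide) (by decide)
  have k6 := N 6 (by decide) (by decide) (by decide)
  have k8 := N 8 (by decide) (by decide) (by decide)
  have e1 : τ.nat 11 = cntLt mid (arr σ (σ.nat 7) (σ.nat 8)) := by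
    rw [← arr_length τ (σ.nat 6) (τ.nat 11), L, cntLt, List.countP_eq_length_filter]
  have e2 : τ.nat 12 = cntGt mid (arr σ (σ.nat 7) (σ.nat 8)) := by
    rw [← arr_length τ (σ.nat 6 + σ.nat 8) (τ.nat 12), G, cntGt, List.countP_eq_length_filter]
  have e3 := cntLt_add_cntGt_le mid (arr σ (σ.nat 7) (σ.nat 8))
  rw [arr_length] at e3
  have Rm : τ.real (σ.nat 4) = mid := by rw [R _ (by omega)]; simp
  have R' : ∀ a, a < σ.nat 6 → a ≠ σ.nat 4 → τ.real a = σ.real a := by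
    intro a h1 h2
    rw [R a h1, if_neg h2]
  have R4 := R' (σ.nat 4 + 4) (by omega) (by omega)
  have R5 := R' (σ.nat 4 + 5) (by omega) (by omega)
  have k17 := N 17 (by decide) (by decide) (by decide)
  have k18 := N 18 (by decide) (by decide) (by decide)
  refine .seq (.ite (fun hb => .seq (.setNat (.seq (.setNat (.seq (.setNat (.setReal (.setNat ?_))))))))
    (fun hb => .seq (.setNat (.seq (.setNat (.seq (.setNat (.setReal (.setNat ?_)))))))))
  · simp at hb
    simp [k4, k6, k8, k17, k18, Rm, R4, arr_setNat]
    refine ⟨by omega, ⟨N 0 (by simp) (by simp) (by simp), N 3 (by simp) (by simp) (by simp)⟩,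
      by omega, by omega, ?_, by linarith, by linarith, ?_⟩
    · intro a h1 h2 h3 h4
      simp [h4, R' a h1 h2]
    · intro u v hu hv
      rw [arr_setReal _ _ _ _ _ (by omega)]
      simp only [arr_setNat]
      rw [L]
      exact cntIoo_filter _ _ _ _ fun x _ hx => hx.trans_le hv
  · simp at hb
    simp [k4, k6, k8, k17, k18, Rm, R5, arr_setNat]
    refine ⟨by omega, ⟨N 0 (by simp) (by simp) (by simp), N 3 (by simp) (by simp) (by simp)⟩,
      by omega, by omega, ?_, by linarith, by linarith, ?_⟩
    · intro a h1 h2 h3 h4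
      simp [h3, R' a h1 h2]
    · intro u v hu hv
      rw [arr_setReal _ _ _ _ _ (by omega)]
      simp only [arr_setNat]
      rw [G]
      exact cntIoo_filter _ _ _ _ fun x hx _ => hu.trans_lt hx

/-- Computes a hypercube around the centre whose boundary is close to few points. -/
def sweepCmd : Cmd :=
  distancesCmd ;;
  .setNat (.lit 7) (rg 6) ;; .setNat (.lit 8) (rg 3) ;; .setNat (.lit 6) (.add (rg 6) (rg 3)) ;;
  .setReal (.add (rg 4) (.lit 4)) (.div (.get (.add (rg 4) (.lit 1))) (.ofNat (.lit 2))) ;;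
  .setReal (.add (rg 4) (.lit 5)) (.get (.add (rg 4) (.lit 1))) ;;
  .setNat (.lit 17) (.lit 1) ;; .setNat (.lit 13) (.lit 0) ;;
  .loop (.natLe (.add (rg 13) (.lit 1)) (rg 0))
    (.setNat (.lit 17) (.mul (.lit 2) (rg 17)) ;; .setNat (.lit 13) (.add (rg 13) (.lit 1))) ;;
  .setNat (.lit 18) (.lit 1) ;;
  .loop (.natLe (.add (rg 18) (.lit 1)) (rg 3)) halveCmd ;;
  .setReal (.add (.add (rg 4) (.lit 16)) (rg 0))
    (.div (.add (.get (.add (rg 4) (.lit 4))) (.get (.add (rg 4) (.lit 5)))) (.ofNat (.lit 2)))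

theorem sweepCmd_spec (σ : State) (h4 : σ.nat 4 = σ.nat 3 * (2 * σ.nat 0 + 1))
    (h6 : σ.nat 4 + 17 + σ.nat 0 ≤ σ.nat 6) (hd : 1 ≤ σ.nat 0)
    (hw : 0 < σ.real (σ.nat 4 + 1)) :
    W X ps sweepCmd σ fun τ t =>
      t ≤ σ.nat 3 * (150 * σ.nat 0 + 200) + 1000 * σ.nat 3 + 50 * σ.nat 0 + 1000 ∧ Kept σ τ ∧
      (∀ k, k < σ.nat 0 → τ.real (σ.nat 4 + 16 + k) = σ.real (σ.nat 4 + 16 + k)) ∧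
      ∃ (g : ℕ → ℝ) (lo hi : ℝ) (k : ℕ),
        (∀ i, i < σ.nat 3 → IsDist (σ.nat 0) (coord σ i)
          (fun k => σ.real (σ.nat 4 + 16 + k)) (g i / 2)) ∧
        τ.real (σ.nat 4 + 16 + σ.nat 0) = (lo + hi) / 2 ∧
        hi - lo = σ.real (σ.nat 4 + 1) / 2 / 2 ^ k ∧
        σ.real (σ.nat 4 + 1) / 2 ≤ lo ∧ hi ≤ σ.real (σ.nat 4 + 1) ∧
        σ.nat 3 ≤ 2 ^ (σ.nat 0 * k) ∧
        (k = 0 ∨ 2 ^ (σ.nat 0 * (k - 1)) < σ.nat 3) ∧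
        ((Finset.range (σ.nat 3)).filter fun i => lo < g i ∧ g i < hi).card * 2 ^ k ≤ σ.nat 3 := by
  unfold sweepCmd
  refine .seq ((distancesCmd_spec σ h4 h6).mono ?_)
  rintro σ₁ t₁ ⟨T1, N1, R1, D1⟩
  have a0 := N1 0 (by decide)
  have a3 := N1 3 (by decide)
  have a4 := N1 4 (by decide)
  have a6 := N1 6 (by decide)
  refine .seq (.setNat (.seq (.setNat (.seq (.setNat (.seq (.setReal (.seq (.setReal (.seq (.setNat
    (.seq (.setNat (.seq ?_))))))))))))))
  have hR1 := R1 (σ.nat 4 + 1) (by omega) (by omega) (by omega)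
  set σ₂ := State.setNat _ _ _ with hσ₂
  have b0 : σ₂.nat 0 = σ.nat 0 := by simp [hσ₂, a0]
  have b3 : σ₂.nat 3 = σ.nat 3 := by simp [hσ₂, a3]
  have b4 : σ₂.nat 4 = σ.nat 4 := by simp [hσ₂, a4]
  have b6 : σ₂.nat 6 = σ.nat 6 + σ.nat 3 := by simp [hσ₂, a6, a3]
  have b7 : σ₂.nat 7 = σ.nat 6 := by simp [hσ₂, a6]
  have b8 : σ₂.nat 8 = σ.nat 3 := by simp [hσ₂, a3]
  have b13 : σ₂.nat 13 = 0 := by simp [hσ₂]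
  have b17 : σ₂.nat 17 = 1 := by simp [hσ₂]
  have c4 : σ₂.real (σ.nat 4 + 4) = σ.real (σ.nat 4 + 1) / 2 := by simp [hσ₂, a4, hR1]
  have c5 : σ₂.real (σ.nat 4 + 5) = σ.real (σ.nat 4 + 1) := by simp [hσ₂, a4, hR1]
  have cr : ∀ a, σ.nat 4 + 16 ≤ a → σ₂.real a = σ₁.real a := by
    intro a ha
    simp [hσ₂, a4]
    rw [if_neg (by omega), if_neg (by omega)]
  have hct : ∀ k, k < σ.nat 0 → σ₂.real (σ.nat 4 + 16 + k) = σ.real (σ.nat 4 + 16 + k) := by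
    intro k hk
    rw [cr _ (by omega), R1 _ (by omega) (by omega) (by omega)]
  clear_value σ₂
  clear hσ₂
  refine .loop (fun τ => τ.nat 13 ≤ σ.nat 0 ∧ (∀ a, a ∉ [13, 17] → τ.nat a = σ₂.nat a) ∧
    τ.real = σ₂.real ∧ τ.nat 17 = 2 ^ τ.nat 13) (fun τ => 50 * (σ.nat 0 - τ.nat 13)) ?_ ?_ ?_
  · simp [b13, b17]
  · rintro τ ⟨i1, i2, i3, i4⟩ hb
    simp [i2 0 (by decide), b0] at hb
    refine .seq (.setNat (.setNat ?_))
    simp [i3, i4, pow_succ']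
    refine ⟨⟨hb, ?_⟩, by omega⟩
    intro a h1 h2
    simp [h1, h2, i2 a (by simp [h1, h2])]
  rintro σ₃ t₃ ⟨i1, N3, R3, P3⟩ hb T3
  simp [N3 0 (by decide), b0] at hb
  have e13 : σ₃.nat 13 = σ.nat 0 := by omega
  rw [e13] at P3
  simp [b13] at T3
  have d0 : σ₃.nat 0 = σ.nat 0 := by rw [N3 0 (by decide), b0]
  have d3 : σ₃.nat 3 = σ.nat 3 := by rw [N3 3 (by decide), b3]
  have d4 : σ₃.nat 4 = σ.nat 4 := by rw [N3 4 (by decide), b4]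
  have d6 : σ₃.nat 6 = σ.nat 6 + σ.nat 3 := by rw [N3 6 (by decide), b6]
  have d7 : σ₃.nat 7 = σ.nat 6 := by rw [N3 7 (by decide), b7]
  have d8 : σ₃.nat 8 = σ.nat 3 := by rw [N3 8 (by decide), b8]
  rw [← R3] at c4 c5 cr hct
  refine .seq (.setNat (.seq ?_))
  have h2d : 2 ≤ 2 ^ σ.nat 0 := by
    calc 2 = 2 ^ 1 := rfl
      _ ≤ 2 ^ σ.nat 0 := Nat.pow_le_pow_right (by norm_num) hd
  refine .loop (fun τ => Kept σ τ ∧ τ.nat 17 = 2 ^ σ.nat 0 ∧ 1 ≤ τ.nat 18 ∧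
      σ.nat 6 ≤ τ.nat 7 ∧ τ.nat 7 + τ.nat 8 ≤ τ.nat 6 ∧
      (∀ k, k < σ.nat 0 → τ.real (σ.nat 4 + 16 + k) = σ.real (σ.nat 4 + 16 + k)) ∧
      σ.real (σ.nat 4 + 1) / 2 ≤ τ.real (σ.nat 4 + 4) ∧
      τ.real (σ.nat 4 + 5) ≤ σ.real (σ.nat 4 + 1) ∧
      (∀ u v, τ.real (σ.nat 4 + 4) ≤ u → v ≤ τ.real (σ.nat 4 + 5) →
        cntIoo u v (arr τ (τ.nat 7) (τ.nat 8)) = cntIoo u v (arr σ₃ (σ.nat 6) (σ.nat 3))) ∧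
      ∃ k, τ.nat 18 = 2 ^ (σ.nat 0 * k) ∧ (k = 0 ∨ 2 ^ (σ.nat 0 * (k - 1)) < σ.nat 3) ∧
        τ.nat 8 * 2 ^ k ≤ σ.nat 3 ∧
        τ.real (σ.nat 4 + 5) - τ.real (σ.nat 4 + 4) = σ.real (σ.nat 4 + 1) / 2 / 2 ^ k)
    (fun τ => 300 * τ.nat 8 + 300 * (σ.nat 3 - τ.nat 18)) ?_ ?_ ?_
  · refine ⟨⟨by simp [d0], by simp [d3], by simp [d4]⟩, by simp [P3], by simp, by simp [d7],
      by simp [d6, d7, d8], by simpa using hct, by simp [c4], by simp [c5], ?_, 0, by simp,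
      by simp, by simp [d8], ?_⟩
    · simp [d7, d8, arr_setNat]
    · simp [c4, c5]
      ring
  · rintro τ ⟨⟨k0, k3, k4⟩, k17, k18, k7, k6, hc, hlo, hhi, hcnt, k, q1, q2, q3, q4⟩ hb
    simp [k3] at hb
    have hlt : τ.real (τ.nat 4 + 4) < τ.real (τ.nat 4 + 5) := by
      rw [k4]
      have : 0 < σ.real (σ.nat 4 + 1) / 2 / 2 ^ k := by positivity
      linarith
    refine (halveCmd_spec τ (by omega) k6 hlt).mono ?_
    rintro τ' t ⟨T, N, f6, f7, g6, g8, g18, R, hlo', hhi', hlen, hcnt'⟩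
    rw [k4] at R hlo' hhi' hlen hcnt'
    have m18 : τ.nat 18 < τ'.nat 18 := by
      rw [g18, k17]
      calc τ.nat 18 < τ.nat 18 * 2 := by omega
        _ ≤ _ := Nat.mul_le_mul_left _ h2d
    refine ⟨⟨⟨by rw [N 0 (by decide), k0], by rw [N 3 (by decide), k3],
      by rw [N 4 (by decide), k4]⟩, by rw [N 17 (by decide), k17], by omega, by omega, g6, ?_,
      by linarith, by linarith, ?_, k + 1, ?_, ?_, ?_, ?_⟩, ?_⟩
    · intro j hj
      rw [R _ (by omega) (by simp; omega), hc j hj]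
    · intro u v hu hv
      rw [hcnt' u v hu hv, hcnt u v (by linarith) (by linarith)]
    · rw [g18, q1, k17, ← pow_add]
      ring_nf
    · right
      rw [Nat.add_sub_cancel, ← q1]
      exact hb
    · calc τ'.nat 8 * 2 ^ (k + 1) = (2 * τ'.nat 8) * 2 ^ k := by ring
        _ ≤ τ.nat 8 * 2 ^ k := Nat.mul_le_mul_right _ g8
        _ ≤ _ := q3
    · rw [hlen, q4, pow_succ]
      field_simp
    · simp; omega
  · rintro τ t ⟨⟨k0, k3, k4⟩, k17, k18, k7, k6, hc, hlo, hhi, hcnt, k, q1, q2, q3, q4⟩ hb T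
    simp [k3] at hb
    simp [d8] at T
    refine .setReal ?_
    simp [k4, k0]
    refine ⟨by omega, ⟨by simp [k0], by simp [k3], by simp [k4]⟩, ?_, fun i => σ₁.real (σ.nat 6 + i),
      D1, τ.real (σ.nat 4 + 4), τ.real (σ.nat 4 + 5), rfl, k, q4, hlo, hhi, by omega, q2, ?_⟩
    · intro j hj
      rw [if_neg (by omega), hc j hj]
    · refine le_trans (Nat.mul_le_mul_right _ ?_) q3
      have h1 := hcnt _ _ le_rfl le_rfl
      have h2 : cntIoo (τ.real (σ.nat 4 + 4)) (τ.real (σ.nat 4 + 5)) (arr τ (τ.nat 7) (τ.nat 8)) ≤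
          τ.nat 8 := by
        conv_rhs => rw [← arr_length τ (τ.nat 7) (τ.nat 8)]
        exact List.countP_le_length
      rw [h1] at h2
      refine le_trans (le_of_eq ?_) h2
      unfold cntIoo arr
      rw [List.countP_map, ← countP_range]
      congr 1
      ext i
      simp [cr (σ.nat 6 + i) (by omega)]

end Phases

section Geometry

variable {d : ℕ}

theorem cube_eq_closedBall (c : Fin d → ℝ) {r : ℝ} (hr : 0 ≤ r) :
    cube c r = Metric.closedBall c (r / 2) := by
  ext x
  rw [Metric.mem_closedBall, dist_pi_le_iff (by linarith)]
  simp [cube, Real.dist_eq]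

theorem mem_frontier_cube (hd : 1 ≤ d) {c x : Fin d → ℝ} {r : ℝ} (hr : 0 < r)
    (h : x ∈ frontier (cube c r)) : dist x c = r / 2 := by
  have : Nonempty (Fin d) := ⟨⟨0, hd⟩⟩
  rw [cube_eq_closedBall c hr.le, frontier_closedBall c (by positivity)] at h
  exact h

theorem mem_interior_cube (hd : 1 ≤ d) {c x : Fin d → ℝ} {r : ℝ} (hr : 0 < r) :
    x ∈ interior (cube c r) ↔ dist x c < r / 2 := by
  have : Nonempty (Fin d) := ⟨⟨0, hd⟩⟩
  rw [cube_eq_closedBall c hr.le, interior_closedBall c (by positivity), Metric.mem_ball]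

theorem IsMinEnclosing.side_nonneg (hd : 1 ≤ d) {A : Set (Fin d → ℝ)} {c : Fin d → ℝ} {r : ℝ}
    (h : IsMinEnclosing A c r) (hA : A.Nonempty) : 0 ≤ r := by
  obtain ⟨x, hx⟩ := hA
  have := (abs_nonneg _).trans (h.1 hx ⟨0, hd⟩)
  linarith

theorem IsMinEnclosing.objSize_eq (hd : 1 ≤ d) {A : Set (Fin d → ℝ)} {c : Fin d → ℝ} {r : ℝ}
    (h : IsMinEnclosing A c r) (hA : A.Nonempty) : objSize A = r :=
  IsLeast.csInf_eq ⟨⟨h.side_nonneg hd hA, c, h.1⟩, fun _ hr' => h.2 _ _ hr'.2.choose_spec⟩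

theorem IsMinEnclosing.dist_le (hd : 1 ≤ d) {A : Set (Fin d → ℝ)} {c x y : Fin d → ℝ} {r : ℝ}
    (h : IsMinEnclosing A c r) (hx : x ∈ A) (hy : y ∈ A) : dist x y ≤ r := by
  have hr := h.side_nonneg hd ⟨x, hx⟩
  rw [dist_pi_le_iff hr]
  intro j
  have h1 := abs_le.1 (h.1 hx j)
  have h2 := abs_le.1 (h.1 hy j)
  rw [Real.dist_eq, abs_le]
  constructor <;> linarith

theorem IsDist.eq_dist {x c : ℕ → ℝ} {D : ℝ} (h : IsDist d x c D) {p q : Fin d → ℝ}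
    (hp : ∀ j : Fin d, x j = p j) (hq : ∀ j : Fin d, c j = q j) : D = dist p q := by
  apply le_antisymm
  · rw [h]
    refine ⟨dist_nonneg, fun k hk => ?_⟩
    rw [hp ⟨k, hk⟩, hq ⟨k, hk⟩, ← Real.dist_eq]
    exact dist_le_pi_dist p q _
  · obtain ⟨h1, h2⟩ := (h D).1 le_rfl
    rw [dist_pi_le_iff h1]
    intro j
    rw [Real.dist_eq, ← hp, ← hq]
    exact h2 j j.2

theorem position_le_two (A : Set (Fin d → ℝ)) (c : Fin d → ℝ) (r : ℝ) : position A c r ≤ 2 := by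
  unfold position
  split_ifs <;> norm_num

theorem liesInside_iff (A : Set (Fin d → ℝ)) (c : Fin d → ℝ) (r : ℝ) :
    LiesInside A c r ↔ position A c r = 0 := by
  unfold position
  split_ifs <;> simp [*]

theorem liesOutside_iff {A : Set (Fin d → ℝ)} (hA : A.Nonempty) (c : Fin d → ℝ) (r : ℝ) :
    LiesOutside A c r ↔ position A c r = 1 := by
  unfold position
  split_ifs with h1 h2
  · simp only [iff_false]
    intro h
    obtain ⟨x, hx⟩ := hA
    exact Set.disjoint_left.1 h hx (interior_subset (h1 hx))
  · simp [h2]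
  · simp [h2]

section Count

variable {m f : ℕ} {S : Fin m → Set (Fin d → ℝ)}

open scoped Classical in
theorem IsFat.card_le (hf : IsFat f S) (hS : ∀ i j, i ≠ j → Disjoint (S i) (S j))
    (c : Fin d → ℝ) {r : ℝ} (hr : 0 < r) :
    (Finset.univ.filter fun i => (S i ∩ cube c r).Nonempty ∧ r ≤ objSize (S i)).card ≤ f := by
  obtain ⟨P, hP, h⟩ := hf c r hr
  choose! p hp using h
  refine le_trans (Finset.card_le_card_of_injOn p ?_ ?_) hP
  · intro i hi
    simp only [Finset.coe_filter, Finset.mem_univ, true_and, Set.mem_ofPred_eq] at hi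
    exact (hp i hi.1 hi.2).1
  · intro i hi j hj hij
    simp only [Finset.coe_filter, Finset.mem_univ, true_and, Set.mem_ofPred_eq] at hi hj
    by_contra hne
    have h1 := (hp i hi.1 hi.2).2
    have h2 := (hp j hj.1 hj.2).2
    rw [hij] at h1
    exact Set.disjoint_left.1 (hS i j hne) h1 h2

theorem exists_grid_point {M : ℕ} {δ t u : ℝ} (hδ : 0 < δ) (ht : 0 < t) (hM : t ≤ M * δ)
    (hu : |u| ≤ t / 2) : ∃ a : Fin M, |u - (-(t / 2) + (a + 1 / 2) * δ)| ≤ δ / 2 := by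
  obtain ⟨h1, h2⟩ := abs_le.1 hu
  have hM0 : 0 < M := by
    rcases Nat.eq_zero_or_pos M with h | h
    · subst h; simp at hM; linarith
    · exact h
  set y := u + t / 2 with hy
  have hy0 : 0 ≤ y / δ := div_nonneg (by linarith) hδ.le
  have f1 := Nat.floor_le hy0
  have f2 := Nat.lt_floor_add_one (y / δ)
  rw [le_div_iff₀ hδ] at f1
  rw [div_lt_iff₀ hδ] at f2
  by_cases h : ⌊y / δ⌋₊ < M
  · refine ⟨⟨_, h⟩, ?_⟩
    rw [abs_le]
    constructor <;> simp only <;> nlinarith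
  · refine ⟨⟨M - 1, by omega⟩, ?_⟩
    have e : ((M - 1 : ℕ) : ℝ) = M - 1 := by push_cast [Nat.cast_sub hM0]; ring
    have h3 : (M : ℝ) * δ ≤ y := by
      refine le_trans ?_ f1
      exact mul_le_mul_of_nonneg_right (by exact_mod_cast not_lt.1 h) hδ.le
    simp only [e]
    rw [abs_le]
    constructor <;> nlinarith

open scoped Classical in
theorem IsFat.card_large_le {e m f : ℕ} {S : Fin m → Set (Fin (e + 1) → ℝ)} (hf : IsFat f S)
    (hS : ∀ i j, i ≠ j → Disjoint (S i) (S j)) (c : Fin (e + 1) → ℝ) {t δ : ℝ} {M : ℕ}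
    (hδ : 0 < δ) (ht : 0 < t) (hM : t ≤ M * δ) :
    (Finset.univ.filter fun i => (∃ x ∈ S i, dist x c = t / 2) ∧ δ ≤ objSize (S i)).card ≤
      (e + 1) * (2 * M ^ e) * f := by
  let ctr : Fin (e + 1) × Bool × (Fin e → Fin M) → Fin (e + 1) → ℝ := fun q =>
    q.1.insertNth (α := fun _ => ℝ) (c q.1 + if q.2.1 then t / 2 else -(t / 2))
      (fun k => c (q.1.succAbove k) + (-(t / 2) + (q.2.2 k + 1 / 2) * δ))
  have hsub : (Finset.univ.filter fun i => (∃ x ∈ S i, dist x c = t / 2) ∧ δ ≤ objSize (S i)) ⊆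
      (Finset.univ : Finset (Fin (e + 1) × Bool × (Fin e → Fin M))).biUnion fun q =>
        Finset.univ.filter fun i => (S i ∩ cube (ctr q) δ).Nonempty ∧ δ ≤ objSize (S i) := by
    intro i hi
    simp only [Finset.mem_filter, Finset.mem_univ, true_and, Finset.mem_biUnion] at hi ⊢
    obtain ⟨⟨x, hx, hxc⟩, hsz⟩ := hi
    have hle : ∀ j, |x j - c j| ≤ t / 2 := fun j => by
      rw [← hxc, ← Real.dist_eq]; exact dist_le_pi_dist x c j
    obtain ⟨j, hj⟩ : ∃ j, t / 2 ≤ |x j - c j| := by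
      by_contra hcon
      push Not at hcon
      have : dist x c < t / 2 := by
        rw [dist_pi_lt_iff (by linarith)]
        intro j
        rw [Real.dist_eq]; exact hcon j
      linarith
    choose a ha using fun k => exists_grid_point hδ ht hM (hle (j.succAbove k))
    refine ⟨(j, decide (0 ≤ x j - c j), a), ⟨x, hx, ?_⟩, hsz⟩
    show ∀ k, _
    rw [Fin.forall_iff_succAbove j]
    refine ⟨?_, fun k => ?_⟩
    · simp only [ctr, Fin.insertNth_apply_same, decide_eq_true_eq]
      have hjj := le_antisymm (hle j) hj
      split_ifs with h
      · rw [abs_of_nonneg h] at hjj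
        rw [show x j - (c j + t / 2) = 0 by linarith, abs_zero]
        linarith
      · rw [abs_of_neg (not_le.1 h)] at hjj
        rw [show x j - (c j + -(t / 2)) = 0 by linarith, abs_zero]
        linarith
    · simp only [ctr, Fin.insertNth_apply_succAbove]
      have := ha k
      rwa [sub_sub] at this
  refine (Finset.card_le_card hsub).trans ?_
  refine (Finset.card_biUnion_le_card_mul _ _ f fun q _ => hf.card_le hS _ hδ).trans ?_
  simp

end Count

end Geometry

section Bounds

theorem ncard_append_le {n₁ n₂ a b s : ℕ} {p : Fin (n₁ + n₂) → Prop} {T₁ : Finset (Fin n₁)}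
    {T₂ : Finset (Fin n₂)} {T : Finset (Fin (n₁ + n₂))} (hT : T.card ≤ s)
    (h₁ : T₁.card ≤ a) (h₂ : T₂.card ≤ b)
    (hp₁ : ∀ i, p (Fin.castAdd n₂ i) → Fin.castAdd n₂ i ∈ T ∨ i ∈ T₁)
    (hp₂ : ∀ i, p (Fin.natAdd n₁ i) → Fin.natAdd n₁ i ∈ T ∨ i ∈ T₂) :
    {i | p i}.ncard ≤ s + a + b := by
  have hsub : {i | p i} ⊆ ((T ∪ T₁.image (Fin.castAdd n₂)) ∪
      T₂.image (Fin.natAdd n₁) : Finset (Fin (n₁ + n₂))) := by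
    intro i hi
    simp only [Finset.coe_union, Finset.coe_image, Set.mem_union, Set.mem_image,
      Set.mem_ofPred_eq, Finset.mem_coe] at hi ⊢
    induction i using Fin.addCases with
    | left i =>
      rcases hp₁ i hi with h | h
      · exact Or.inl (Or.inl h)
      · exact Or.inl (Or.inr ⟨i, h, rfl⟩)
    | right i =>
      rcases hp₂ i hi with h | h
      · exact Or.inl (Or.inl h)
      · exact Or.inr ⟨i, h, rfl⟩
  refine (Set.ncard_le_ncard hsub (Finset.finite_toSet _)).trans ?_
  rw [Set.ncard_coe_finset]
  refine (Finset.card_union_le _ _).trans (add_le_add ?_ (Finset.card_image_le.trans h₂))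
  exact (Finset.card_union_le _ _).trans (add_le_add hT (Finset.card_image_le.trans h₁))

/-- A set that misses a `4 ^ d`-th part of `Fin N` contains at most the remaining part. -/
theorem ncard_le_of_missed {N d : ℕ} {B : Set (Fin N)} {M : Finset ℕ}
    (hM : M ⊆ Finset.range N) (hcard : N ≤ 4 ^ d * M.card)
    (hB : ∀ i : Fin N, (i : ℕ) ∈ M → i ∉ B) :
    (B.ncard : ℝ) ≤ ((4 : ℝ) ^ d - 1) / (4 : ℝ) ^ d * (N : ℝ) := by
  have h1 : B.ncard + M.card ≤ N := by
    have hsub : (fun i : Fin N => (i : ℕ)) '' B ⊆ ((Finset.range N \ M : Finset ℕ) : Set ℕ) := by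
      rintro _ ⟨i, hi, rfl⟩
      simp only [Finset.coe_sdiff, Finset.coe_range, Set.mem_sdiff, Set.mem_Iio, Finset.mem_coe]
      exact ⟨i.2, fun h => hB i h hi⟩
    have h2 := Set.ncard_le_ncard hsub (Finset.finite_toSet _)
    rw [Set.ncard_image_of_injective _ Fin.val_injective, Set.ncard_coe_finset,
      Finset.card_sdiff_of_subset hM, Finset.card_range] at h2
    have := Finset.card_le_card hM
    rw [Finset.card_range] at this
    omega
  have h4 : (0 : ℝ) < 4 ^ d := by positivity
  have h2 : (B.ncard : ℝ) + M.card ≤ N := by exact_mod_cast h1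
  have h3 : (N : ℝ) ≤ 4 ^ d * M.card := by exact_mod_cast hcard
  rw [div_mul_eq_mul_div, le_div_iff₀ h4]
  nlinarith

theorem sweep_bound {n e k s a : ℕ} (hn : 1 ≤ n) (hk : n ≤ 2 ^ ((e + 1) * k))
    (hk' : k = 0 ∨ 2 ^ ((e + 1) * (k - 1)) < n) (hs : s * 2 ^ k ≤ n) :
    ((s + a * (8 * 2 ^ k) ^ e : ℕ) : ℝ) ≤
      (1 + a * 16 ^ e) * (n : ℝ) ^ (1 - 1 / ((e + 1 : ℕ) : ℝ)) := by
  have hn0 : (0 : ℝ) < n := by exact_mod_cast hn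
  set y : ℝ := (n : ℝ) ^ (1 / ((e + 1 : ℕ) : ℝ)) with hy
  have hy0 : 0 < y := Real.rpow_pos_of_pos hn0 _
  have hyd : y ^ (e + 1) = n := by
    rw [hy, ← Real.rpow_natCast, ← Real.rpow_mul hn0.le]
    rw [one_div, inv_mul_cancel₀ (by positivity), Real.rpow_one]
  have hpow : (n : ℝ) ^ (1 - 1 / ((e + 1 : ℕ) : ℝ)) = y ^ e := by
    rw [Real.rpow_sub hn0, Real.rpow_one, ← hy, div_eq_iff hy0.ne', ← pow_succ, hyd]
  rw [hpow]
  have hy1 : 1 ≤ y := Real.one_le_rpow (by exact_mod_cast hn) (by positivity)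
  have hyk : y ≤ 2 ^ k := by
    refine le_of_pow_le_pow_left₀ (n := e + 1) (by omega) (by positivity) ?_
    rw [hyd, ← pow_mul, mul_comm k]
    exact_mod_cast hk
  have hky : (2 : ℝ) ^ k ≤ 2 * y := by
    rcases hk' with rfl | h
    · simp; linarith
    · rcases Nat.eq_zero_or_pos k with rfl | hk0
      · simp; linarith
      · obtain ⟨j, rfl⟩ := Nat.exists_eq_succ_of_ne_zero hk0.ne'
        have : (2 : ℝ) ^ j ≤ y := by
          refine le_of_pow_le_pow_left₀ (n := e + 1) (by omega) hy0.le ?_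
          rw [hyd, ← pow_mul, mul_comm j]
          exact_mod_cast h.le
        rw [pow_succ]
        linarith
  have hs' : (s : ℝ) ≤ y ^ e := by
    have h1 : (s : ℝ) * 2 ^ k ≤ n := by exact_mod_cast hs
    have h2 : (s : ℝ) * y ≤ y ^ e * y := by
      rw [← pow_succ, hyd]
      exact (mul_le_mul_of_nonneg_left hyk (Nat.cast_nonneg _)).trans h1
    exact le_of_mul_le_mul_right h2 hy0
  have hM : ((8 * 2 ^ k : ℝ)) ^ e ≤ 16 ^ e * y ^ e := by
    rw [← mul_pow]
    exact pow_le_pow_left₀ (by positivity) (by linarith) _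
  push_cast
  have : (a : ℝ) * (8 * 2 ^ k) ^ e ≤ a * (16 ^ e * y ^ e) :=
    mul_le_mul_of_nonneg_left hM (Nat.cast_nonneg _)
  linarith

end Bounds

section Separators

theorem tiny_cube_facts {d : ℕ} (hd : 1 ≤ d) {c c' : Fin d → ℝ} {r : ℝ} (hr : 0 < r)
    (h0 : c' ⟨0, hd⟩ = c ⟨0, hd⟩ - r / 2) (hc : ∀ j : Fin d, 1 ≤ (j : ℕ) → c' j = c j) :
    c ∈ cube c' r ∧ c ∉ interior (cube c' r) ∧ ∀ x ∈ cube c' r, dist x c ≤ r := by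
  have hj : ∀ j : Fin d, j = ⟨0, hd⟩ ∨ c' j = c j := by
    intro j
    rcases Nat.eq_zero_or_pos (j : ℕ) with h | h
    · exact Or.inl (Fin.ext h)
    · exact Or.inr (hc j h)
  refine ⟨fun j => ?_, ?_, fun x hx => ?_⟩
  · rcases hj j with rfl | h
    · rw [h0, abs_le]; constructor <;> linarith
    · rw [h, sub_self, abs_zero]; linarith
  · rw [mem_interior_cube hd hr, not_lt]
    refine le_trans ?_ (dist_le_pi_dist c c' ⟨0, hd⟩)
    rw [h0, Real.dist_eq, sub_sub_cancel]
    exact le_abs_self _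
  · rw [dist_pi_le_iff hr.le]
    intro j
    have := abs_le.1 (hx j)
    rw [Real.dist_eq, abs_le]
    rcases hj j with rfl | h
    · rw [h0] at this; constructor <;> linarith
    · rw [h] at this; constructor <;> linarith

theorem Crosses.inter_cube {d : ℕ} {A : Set (Fin d → ℝ)} {c : Fin d → ℝ} {r : ℝ} (hr : 0 < r)
    (h : Crosses A c r) : (A ∩ cube c r).Nonempty := by
  obtain ⟨x, hx, hxf⟩ := h
  refine ⟨x, hx, ?_⟩
  have hcl : IsClosed (cube c r) := by
    rw [cube_eq_closedBall c hr.le]; exact Metric.isClosed_closedBall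
  exact hcl.frontier_subset hxf

open scoped Classical in
theorem IsFat.card_near_le {d m f : ℕ} {S : Fin m → Set (Fin d → ℝ)} (hf : IsFat f S)
    (hS : ∀ i j, i ≠ j → Disjoint (S i) (S j)) (c c' : Fin d → ℝ) {r : ℝ} (hr : 0 < r) :
    (Finset.univ.filter fun i =>
      ((S i ∩ cube c' r).Nonempty ∧ r ≤ objSize (S i)) ∨ c ∈ S i).card ≤ f + 1 := by
  rw [Finset.filter_or]
  refine (Finset.card_union_le _ _).trans (add_le_add (hf.card_le hS c' hr) ?_)
  rw [Finset.card_le_one]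
  intro i hi j hj
  simp only [Finset.mem_filter, Finset.mem_univ, true_and] at hi hj
  by_contra h
  exact Set.disjoint_left.1 (hS i j h) hi hj

theorem tiny_crosses {d f n₁ n₂ : ℕ} (hd : 1 ≤ d) {S₁ : Fin n₁ → Set (Fin d → ℝ)}
    {S₂ : Fin n₂ → Set (Fin d → ℝ)}
    {rep center : Fin (n₁ + n₂) → Fin d → ℝ} {side : Fin (n₁ + n₂) → ℝ}
    (hS₁ : ∀ i j, i ≠ j → Disjoint (S₁ i) (S₁ j)) (hS₂ : ∀ i j, i ≠ j → Disjoint (S₂ i) (S₂ j))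
    (hf₁ : IsFat f S₁) (hf₂ : IsFat f S₂) (hrep : ∀ i, rep i ∈ Fin.append S₁ S₂ i)
    (hmin : ∀ i, IsMinEnclosing (Fin.append S₁ S₂ i) (center i) (side i))
    {c c' : Fin d → ℝ} {r : ℝ} (hr : 0 < r)
    (h0 : c' ⟨0, hd⟩ = c ⟨0, hd⟩ - r / 2) (hc : ∀ j : Fin d, 1 ≤ (j : ℕ) → c' j = c j)
    (hside : ∀ i, side i ≤ 0 ∨ r ≤ side i)
    (hdist : ∀ i, dist (rep i) c ≤ 0 ∨ r < dist (rep i) c) :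
    {i | Crosses (Fin.append S₁ S₂ i) c' r}.ncard ≤ 0 + (f + 1) + (f + 1) := by
  classical
  have key : ∀ i, Crosses (Fin.append S₁ S₂ i) c' r →
      (((Fin.append S₁ S₂ i) ∩ cube c' r).Nonempty ∧ r ≤ objSize (Fin.append S₁ S₂ i)) ∨
        c ∈ Fin.append S₁ S₂ i := by
    intro i hi
    have hne := hi.inter_cube hr
    rcases hside i with h | h
    · right
      obtain ⟨x, hx, hxc⟩ := hne
      have hx' : dist (rep i) x ≤ 0 := ((hmin i).dist_le hd (hrep i) hx).trans h
      have hxr : rep i = x := dist_le_zero.1 hx'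
      have h3 := (tiny_cube_facts hd hr h0 hc).2.2 x hxc
      rcases hdist i with h4 | h4
      · rw [← dist_le_zero.1 h4]; exact hrep i
      · rw [hxr] at h4; linarith
    · left
      exact ⟨hne, by rw [(hmin i).objSize_eq hd ⟨_, hrep i⟩]; exact h⟩
  refine ncard_append_le (T := ∅) (by simp) (hf₁.card_near_le hS₁ c c' hr)
    (hf₂.card_near_le hS₂ c c' hr) (fun i hi => Or.inr ?_) (fun i hi => Or.inr ?_)
  · simpa using key _ hi
  · simpa using key _ hi

theorem sweep_crosses {e f n₁ n₂ : ℕ} {S₁ : Fin n₁ → Set (Fin (e + 1) → ℝ)}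
    {S₂ : Fin n₂ → Set (Fin (e + 1) → ℝ)}
    {rep center : Fin (n₁ + n₂) → Fin (e + 1) → ℝ} {side : Fin (n₁ + n₂) → ℝ}
    (hS₁ : ∀ i j, i ≠ j → Disjoint (S₁ i) (S₁ j)) (hS₂ : ∀ i j, i ≠ j → Disjoint (S₂ i) (S₂ j))
    (hf₁ : IsFat f S₁) (hf₂ : IsFat f S₂) (hrep : ∀ i, rep i ∈ Fin.append S₁ S₂ i)
    (hmin : ∀ i, IsMinEnclosing (Fin.append S₁ S₂ i) (center i) (side i))
    {c : Fin (e + 1) → ℝ} {w lo hi : ℝ} {k : ℕ} {g : ℕ → ℝ} (hw : 0 < w)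
    (hg : ∀ i : Fin (n₁ + n₂), g i / 2 = dist (rep i) c)
    (hlen : hi - lo = w / 2 / 2 ^ k) (hlo : w / 2 ≤ lo) (hhi : hi ≤ w) :
    {i | Crosses (Fin.append S₁ S₂ i) c ((lo + hi) / 2)}.ncard ≤
      ((Finset.range (n₁ + n₂)).filter fun i => lo < g i ∧ g i < hi).card +
        (4 * (e + 1) * f) * (8 * 2 ^ k) ^ e := by
  classical
  have hl : 0 < w / 2 / 2 ^ k := by positivity
  set δ := (hi - lo) / 4 with hδ
  have hδ0 : 0 < δ := by rw [hδ, hlen]; positivity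
  set t := (lo + hi) / 2 with ht
  have ht0 : 0 < t := by linarith
  have hM : t ≤ (8 * 2 ^ k : ℕ) * δ := by
    rw [hδ, hlen]
    push_cast
    have : (8 * 2 ^ k : ℝ) * (w / 2 / 2 ^ k / 4) = w := by field_simp; norm_num
    linarith
  have key : ∀ i, Crosses (Fin.append S₁ S₂ i) c t →
      (lo < g i ∧ g i < hi) ∨ ((∃ x ∈ Fin.append S₁ S₂ i, dist x c = t / 2) ∧
        δ ≤ objSize (Fin.append S₁ S₂ i)) := by
    rintro i ⟨x, hx, hxf⟩
    have hxc := mem_frontier_cube (by omega) ht0 hxf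
    rw [(hmin i).objSize_eq (by omega) ⟨_, hrep i⟩]
    rcases lt_or_ge (side i) δ with h | h
    · left
      have h1 := (hmin i).dist_le (by omega) (hrep i) hx
      have h2 := dist_triangle (rep i) x c
      have h3 := dist_triangle_left x c (rep i)
      have h4 := hg i
      constructor <;> linarith
    · exact Or.inr ⟨⟨x, hx, hxc⟩, h⟩
  have hT : (Finset.univ.filter fun i : Fin (n₁ + n₂) => lo < g i ∧ g i < hi).card ≤
      ((Finset.range (n₁ + n₂)).filter fun i => lo < g i ∧ g i < hi).card := by
    refine Finset.card_le_card_of_injOn (fun i => (i : ℕ)) ?_ Fin.val_injective.injOn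
    intro i hi
    simpa using hi
  refine (ncard_append_le hT (hf₁.card_large_le hS₁ c hδ0 ht0 hM)
    (hf₂.card_large_le hS₂ c hδ0 ht0 hM) (fun i hi => ?_) (fun i hi => ?_)).trans
    (le_of_eq (by ring))
  · simpa using key _ hi
  · simpa using key _ hi

end Separators

/-- The main command of the algorithm. -/
def mainCmd : Cmd :=
  prepareCmd ;; .ite (.realLe (.get (.add (rg 4) (.lit 1))) (.ofNat (.lit 0))) tinyCmd sweepCmd ;;
    outputCmd

/-- The constant in the bound for the number of crossed objects. -/
def crossConst (f d : ℕ) : ℝ := 1 + (4 * d * f : ℕ) * 16 ^ (d - 1) + (2 * f + 2)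

theorem running_time_le {d n₁ n₂ t₁ t₂ t₃ : ℕ} (hd : 1 ≤ d)
    (h₁ : t₁ ≤ 50 * n₁ + 300 + d * (65000 * n₁ + 2100))
    (h₂ : t₂ ≤ (n₁ + n₂) * (150 * d + 300) + 1000 * (n₁ + n₂) + 50 * d + 2000)
    (h₃ : t₃ ≤ (n₁ + n₂) * (d + 50) + 50) :
    t₁ + (t₂ + t₃) ≤ 100000 * (d * max 1 (n₁ + n₂)) := by
  set N := max 1 (n₁ + n₂) with hN
  have a1 : 1 ≤ N := le_max_left _ _
  have a2 : n₁ + n₂ ≤ N := le_max_right _ _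
  have b1 : d ≤ d * N := Nat.le_mul_of_pos_right _ a1
  have b2 : N ≤ d * N := Nat.le_mul_of_pos_left _ hd
  have b3 : d * n₁ ≤ d * N := Nat.mul_le_mul_left _ (by omega)
  have b4 : (n₁ + n₂) * d ≤ d * N := by rw [mul_comm]; exact Nat.mul_le_mul_left _ a2
  have e1 : d * (65000 * n₁ + 2100) = 65000 * (d * n₁) + 2100 * d := by ring
  have e2 : (n₁ + n₂) * (150 * d + 300) = 150 * ((n₁ + n₂) * d) + 300 * (n₁ + n₂) := by ring
  have e3 : (n₁ + n₂) * (d + 50) = (n₁ + n₂) * d + 50 * (n₁ + n₂) := by ring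
  rw [e1] at h₁
  rw [e2] at h₂
  rw [e3] at h₃
  generalize d * N = Y at *
  generalize d * n₁ = Y₁ at *
  generalize (n₁ + n₂) * d = Y₂ at *
  omega

/-- A hypercube with the required properties. -/
def IsSeparator {d n₁ n₂ : ℕ} (f : ℕ) (X : Fin (n₁ + n₂) → Set (Fin d → ℝ)) (c : Fin d → ℝ)
    (r : ℝ) : Prop :=
  0 < r ∧
  ({i | Crosses (X i) c r}.ncard : ℝ)
    ≤ crossConst f d * ((n₁ + n₂ : ℕ) : ℝ) ^ (1 - 1 / (d : ℝ)) ∧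
  (∃ M : Finset ℕ, M ⊆ Finset.range n₁ ∧ n₁ ≤ 4 ^ d * M.card ∧
    ∀ i : Fin n₁, (i : ℕ) ∈ M → ¬ LiesInside (X (Fin.castAdd n₂ i)) c r) ∧
  (∃ M : Finset ℕ, M ⊆ Finset.range n₁ ∧ n₁ ≤ 4 ^ d * M.card ∧
    ∀ i : Fin n₁, (i : ℕ) ∈ M → ¬ LiesOutside (X (Fin.castAdd n₂ i)) c r)

section Correctness

variable {d f n₁ n₂ : ℕ} {S₁ : Fin n₁ → Set (Fin d → ℝ)} {S₂ : Fin n₂ → Set (Fin d → ℝ)}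
  {rep center : Fin (n₁ + n₂) → Fin d → ℝ} {side : Fin (n₁ + n₂) → ℝ}

theorem isSeparator_tiny (hd : 1 ≤ d)
    (hS₁ : ∀ i j, i ≠ j → Disjoint (S₁ i) (S₁ j)) (hS₂ : ∀ i j, i ≠ j → Disjoint (S₂ i) (S₂ j))
    (hf₁ : IsFat f S₁) (hf₂ : IsFat f S₂) (hrep : ∀ i, rep i ∈ Fin.append S₁ S₂ i)
    (hmin : ∀ i, IsMinEnclosing (Fin.append S₁ S₂ i) (center i) (side i))
    {x : ℕ → ℕ → ℝ} {cn : ℕ → ℝ} {P : Finset ℕ} {w : ℝ} (hw : w ≤ 0)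
    (hL : Localized n₁ d x d P cn w)
    (hx : ∀ (i : Fin n₁) (j : Fin d), x i j = rep (Fin.castAdd n₂ i) j)
    {c' : Fin d → ℝ} {r : ℝ} (hr : 0 < r)
    (h0 : c' ⟨0, hd⟩ = cn 0 - r / 2) (hc : ∀ j : Fin d, 1 ≤ (j : ℕ) → c' j = cn j)
    (hside : ∀ i, side i ≤ 0 ∨ r ≤ side i)
    (hdist : ∀ i, dist (rep i) (fun j : Fin d => cn j) ≤ 0 ∨
      r < dist (rep i) (fun j : Fin d => cn j)) :
    IsSeparator f (Fin.append S₁ S₂) c' r := by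
  have hP : ∀ i : Fin n₁, (i : ℕ) ∈ P → rep (Fin.castAdd n₂ i) = fun j : Fin d => cn j := by
    intro i hi
    funext j
    have h1 := hL.close j j.2 i hi
    rw [hx] at h1
    have h2 := abs_nonneg (rep (Fin.castAdd n₂ i) j - cn j)
    exact sub_eq_zero.1 (abs_eq_zero.1 (by linarith))
  obtain ⟨hin, hint, -⟩ := tiny_cube_facts (c := fun j : Fin d => cn j) hd hr h0 hc
  refine ⟨hr, ?_, ⟨P, hL.sub, hL.card, fun i hi h => ?_⟩, ⟨P, hL.sub, hL.card, fun i hi h => ?_⟩⟩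
  · have hcr := tiny_crosses hd hS₁ hS₂ hf₁ hf₂ hrep hmin (c := fun j : Fin d => cn j) hr h0 hc
      hside hdist
    rcases Nat.eq_zero_or_pos (n₁ + n₂) with hn | hn
    · have hem : {i | Crosses (Fin.append S₁ S₂ i) c' r} = ∅ := by
        ext i
        exact absurd i.2 (by omega)
      rw [hem, Set.ncard_empty]
      unfold crossConst
      push_cast
      positivity
    · have h1 : (1 : ℝ) ≤ ((n₁ + n₂ : ℕ) : ℝ) ^ (1 - 1 / (d : ℝ)) := by
        apply Real.one_le_rpow (by exact_mod_cast hn)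
        have : (1 : ℝ) ≤ d := by exact_mod_cast hd
        rw [sub_nonneg, div_le_one (by linarith)]
        exact this
      have h2 : ({i | Crosses (Fin.append S₁ S₂ i) c' r}.ncard : ℝ) ≤ 2 * f + 2 := by
        have : (({i | Crosses (Fin.append S₁ S₂ i) c' r}.ncard : ℕ) : ℝ) ≤
          ((0 + (f + 1) + (f + 1) : ℕ) : ℝ) := by exact_mod_cast hcr
        push_cast at this
        linarith
      have h3 : (2 * f + 2 : ℝ) ≤ crossConst f d := by
        unfold crossConst
        have : (0 : ℝ) ≤ 1 + (4 * d * f : ℕ) * 16 ^ (d - 1) := by positivity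
        linarith
      have h4 : (0 : ℝ) ≤ crossConst f d := le_trans (by positivity) h3
      nlinarith
  · have := h (hrep (Fin.castAdd n₂ i))
    rw [hP i hi] at this
    exact hint this
  · have h1 := hrep (Fin.castAdd n₂ i)
    rw [hP i hi] at h1
    exact Set.disjoint_left.1 h h1 hin

theorem isSeparator_sweep (hd : 1 ≤ d)
    (hS₁ : ∀ i j, i ≠ j → Disjoint (S₁ i) (S₁ j)) (hS₂ : ∀ i j, i ≠ j → Disjoint (S₂ i) (S₂ j))
    (hf₁ : IsFat f S₁) (hf₂ : IsFat f S₂) (hrep : ∀ i, rep i ∈ Fin.append S₁ S₂ i)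
    (hmin : ∀ i, IsMinEnclosing (Fin.append S₁ S₂ i) (center i) (side i))
    {x : ℕ → ℕ → ℝ} {cn : ℕ → ℝ} {P : Finset ℕ} {w : ℝ} (hw : 0 < w)
    (hL : Localized n₁ d x d P cn w)
    (hx : ∀ (i : Fin n₁) (j : Fin d), x i j = rep (Fin.castAdd n₂ i) j)
    {g : ℕ → ℝ} {lo hi : ℝ} {k : ℕ}
    (hg : ∀ i : Fin (n₁ + n₂), g i / 2 = dist (rep i) (fun j : Fin d => cn j))
    (hlen : hi - lo = w / 2 / 2 ^ k) (hlo : w / 2 ≤ lo) (hhi : hi ≤ w)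
    (hk : n₁ + n₂ ≤ 2 ^ (d * k)) (hk' : k = 0 ∨ 2 ^ (d * (k - 1)) < n₁ + n₂)
    (hs : ((Finset.range (n₁ + n₂)).filter fun i => lo < g i ∧ g i < hi).card * 2 ^ k ≤
      n₁ + n₂) :
    IsSeparator f (Fin.append S₁ S₂) (fun j : Fin d => cn j) ((lo + hi) / 2) := by
  have hl : 0 < w / 2 / 2 ^ k := by positivity
  have hr : 0 < (lo + hi) / 2 := by linarith
  refine ⟨hr, ?_, ?_, ⟨P, hL.sub, hL.card, fun i hi' h => ?_⟩⟩
  · obtain ⟨e, rfl⟩ := Nat.exists_eq_add_of_le' hd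
    rcases Nat.eq_zero_or_pos (n₁ + n₂) with hn | hn
    · have hem : {i | Crosses (Fin.append S₁ S₂ i) (fun j => cn j) ((lo + hi) / 2)} = ∅ := by
        ext i
        exact absurd i.2 (by omega)
      rw [hem, Set.ncard_empty]
      unfold crossConst
      push_cast
      positivity
    · have h1 := sweep_crosses hS₁ hS₂ hf₁ hf₂ hrep hmin hw hg hlen hlo hhi
      have h2 := sweep_bound (a := 4 * (e + 1) * f) hn hk hk' hs
      refine (Nat.cast_le.2 h1).trans (h2.trans ?_)
      refine mul_le_mul_of_nonneg_right ?_ (by positivity)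
      unfold crossConst
      rw [Nat.add_sub_cancel]
      have : (0 : ℝ) ≤ 2 * f + 2 := by positivity
      linarith
  · obtain ⟨M, hM1, hM2, hM3⟩ := hL.sep cn ((lo + hi) / 2) (by linarith)
    refine ⟨M, hM1, hM2, fun i hi' h => ?_⟩
    obtain ⟨j, hj, hlt⟩ := hM3 i hi'
    have h1 : rep (Fin.castAdd n₂ i) ∈ cube (fun j : Fin d => cn j) ((lo + hi) / 2) :=
      interior_subset (h (hrep _))
    have h2 := h1 ⟨j, hj⟩
    rw [← hx] at h2
    exact absurd hlt (not_lt.2 h2)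
  · refine Set.disjoint_left.1 h (hrep (Fin.castAdd n₂ i)) fun j => ?_
    rw [← hx]
    exact (hL.close j j.2 i hi').trans (by linarith)

theorem mainCmd_spec (hd : 1 ≤ d)
    (hS₁ : ∀ i j, i ≠ j → Disjoint (S₁ i) (S₁ j)) (hS₂ : ∀ i j, i ≠ j → Disjoint (S₂ i) (S₂ j))
    (hf₁ : IsFat f S₁) (hf₂ : IsFat f S₂) (hrep : ∀ i, rep i ∈ Fin.append S₁ S₂ i)
    (hmin : ∀ i, IsMinEnclosing (Fin.append S₁ S₂ i) (center i) (side i))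
    {σ : State} (hσ : IsInput n₁ n₂ rep center side σ) :
    W (Fin.append S₁ S₂) [selectCmd] mainCmd σ fun τ t =>
      t ≤ 100000 * (d * max 1 (n₁ + n₂)) ∧
      ∃ (c : Fin d → ℝ) (r : ℝ), IsSeparator f (Fin.append S₁ S₂) c r ∧
        (∀ j : Fin d, τ.real (τ.nat 0 + j) = c j) ∧ τ.real (τ.nat 0 + d) = r ∧
        ∀ i : Fin (n₁ + n₂), τ.nat (τ.nat 1 + i) = position (Fin.append S₁ S₂ i) c r := by
  obtain ⟨hσ0, hσ1, hσ2, hobj⟩ := hσ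
  unfold mainCmd
  refine .seq ((prepareCmd_spec rfl σ (by omega)).mono ?_)
  rintro τ t ⟨T, L, P, hL⟩
  have L0 := L.nat0
  have L3 := L.nat3
  have L4 := L.nat4
  have L6 := L.nat6
  rw [hσ0] at L0 L6
  rw [hσ1, hσ2] at L3
  rw [hσ0, hσ1, hσ2] at L4
  rw [hσ0, hσ1] at hL T
  have hidx : ∀ i : Fin (n₁ + n₂), (i : ℕ) * (2 * d + 1) + (2 * d + 1) ≤ τ.nat 4 := by
    intro i
    rw [L4, ← Nat.succ_mul]
    exact Nat.mul_le_mul_right _ i.2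
  have hcoord : ∀ (i : Fin (n₁ + n₂)) (j : Fin d), coord τ i j = rep i j := by
    intro i j
    have h1 := hidx i
    have h2 := j.2
    unfold coord
    rw [L0, L.real _ (by omega), (hobj i).1 j]
  have hsd : ∀ i : Fin (n₁ + n₂), τ.real (i * (2 * d + 1) + 2 * d) = side i := by
    intro i
    have h1 := hidx i
    rw [L.real _ (by omega), (hobj i).2.2]
  have hx : ∀ (i : Fin n₁) (j : Fin d), coord σ i j = rep (Fin.castAdd n₂ i) j := by
    intro i j
    have := (hobj (Fin.castAdd n₂ i)).1 j
    unfold coord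
    rw [hσ0]
    simpa using this
  refine .seq (W.mono (Q := fun υ t => t ≤ (n₁ + n₂) * (150 * d + 300) + 1000 * (n₁ + n₂) +
    50 * d + 2000 ∧ Kept τ υ ∧ IsSeparator f (Fin.append S₁ S₂)
      (fun j => υ.real (τ.nat 4 + 16 + j)) (υ.real (τ.nat 4 + 16 + d))) ?_ ?_)
  · have h4 : τ.nat 4 = τ.nat 3 * (2 * τ.nat 0 + 1) := by rw [L4, L3, L0]
    refine .ite ?_ ?_
    · intro hw
      simp at hw
      refine (tinyCmd_spec τ h4 (by omega)).mono ?_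
      rintro υ t' ⟨T', K, r, hr, hr1, hr2, hr3, hr4⟩
      rw [L3, L0] at T'
      rw [L0] at hr1 hr3 hr4
      rw [L3] at hr4
      refine ⟨by simp; omega, K, ?_⟩
      rw [hr1]
      refine isSeparator_tiny hd hS₁ hS₂ hf₁ hf₂ hrep hmin hw hL hx hr hr2
        (fun j hj => hr3 j hj j.2) (fun i => ?_) (fun i => ?_)
      · rw [← hsd i]
        exact (hr4 i i.2).1
      · obtain ⟨D, hD1, hD2⟩ := (hr4 i i.2).2
        rwa [hD1.eq_dist (p := rep i) (q := fun j : Fin d => τ.real (τ.nat 4 + 16 + j))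
          (hcoord i) (fun _ => rfl)] at hD2
    · intro hw
      simp at hw
      refine (sweepCmd_spec τ h4 (by omega) (by omega) hw).mono ?_
      rintro υ t' ⟨T', K, hc, g, lo, hi, k, hg, hr, hlen, hlo, hhi, hk, hk', hs⟩
      rw [L3, L0] at T' hk hk'
      rw [L3] at hs hg
      rw [L0] at hr hc hg
      refine ⟨?_, K, ?_⟩
      · have : (n₁ + n₂) * (150 * d + 200) ≤ (n₁ + n₂) * (150 * d + 300) :=
          Nat.mul_le_mul_left _ (by omega)
        simp
        omega
      · rw [hr, show (fun j : Fin d => υ.real (τ.nat 4 + 16 + j)) =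
          fun j : Fin d => τ.real (τ.nat 4 + 16 + j) from funext fun j => hc j j.2]
        refine isSeparator_sweep hd hS₁ hS₂ hf₁ hf₂ hrep hmin (x := coord σ)
          (cn := fun k => τ.real (τ.nat 4 + 16 + k)) hw hL hx
          (fun i => (hg i i.2).eq_dist (hcoord i) fun _ => rfl) hlen hlo hhi hk hk' hs
  · rintro υ t' ⟨T', K, hsep⟩
    refine (outputCmd_spec υ (by rw [K.nat3, L3])).mono ?_
    rintro φ t'' ⟨T'', R, o0, o1, hpos⟩
    rw [K.nat4] at o0 hpos
    refine ⟨running_time_le hd T T' T'', _, _, hsep, fun j => by rw [R, o0], by rw [R, o0], ?_⟩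
    intro i
    rw [o1]
    exact hpos i

end Correctness

end FatSep

theorem lemmal :
    ∃ (prog : FatSep.Program) (C : ℕ) (K : ℕ → ℕ → ℝ),
      ∀ (d f n₁ n₂ : ℕ) (S₁ : Fin n₁ → Set (Fin d → ℝ)) (S₂ : Fin n₂ → Set (Fin d → ℝ))
        (rep center : Fin (n₁ + n₂) → Fin d → ℝ) (side : Fin (n₁ + n₂) → ℝ)
        (σ : FatSep.State),
        1 ≤ d →
        (∀ i, IsConnected (S₁ i)) → (∀ i, IsConnected (S₂ i)) →
        (∀ i j, i ≠ j → Disjoint (S₁ i) (S₁ j)) → (∀ i j, i ≠ j → Disjoint (S₂ i) (S₂ j)) →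
        FatSep.IsFat f S₁ → FatSep.IsFat f S₂ →
        (∀ i, rep i ∈ Fin.append S₁ S₂ i) →
        (∀ i, FatSep.IsMinEnclosing (Fin.append S₁ S₂ i) (center i) (side i)) →
        FatSep.IsInput n₁ n₂ rep center side σ →
        ∃ (τ : FatSep.State) (t : ℕ) (c : Fin d → ℝ) (r : ℝ)
          (inside outside : Set (Fin (n₁ + n₂))),
          FatSep.Exec (Fin.append S₁ S₂) prog.procs prog.main σ τ t ∧
          t ≤ C * (d * max 1 (n₁ + n₂)) ∧
          FatSep.IsOutput τ c r inside outside ∧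
          0 < r ∧
          (∀ i, i ∈ inside ↔ FatSep.LiesInside (Fin.append S₁ S₂ i) c r) ∧
          (∀ i, i ∈ outside ↔ FatSep.LiesOutside (Fin.append S₁ S₂ i) c r) ∧
          ({i | FatSep.Crosses (Fin.append S₁ S₂ i) c r}.ncard : ℝ)
            ≤ K f d * ((n₁ + n₂ : ℕ) : ℝ) ^ (1 - 1 / (d : ℝ)) ∧
          ({i : Fin n₁ | Fin.castAdd n₂ i ∈ inside}.ncard : ℝ)
            ≤ ((4 : ℝ) ^ d - 1) / (4 : ℝ) ^ d * (n₁ : ℝ) ∧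
          ({i : Fin n₁ | Fin.castAdd n₂ i ∈ outside}.ncard : ℝ)
            ≤ ((4 : ℝ) ^ d - 1) / (4 : ℝ) ^ d * (n₁ : ℝ) := by
  refine ⟨⟨FatSep.mainCmd, [FatSep.selectCmd]⟩, 100000, FatSep.crossConst, ?_⟩
  intro d f n₁ n₂ S₁ S₂ rep center side σ hd _ _ hS₁ hS₂ hf₁ hf₂ hrep hmin hσ
  obtain ⟨τ, t, hexec, ht, c, r, ⟨hr, hcross, ⟨M, hM1, hM2, hM3⟩, ⟨M', hM1', hM2', hM3'⟩⟩,
    hc, hrr, hpos⟩ := FatSep.mainCmd_spec hd hS₁ hS₂ hf₁ hf₂ hrep hmin hσ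
  refine ⟨τ, t, c, r, {i | FatSep.LiesInside (Fin.append S₁ S₂ i) c r},
    {i | FatSep.LiesOutside (Fin.append S₁ S₂ i) c r}, hexec, ht, ⟨hc, hrr, fun i => ?_⟩, hr,
    fun i => Iff.rfl, fun i => Iff.rfl, hcross, FatSep.ncard_le_of_missed hM1 hM2 hM3,
    FatSep.ncard_le_of_missed hM1' hM2' hM3'⟩
  rw [hpos i]
  exact ⟨FatSep.position_le_two _ _ _, FatSep.liesInside_iff _ _ _,
    FatSep.liesOutside_iff ⟨_, hrep i⟩ _ _⟩
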